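/- Let $c\colon\mathbb{N}=\{1,2,\dots\}\to[0,\infty)$ be bounded and not identically zero. Let $T(x)=\frac1x-\lfloor\frac1x\rfloor$ for $x\in(0,1]$ and $T(0)=0$ be the Gauss map, $\xi(x)=\frac{1}{(\log 2)(1+x)}$, and put \[\mathfrak h(T)=\int_0^1\log|T'(x)|\,\xi(x)\,dx,\qquad \mu=\frac{2}{\mathfrak h(T)}\sum_{n=1}^\infty c(n)\int_{1/(n+1)}^{1/n}\xi(x)\,dx,\] $\psi(x)=c(n)+\mu\log x$ for $x\in(\frac1{n+1},\frac1n]$, $n\ge1$, and $\psi(0)=0$. Let $\mathbb D=\{z\in\mathbb C:|z-\frac23|<1\}$, let $H^\infty(\mathbb D)$ be the Banach space of bounded holomorphic functions on $\mathbb D$ with the uniform norm, and for $s,\omega\in\mathbb C$ with $\Re(2s+\mu\omega)>1$ let $\mathcal L_{s,\omega}$ be the bounded operator on $H^\infty(\mathbb D)$ given by \[(\mathcal L_{s,\omega}f)(z)=\sum_{n=1}^\infty\frac{e^{\omega c(n)}}{(z+n)^{2s+\mu\omega}}f\Big(\frac1{z+n}\Big),\] where the powers are defined by the principal logarithm. A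 \emph{leading eigenvalue function} is a function $\lambda\colon\mathcal V\to\mathbb C$ on an open set $\mathcal V\subset\mathbb C^2$ with $(1,0)\in\mathcal V$ and $\Re(2s+\mu\omega)>1$ on $\mathcal V$, such that for $(s,\omega)\in\mathcal V$ one can write $\mathcal L_{s,\omega}=\lambda(s,\omega)\mathcal P_{s,\omega}+\mathcal N_{s,\omega}$, where $\mathcal P_{s,\omega},\mathcal N_{s,\omega}$ are bounded operators on $H^\infty(\mathbb D)$ with $\mathcal P_{s,\omega}\mathcal N_{s,\omega}=\mathcal N_{s,\omega}\mathcal P_{s,\omega}=0$, $\mathcal P_{s,\omega}$ is a projection onto a one-dimensional subspace which is the eigenspace of $\mathcal L_{s,\omega}$ for the eigenvalue $\lambda(s,\omega)$, $\mathcal N_{s,\omega}$ has spectral radius strictly less than $1$, and $\lambda$, $\mathcal P$, $\mathcal N$ depend holomorphically on $(s,\omega)\in\mathcal V$. A leading eigenvalue function exists, and every leading eigenvalue function $\lambda$ satisfies \[\frac{\partial\lambda}{\partial s}(1,0)=-\mathfrak h(T)<0,\qquad \frac{\partial\lambda}{\partial\omega}(1,0)=0,\] \[\frac{\partial^2\lambda}{\partial\omega^2}(1,0)=\lim_{n\to\infty}\frac1n\int_0^1\Big(\sum_{k=0}^{n-1}\psi(T^kx)\Big)^2\xi(x)\,dx>0,\]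 where all the integrals are finite and the limit exists. -/

import Mathlib

open Filter Topology MeasureTheory

noncomputable section

namespace GaussEuclid

/-! ### The Gauss map, its invariant density, the cost and the mean -/

/-- The Gauss map `T x = 1/x - ⌊1/x⌋` (with `T 0 = 0`). -/
def gaussMap (x : ℝ) : ℝ := 1 / x - ⌊1 / x⌋

/-- The Gauss density `ξ x = 1 / (log 2 * (1 + x))`. -/
def xi (x : ℝ) : ℝ := 1 / (Real.log 2 * (1 + x))

/-- `𝔥(T) = ∫₀¹ log |T'(x)| ξ(x) dx`. -/
def entropy : ℝ := ∫ x in (0 : ℝ)..1, Real.log |deriv gaussMap x| * xi x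

/-- `μ = (2 / 𝔥(T)) ∑_{n ≥ 1} c(n) ∫_{1/(n+1)}^{1/n} ξ(x) dx`; the summation index is `m = n - 1`. -/
def mean (c : ℕ → ℝ) : ℝ :=
  2 / entropy *
    ∑' m : ℕ, c (m + 1) * ∫ x in (1 / ((m : ℝ) + 2))..(1 / ((m : ℝ) + 1)), xi x

/-- `ψ(x) = c(n) + μ log x` for `1/(n+1) < x ≤ 1/n`, that is for `n = ⌊1/x⌋`, and `ψ(0) = 0`. -/
def psi (c : ℕ → ℝ) (x : ℝ) : ℝ :=
  if 0 < x ∧ x ≤ 1 then c ⌊1 / x⌋₊ + mean c * Real.log x else 0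

/-! ### The Banach space of bounded holomorphic functions on the disc -/

/-- The open disc `{z : |z - 2/3| < 1}`. -/
def disc : Set ℂ := Metric.ball (2 / 3 : ℂ) 1

/-- Extension by zero of a function on the disc. -/
def zeroExt (f : disc → ℂ) (z : ℂ) : ℂ :=
  open Classical in if h : z ∈ disc then f ⟨z, h⟩ else 0

theorem zeroExt_of_mem (f : disc → ℂ) {z : ℂ} (h : z ∈ disc) : zeroExt f z = f ⟨z, h⟩ := by
  simp [zeroExt, h]

/-- `H^∞(𝔻)`: bounded holomorphic functions on the disc, with the norm inherited from the bounded
continuous functions on the disc, which is the uniform norm. -/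
def Hinf : Submodule ℂ (BoundedContinuousFunction disc ℂ) where
  carrier := {f | DifferentiableOn ℂ (zeroExt f) disc}
  zero_mem' := by
    refine (differentiableOn_const (0 : ℂ)).congr fun z hz => ?_
    simp [zeroExt_of_mem _ hz]
  add_mem' := by
    intro f g hf hg
    refine (DifferentiableOn.add hf hg).congr fun z hz => ?_
    simp [zeroExt_of_mem _ hz]
  smul_mem' := by
    intro a f hf
    refine (DifferentiableOn.const_smul hf a).congr fun z hz => ?_
    simp [zeroExt_of_mem _ hz]

/-! ### The transfer operator -/

/-- The exponent `2 s + μ ω`. -/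
def expo (c : ℕ → ℝ) (s ω : ℂ) : ℂ := 2 * s + (mean c : ℂ) * ω

/-- The summand `e^{ω c(n)} (z+n)^{-(2s + μω)} f(1/(z+n))` of the transfer operator, with
`n = m + 1`. The power is the principal one, and `z + n` has positive real part. -/
def transferTerm (c : ℕ → ℝ) (s ω : ℂ) (f : disc → ℂ) (m : ℕ) (z : ℂ) : ℂ :=
  Complex.exp (ω * (c (m + 1) : ℂ)) / (z + ((m : ℂ) + 1)) ^ expo c s ω *
    zeroExt f (1 / (z + ((m : ℂ) + 1)))

/-- The conditions under which the series of the transfer operator is considered: `c` is bounded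
and `Re (2 s + μ ω) > 1`. -/
def Admissible (c : ℕ → ℝ) (s ω : ℂ) : Prop :=
  (∃ B : ℝ, ∀ n, 1 ≤ n → |c n| ≤ B) ∧ 1 < (expo c s ω).re

theorem re_add_lower {z : ℂ} (hz : z ∈ disc) (m : ℕ) :
    (m : ℝ) + 2 / 3 < (z + ((m : ℂ) + 1)).re := by
  have h1 : |(z - 2 / 3 : ℂ).re| < 1 := by
    refine lt_of_le_of_lt (Complex.abs_re_le_norm _) ?_
    simpa [disc, Metric.mem_ball, dist_eq_norm] using hz
  have h2 : (z - 2 / 3 : ℂ).re = z.re - 2 / 3 := by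
    simp [Complex.sub_re]
  rw [h2, abs_lt] at h1
  simp only [Complex.add_re, Complex.natCast_re, Complex.one_re]
  linarith [h1.1]

theorem inv_mem_disc {z : ℂ} (hz : z ∈ disc) (m : ℕ) : 1 / (z + ((m : ℂ) + 1)) ∈ disc := by
  have hre := re_add_lower hz m
  set w : ℂ := z + ((m : ℂ) + 1) with hw
  have hm : (0 : ℝ) ≤ m := Nat.cast_nonneg m
  have hw0 : w ≠ 0 := by
    intro h
    rw [h, Complex.zero_re] at hre
    linarith
  have hwn : 0 < ‖w‖ := norm_pos_iff.mpr hw0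
  have hkey : ‖3 - 2 * w‖ < 3 * ‖w‖ := by
    refine lt_of_pow_lt_pow_left₀ 2 (by positivity) ?_
    rw [mul_pow, Complex.sq_norm, Complex.sq_norm, Complex.normSq_apply, Complex.normSq_apply]
    have e1 : (3 - 2 * w : ℂ).re = 3 - 2 * w.re := by simp
    have e2 : (3 - 2 * w : ℂ).im = -2 * w.im := by simp
    rw [e1, e2]
    nlinarith [sq_nonneg w.im]
  have heq : 1 / w - 2 / 3 = (3 - 2 * w) / (3 * w) := by
    field_simp
  rw [disc, Metric.mem_ball, dist_eq_norm, heq, norm_div, norm_mul]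
  rw [div_lt_one (by simpa using hwn)]
  simpa using hkey

theorem transferTerm_bound {c : ℕ → ℝ} {s ω : ℂ} (h : Admissible c s ω) :
    ∃ u : ℕ → ℝ, Summable u ∧ ∀ (f : BoundedContinuousFunction disc ℂ) (m : ℕ) (z : ℂ),
      z ∈ disc → ‖transferTerm c s ω f m z‖ ≤ u m * ‖f‖ := by
  obtain ⟨⟨B, hB⟩, ha⟩ := h
  set a := expo c s ω with ha'
  refine ⟨fun m => Real.exp (‖ω‖ * B) * Real.exp (Real.pi * |a.im|) *
    ((m : ℝ) + 2 / 3) ^ (-a.re), ?_, ?_⟩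
  · refine Summable.mul_left _ ?_
    rw [← summable_nat_add_iff 1]
    have hs : Summable fun m : ℕ => ((m : ℝ) + 1) ^ (-a.re) := by
      have := (Real.summable_nat_rpow (p := -a.re)).mpr (by linarith)
      rw [← summable_nat_add_iff 1] at this
      simpa using this
    refine Summable.of_nonneg_of_le (fun m => by positivity) (fun m => ?_) hs
    push_cast
    exact Real.rpow_le_rpow_of_nonpos (by positivity) (by linarith) (by linarith)
  · intro f m z hz
    have hre := re_add_lower hz m
    have hm : (0 : ℝ) ≤ m := Nat.cast_nonneg m
    have hmem := inv_mem_disc hz m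
    rw [transferTerm, zeroExt_of_mem _ hmem, norm_mul, norm_div, ← ha', div_eq_mul_inv]
    set w : ℂ := z + ((m : ℂ) + 1) with hw
    have hwn : (m : ℝ) + 2 / 3 ≤ ‖w‖ := hre.le.trans (Complex.re_le_norm w)
    have hw0 : w ≠ 0 := norm_pos_iff.mp (by linarith)
    have b1 : ‖Complex.exp (ω * (c (m + 1) : ℂ))‖ ≤ Real.exp (‖ω‖ * B) := by
      rw [Complex.norm_exp]
      refine Real.exp_le_exp.mpr ((Complex.re_le_norm _).trans ?_)
      rw [norm_mul, Complex.norm_real, Real.norm_eq_abs]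
      exact mul_le_mul_of_nonneg_left (hB (m + 1) (by omega)) (norm_nonneg _)
    have b2 : ‖w ^ a‖⁻¹ ≤ Real.exp (Real.pi * |a.im|) * ((m : ℝ) + 2 / 3) ^ (-a.re) := by
      rw [Complex.norm_cpow_of_ne_zero hw0, inv_div, div_eq_mul_inv,
        ← Real.rpow_neg (norm_nonneg w)]
      refine mul_le_mul (Real.exp_le_exp.mpr ?_)
        (Real.rpow_le_rpow_of_nonpos (by positivity) hwn (by linarith)) (by positivity)
        (by positivity)
      refine (le_abs_self _).trans ?_
      rw [abs_mul]
      exact mul_le_mul_of_nonneg_right (Complex.abs_arg_le_pi w) (abs_nonneg _)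
    beta_reduce
    rw [mul_assoc (Real.exp (‖ω‖ * B)) (Real.exp (Real.pi * |a.im|))]
    refine mul_le_mul (mul_le_mul b1 b2 (by positivity) (by positivity))
      (f.norm_coe_le_norm _) (norm_nonneg _) (by positivity)

theorem transferTerm_differentiableOn (c : ℕ → ℝ) (s ω : ℂ) (f : Hinf) (m : ℕ) :
    DifferentiableOn ℂ (transferTerm c s ω f.1 m) disc := by
  have hlin : DifferentiableOn ℂ (fun z : ℂ => z + ((m : ℂ) + 1)) disc := by fun_prop
  have hslit : ∀ z ∈ disc, z + ((m : ℂ) + 1) ∈ Complex.slitPlane := fun z hz =>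
    Or.inl (lt_trans (by positivity) (re_add_lower hz m))
  have hne : ∀ z ∈ disc, z + ((m : ℂ) + 1) ≠ 0 := fun z hz =>
    Complex.slitPlane_ne_zero (hslit z hz)
  refine DifferentiableOn.mul (DifferentiableOn.div (differentiableOn_const _) ?_ ?_) ?_
  · exact hlin.cpow_const hslit
  · intro z hz
    simp [Complex.cpow_eq_zero_iff, hne z hz]
  · exact DifferentiableOn.comp (t := disc) f.2
      ((differentiableOn_const (1 : ℂ)).div hlin hne) fun z hz => inv_mem_disc hz m

theorem transferTerm_summable {c : ℕ → ℝ} {s ω : ℂ} (h : Admissible c s ω)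
    (f : BoundedContinuousFunction disc ℂ) {z : ℂ} (hz : z ∈ disc) :
    Summable fun m => transferTerm c s ω f m z := by
  obtain ⟨u, hu, hb⟩ := transferTerm_bound h
  exact Summable.of_norm_bounded (hu.mul_right ‖f‖) fun m => hb f m z hz

/-- The function `(𝓛_{s,ω} f)(z) = ∑_{n ≥ 1} e^{ω c(n)} (z+n)^{-(2s + μω)} f(1/(z+n))`. -/
def transferFun (c : ℕ → ℝ) (s ω : ℂ) (f : disc → ℂ) (z : ℂ) : ℂ :=
  ∑' m : ℕ, transferTerm c s ω f m z

theorem transferFun_differentiableOn {c : ℕ → ℝ} {s ω : ℂ} (h : Admissible c s ω) (f : Hinf) :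
    DifferentiableOn ℂ (transferFun c s ω f.1) disc := by
  obtain ⟨u, hu, hb⟩ := transferTerm_bound h
  exact Complex.differentiableOn_tsum_of_summable_norm (hu.mul_right ‖f.1‖)
    (fun m => transferTerm_differentiableOn c s ω f m) Metric.isOpen_ball
    fun m z hz => hb f.1 m z hz

theorem transferFun_bound {c : ℕ → ℝ} {s ω : ℂ} (h : Admissible c s ω) :
    ∃ C : ℝ, 0 ≤ C ∧ ∀ (f : BoundedContinuousFunction disc ℂ) (z : ℂ),
      z ∈ disc → ‖transferFun c s ω f z‖ ≤ C * ‖f‖ := by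
  obtain ⟨u, hu, hb⟩ := transferTerm_bound h
  refine ⟨|∑' m, u m|, abs_nonneg _, fun f z hz => ?_⟩
  have h1 := tsum_of_norm_bounded (hu.mul_right ‖f‖).hasSum fun m => hb f m z hz
  rw [tsum_mul_right] at h1
  exact h1.trans (mul_le_mul_of_nonneg_right (le_abs_self _) (norm_nonneg _))

/-- `𝓛_{s,ω} f` as an element of `H^∞(𝔻)`. -/
def transferElem {c : ℕ → ℝ} {s ω : ℂ} (h : Admissible c s ω) (f : Hinf) : Hinf :=
  ⟨BoundedContinuousFunction.ofNormedAddCommGroup (fun z : disc => transferFun c s ω f.1 z)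
      ((transferFun_differentiableOn h f).continuousOn.domRestrict)
      ((transferFun_bound h).choose * ‖f.1‖)
      (fun z => (transferFun_bound h).choose_spec.2 f.1 z z.2),
    (transferFun_differentiableOn h f).congr fun z hz => by
      rw [zeroExt_of_mem _ hz]; rfl⟩

theorem transferElem_apply {c : ℕ → ℝ} {s ω : ℂ} (h : Admissible c s ω) (f : Hinf) (z : disc) :
    (transferElem h f).1 z = transferFun c s ω f.1 z := rfl

/-- `𝓛_{s,ω}` as a bounded operator on `H^∞(𝔻)`, for admissible parameters. -/
def transferCLM {c : ℕ → ℝ} {s ω : ℂ} (h : Admissible c s ω) : Hinf →L[ℂ] Hinf :=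
  LinearMap.mkContinuous
    { toFun := transferElem h
      map_add' := fun f g => by
        ext z
        change transferFun c s ω (f + g).1 z = transferFun c s ω f.1 z + transferFun c s ω g.1 z
        rw [transferFun, transferFun, transferFun,
          ← (transferTerm_summable h f.1 z.2).tsum_add (transferTerm_summable h g.1 z.2)]
        refine tsum_congr fun m => ?_
        simp only [transferTerm, zeroExt_of_mem _ (inv_mem_disc z.2 m)]
        simp [mul_add]
      map_smul' := fun a f => by
        ext z
        change transferFun c s ω (a • f).1 z = a * transferFun c s ω f.1 z
        rw [transferFun, transferFun, ← tsum_mul_left]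
        refine tsum_congr fun m => ?_
        simp only [transferTerm, zeroExt_of_mem _ (inv_mem_disc z.2 m)]
        simp [mul_left_comm] }
    (transferFun_bound h).choose
    (fun f => by
      refine (BoundedContinuousFunction.norm_le
        (mul_nonneg (transferFun_bound h).choose_spec.1 (norm_nonneg _))).mpr fun z => ?_
      exact (transferFun_bound h).choose_spec.2 f.1 z z.2)

open Classical in
/-- The transfer operator `𝓛_{s,ω}` on `H^∞(𝔻)`; it is only used for admissible parameters. -/
def transferOperator (c : ℕ → ℝ) (s ω : ℂ) : Hinf →L[ℂ] Hinf :=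
  if h : Admissible c s ω then transferCLM h else 0

theorem transferOperator_apply {c : ℕ → ℝ} {s ω : ℂ} (h : Admissible c s ω) (f : Hinf)
    (z : disc) : (transferOperator c s ω f).1 z = transferFun c s ω f.1 z := by
  rw [transferOperator, dif_pos h]
  rfl

/-! ### The leading eigenvalue -/

/-- `λ` is a leading eigenvalue function of the family `𝓛_{s,ω}` on the open neighbourhood `V` of
`(1,0)`: there `𝓛 = λ 𝓟 + 𝓝` with `𝓟 𝓝 = 𝓝 𝓟 = 0`, `𝓟` a projection onto a one-dimensional
eigenspace of `𝓛`, `ρ(𝓝) < 1`, and `λ`, `𝓟`, `𝓝` depend holomorphically on `(s,ω)`. -/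
structure IsLeadingDecomposition (c : ℕ → ℝ) (V : Set (ℂ × ℂ)) (lam : ℂ × ℂ → ℂ)
    (P N : ℂ × ℂ → (Hinf →L[ℂ] Hinf)) : Prop where
  isOpen : IsOpen V
  mem : ((1, 0) : ℂ × ℂ) ∈ V
  admissible : ∀ p ∈ V, Admissible c p.1 p.2
  lam_analytic : AnalyticOnNhd ℂ lam V
  P_analytic : AnalyticOnNhd ℂ P V
  N_analytic : AnalyticOnNhd ℂ N V
  decomp : ∀ p ∈ V, transferOperator c p.1 p.2 = lam p • P p + N p
  P_comp_N : ∀ p ∈ V, (P p).comp (N p) = 0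
  N_comp_P : ∀ p ∈ V, (N p).comp (P p) = 0
  P_proj : ∀ p ∈ V, (P p).comp (P p) = P p
  finrank_range : ∀ p ∈ V, Module.finrank ℂ (LinearMap.range (P p).toLinearMap) = 1
  range_eq_eigenspace : ∀ p ∈ V, LinearMap.range (P p).toLinearMap =
    Module.End.eigenspace (transferOperator c p.1 p.2).toLinearMap (lam p)
  spectralRadius_lt : ∀ p ∈ V, spectralRadius ℂ (N p) < 1

end GaussEuclid

end

set_option autoImplicit false

/-! ### The space `H^∞(𝔻)`, its functionals and the Gauss density. -/

noncomputable section

namespace GaussEuclid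

/-! Existence is a perturbation argument. At `(1, 0)` the transfer operator is the Gauss operator
`L`, whatever the cost. It fixes the Gauss density (`transferOperator_density`) and preserves `∫₀¹
f` (`meanCLM_transferOperator`). The inverse branches send the disc into a smaller closed ball, so
`L` is compact (`isCompactOperator_transferOperator`). By rigidity in the maximum principle on `[0,
1]`, an eigenfunction for an eigenvalue of modulus at least one is a multiple of the density
(`eq_smul_density_of_eigenvector`). Hence `L` minus its rank-one part has spectral radius below one.
The family is jointly analytic near `(1, 0)` (`contDiffAt_transferOperator`), and the implicit
function theorem, applied to right and left eigenvectors, continues the eigenvalue and its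
projection (`exists_analytic_rank_one_decomposition`).

The derivatives are found for an arbitrary decomposition, along a line `(1 + a t, b t)`. Let `v(t)`
be the eigenfunction obtained by projecting the density and normalising its integral to 1. Duality
(`integral_transferOperator_mul`) gives `λ(t) ∫ v(t) g = ∫ v(t) e^{tφ} g ∘ T` with `φ = 2 a log + b
ψ`. Exponential moments of `φ` allow an expansion in `t` with error `O(t³)`, uniformly on bounded
sets of `v`. Comparing coefficients (`IsLeadingDecomposition.exists_derivatives`) gives, with `γ`
the Gauss measure, `λ' = ∫ φ dγ`, `λ'' = ∫ φ² dγ + 2 ∫ v'(0) φ`, and a functional equation for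
`v'(0)`. For `φ = 2 log` the first derivative is minus the entropy; for `φ = ψ` it vanishes, by the
choice of `μ`.

For `φ = ψ`, write `w = v'(0)/ξ` and `h = Re w`. The functional equation says that `m = ψ + h - h ∘
T` is orthogonal to every bounded `g ∘ T`, so `ψ` is a reversed martingale difference up to a
bounded coboundary. Birkhoff sums of `m` have second moment exactly `n ∫ m²`, and the coboundary
does not affect the limit (`tendsto_variance_of_martingale_coboundary`). The limit `∫ m² = ∫ ψ² + 2
∫ ψ h` is `λ''`, since `Im w` is `T`-invariant and so contributes nothing. It is positive: otherwise
`ψ = h ∘ T - h` almost everywhere would be bounded, while `μ log x` is unbounded at 0 and `c` is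
bounded. -/

theorem isOpen_disc : IsOpen disc := Metric.isOpen_ball

theorem re_gt_of_mem_disc {z : ℂ} (hz : z ∈ disc) : -(1 / 3) < z.re := by
  have h := re_add_lower hz 0
  norm_num at h
  linarith

theorem mem_disc_of_mem_Icc {x : ℝ} (hx : x ∈ Set.Icc (0 : ℝ) 1) : (x : ℂ) ∈ disc := by
  rw [disc, Metric.mem_ball, dist_eq_norm]
  have : (x : ℂ) - 2 / 3 = ((x - 2 / 3 : ℝ) : ℂ) := by push_cast; ring
  rw [this, Complex.norm_real, Real.norm_eq_abs, abs_lt]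
  constructor <;> linarith [hx.1, hx.2]

theorem one_add_ne_zero {z : ℂ} (hz : z ∈ disc) : 1 + z ≠ 0 := by
  intro h
  have := congrArg Complex.re h
  simp only [Complex.add_re, Complex.one_re, Complex.zero_re] at this
  linarith [re_gt_of_mem_disc hz]

/-- Locally uniform limits of holomorphic functions are holomorphic, so `Hinf` is closed in the
bounded continuous functions. -/
instance : CompleteSpace Hinf := by
  refine IsClosed.completeSpace_coe (s := (Hinf : Set (BoundedContinuousFunction disc ℂ))) (hs := ?_)
  refine isClosed_of_closure_subset fun f hf => ?_
  obtain ⟨u, hu, hlim⟩ := mem_closure_iff_seq_limit.mp hf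
  have hunif : TendstoUniformly (fun n => ⇑(u n)) f atTop :=
    BoundedContinuousFunction.tendsto_iff_tendstoUniformly.mp hlim
  have h2 : TendstoUniformlyOn (fun n => zeroExt (u n)) (zeroExt f) atTop disc := by
    rw [Metric.tendstoUniformlyOn_iff]
    intro ε hε
    filter_upwards [Metric.tendstoUniformly_iff.mp hunif ε hε] with n hn z hz
    rw [zeroExt_of_mem _ hz, zeroExt_of_mem _ hz]
    exact hn ⟨z, hz⟩
  exact h2.tendstoLocallyUniformlyOn.differentiableOn (Eventually.of_forall fun n => hu n) isOpen_disc

/-- The element of `H^∞(𝔻)` given by a bounded holomorphic function. -/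
def Hinf.of (F : ℂ → ℂ) (hd : DifferentiableOn ℂ F disc) (hb : ∃ C, ∀ z ∈ disc, ‖F z‖ ≤ C) :
    Hinf :=
  ⟨BoundedContinuousFunction.ofNormedAddCommGroup (fun z : disc => F z)
      hd.continuousOn.domRestrict hb.choose (fun z => hb.choose_spec z z.2),
    hd.congr fun z hz => by rw [zeroExt_of_mem _ hz]; rfl⟩

open Classical in
/-- Evaluation of an element of `H^∞(𝔻)`, extended by zero outside of the disc. -/
def evalAt (z : ℂ) : Hinf →L[ℂ] ℂ :=
  if h : z ∈ disc then (BoundedContinuousFunction.evalCLM ℂ (⟨z, h⟩ : disc)).comp Hinf.subtypeL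
  else 0

theorem evalAt_of_mem {z : ℂ} (hz : z ∈ disc) (f : Hinf) : evalAt z f = f.1 ⟨z, hz⟩ := by
  rw [evalAt, dif_pos hz]
  rfl

theorem evalAt_of_notMem {z : ℂ} (hz : z ∉ disc) (f : Hinf) : evalAt z f = 0 := by
  rw [evalAt, dif_neg hz]
  rfl

theorem evalAt_apply (z : ℂ) (f : Hinf) : evalAt z f = zeroExt f.1 z := by
  by_cases hz : z ∈ disc
  · rw [evalAt_of_mem hz, zeroExt_of_mem _ hz]
  · rw [evalAt_of_notMem hz, zeroExt, dif_neg hz]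

theorem norm_evalAt_le (z : ℂ) (f : Hinf) : ‖evalAt z f‖ ≤ ‖f‖ := by
  by_cases hz : z ∈ disc
  · rw [evalAt_of_mem hz]; exact f.1.norm_coe_le_norm _
  · rw [evalAt_of_notMem hz, norm_zero]; exact norm_nonneg _

theorem evalAt_of {F : ℂ → ℂ} (hd : DifferentiableOn ℂ F disc) (hb : ∃ C, ∀ z ∈ disc, ‖F z‖ ≤ C)
    {z : ℂ} (hz : z ∈ disc) : evalAt z (Hinf.of F hd hb) = F z :=
  evalAt_of_mem hz _

theorem Hinf.ext_evalAt {f g : Hinf} (h : ∀ z ∈ disc, evalAt z f = evalAt z g) : f = g := by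
  ext z
  simpa [evalAt_of_mem z.2] using h z z.2

theorem Hinf.norm_le {f : Hinf} {C : ℝ} (hC : 0 ≤ C) (h : ∀ z ∈ disc, ‖evalAt z f‖ ≤ C) :
    ‖f‖ ≤ C :=
  (BoundedContinuousFunction.norm_le hC).mpr fun z => by
    simpa [evalAt_of_mem z.2] using h z z.2

theorem differentiableOn_evalAt (f : Hinf) : DifferentiableOn ℂ (fun z => evalAt z f) disc := by
  simp_rw [evalAt_apply]
  exact f.2

theorem continuousOn_evalAt_real (f : Hinf) :
    ContinuousOn (fun x : ℝ => evalAt x f) (Set.Icc 0 1) :=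
  (differentiableOn_evalAt f).continuousOn.comp Complex.continuous_ofReal.continuousOn
    fun _ hx => mem_disc_of_mem_Icc hx

theorem aestronglyMeasurable_evalAt (f : Hinf) :
    AEStronglyMeasurable (fun x : ℝ => evalAt x f) (volume.restrict (Set.Ioc 0 1)) :=
  ((continuousOn_evalAt_real f).mono Set.Ioc_subset_Icc_self).aestronglyMeasurable
    measurableSet_Ioc

theorem integrable_evalAt (f : Hinf) :
    Integrable (fun x : ℝ => evalAt x f) (volume.restrict (Set.Ioc 0 1)) :=
  Integrable.of_bound (aestronglyMeasurable_evalAt f) ‖f‖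
    (Eventually.of_forall fun x => norm_evalAt_le x f)

theorem integrable_evalAt_mul {g : ℝ → ℂ} (hg : Measurable g) (hgb : ∃ C, ∀ x, ‖g x‖ ≤ C)
    (f : Hinf) :
    Integrable (fun x : ℝ => evalAt x f * g x) (volume.restrict (Set.Ioc 0 1)) :=
  (integrable_evalAt f).mul_bdd hg.aestronglyMeasurable
    (Eventually.of_forall hgb.choose_spec)

theorem norm_integral_evalAt_mul_le {g : ℝ → ℂ} {C : ℝ} (hC : ∀ x, ‖g x‖ ≤ C) (f : Hinf) :
    ‖∫ x in Set.Ioc (0 : ℝ) 1, evalAt x f * g x‖ ≤ C * ‖f‖ := by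
  have h := norm_setIntegral_le_of_norm_le_const (μ := volume) (s := Set.Ioc (0 : ℝ) 1)
    (f := fun x : ℝ => evalAt x f * g x) (C := C * ‖f‖) (by simp)
    (fun x _ => by
      rw [norm_mul, mul_comm]
      exact mul_le_mul (hC x) (norm_evalAt_le _ _) (norm_nonneg _) ((norm_nonneg _).trans (hC x)))
  have h1 : volume.real (Set.Ioc (0 : ℝ) 1) = 1 := by simp
  rwa [h1, mul_one] at h

/-- The functional `f ↦ ∫₀¹ f(x) g(x) dx` for a bounded measurable weight `g`. -/
def integralCLM (g : ℝ → ℂ) (hg : Measurable g) (hgb : ∃ C, ∀ x, ‖g x‖ ≤ C) : Hinf →L[ℂ] ℂ :=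
  LinearMap.mkContinuous
    { toFun := fun f => ∫ x in Set.Ioc (0 : ℝ) 1, evalAt x f * g x
      map_add' := fun f₁ f₂ => by
        simp only [map_add, add_mul]
        exact integral_add (integrable_evalAt_mul hg hgb f₁) (integrable_evalAt_mul hg hgb f₂)
      map_smul' := fun a f => by
        simp only [map_smul, smul_eq_mul, mul_assoc, RingHom.id_apply]
        exact integral_const_mul a _ } hgb.choose
    (fun f => norm_integral_evalAt_mul_le hgb.choose_spec f)

theorem integralCLM_apply (g : ℝ → ℂ) (hg : Measurable g) (hgb : ∃ C, ∀ x, ‖g x‖ ≤ C) (f : Hinf) :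
    integralCLM g hg hgb f = ∫ x in Set.Ioc (0 : ℝ) 1, evalAt x f * g x := rfl

/-- The functional `f ↦ ∫₀¹ f(x) dx`. -/
def meanCLM : Hinf →L[ℂ] ℂ := integralCLM (fun _ => 1) measurable_const ⟨1, by simp⟩

theorem meanCLM_apply (f : Hinf) : meanCLM f = ∫ x in Set.Ioc (0 : ℝ) 1, evalAt x f := by
  simp [meanCLM, integralCLM_apply]

/-- The Gauss density as an element of `H^∞(𝔻)`. -/
def density : Hinf :=
  Hinf.of (fun z => 1 / ((Real.log 2 : ℂ) * (1 + z)))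
    (by
      refine (differentiableOn_const (1 : ℂ)).div (by fun_prop) fun z hz => ?_
      have : (Real.log 2 : ℂ) ≠ 0 := by
        exact_mod_cast (Real.log_pos one_lt_two).ne'
      exact mul_ne_zero this (one_add_ne_zero hz))
    ⟨1 / (Real.log 2 * (2 / 3)), fun z hz => by
      have hl := Real.log_pos one_lt_two
      rw [norm_div, norm_one, norm_mul, Complex.norm_real, Real.norm_of_nonneg hl.le]
      have h1 : (2 / 3 : ℝ) ≤ ‖1 + z‖ := by
        refine le_trans ?_ (Complex.re_le_norm _)
        simp only [Complex.add_re, Complex.one_re]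
        linarith [re_gt_of_mem_disc hz]
      gcongr⟩

theorem evalAt_density {z : ℂ} (hz : z ∈ disc) :
    evalAt z density = 1 / ((Real.log 2 : ℂ) * (1 + z)) := evalAt_of _ _ hz

theorem evalAt_density_real {x : ℝ} (hx : x ∈ Set.Icc (0 : ℝ) 1) :
    evalAt x density = (xi x : ℂ) := by
  rw [evalAt_density (mem_disc_of_mem_Icc hx), xi]
  push_cast
  rfl

theorem evalAt_density_ne_zero {z : ℂ} (hz : z ∈ disc) : evalAt z density ≠ 0 := by
  rw [evalAt_density hz]
  have : (Real.log 2 : ℂ) ≠ 0 := by exact_mod_cast (Real.log_pos one_lt_two).ne'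
  exact one_div_ne_zero (mul_ne_zero this (one_add_ne_zero hz))

theorem integral_xi : ∫ x in Set.Ioc (0 : ℝ) 1, xi x = 1 := by
  have hl := Real.log_pos one_lt_two
  rw [← intervalIntegral.integral_of_le zero_le_one]
  have h1 : ∀ x ∈ Set.uIcc (0 : ℝ) 1, HasDerivAt (fun y => Real.log (1 + y) / Real.log 2) (xi x) x := by
    intro x hx
    rw [Set.uIcc_of_le zero_le_one] at hx
    have h2 : (1 : ℝ) + x ≠ 0 := by linarith [hx.1]
    have h3 := (((hasDerivAt_id x).const_add 1).log h2).div_const (Real.log 2)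
    refine h3.congr_deriv ?_
    simp only [xi, id]
    field_simp
  rw [intervalIntegral.integral_eq_sub_of_hasDerivAt h1]
  · norm_num
  · apply ContinuousOn.intervalIntegrable
    unfold xi
    refine continuousOn_const.div (by fun_prop) fun x hx => ?_
    rw [Set.uIcc_of_le zero_le_one] at hx
    have h2 : (1 : ℝ) + x ≠ 0 := by linarith [hx.1]
    exact mul_ne_zero hl.ne' h2

theorem meanCLM_density : meanCLM density = 1 := by
  rw [meanCLM_apply]
  have : ∫ x in Set.Ioc (0 : ℝ) 1, evalAt x density = ∫ x in Set.Ioc (0 : ℝ) 1, (xi x : ℂ) :=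
    setIntegral_congr_fun measurableSet_Ioc fun x hx =>
      evalAt_density_real (Set.Ioc_subset_Icc_self hx)
  rw [this, integral_complex_ofReal, integral_xi, Complex.ofReal_one]

theorem expo_one_zero (c : ℕ → ℝ) : expo c 1 0 = 2 := by simp [expo]

theorem admissible_one_zero {c : ℕ → ℝ} (hc : ∃ B : ℝ, ∀ n, 1 ≤ n → |c n| ≤ B) :
    Admissible c 1 0 := ⟨hc, by rw [expo_one_zero]; norm_num⟩

theorem evalAt_transferOperator {c : ℕ → ℝ} {s ω : ℂ} (h : Admissible c s ω) (f : Hinf) {z : ℂ}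
    (hz : z ∈ disc) : evalAt z (transferOperator c s ω f) = transferFun c s ω f.1 z := by
  rw [evalAt_of_mem hz, transferOperator_apply h]

theorem transferTerm_one_zero (c : ℕ → ℝ) (f : Hinf) (m : ℕ) (z : ℂ) :
    transferTerm c 1 0 f.1 m z =
      1 / (z + ((m : ℂ) + 1)) ^ 2 * evalAt (1 / (z + ((m : ℂ) + 1))) f := by
  rw [transferTerm, expo_one_zero, evalAt_apply]
  simp

theorem add_natCast_ne_zero {z : ℂ} (hz : z ∈ disc) (m : ℕ) : z + ((m : ℂ) + 1) ≠ 0 := by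
  intro h
  have h1 := re_add_lower hz m
  rw [h, Complex.zero_re] at h1
  have : (0 : ℝ) ≤ m := m.cast_nonneg
  linarith

/-- With `w = z + n` the summand is `1 / (log 2 · w (w + 1))`, a difference of consecutive
reciprocals, so the series telescopes to `1 / (log 2 · (z + 1))`. -/
theorem transferOperator_density {c : ℕ → ℝ} (hc : ∃ B : ℝ, ∀ n, 1 ≤ n → |c n| ≤ B) :
    transferOperator c 1 0 density = density := by
  have hadm := admissible_one_zero hc
  refine Hinf.ext_evalAt fun z hz => ?_
  rw [evalAt_transferOperator hadm _ hz, transferFun]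
  have hsum := (transferTerm_summable hadm density.1 hz).hasSum.tendsto_sum_nat
  refine tendsto_nhds_unique hsum ?_
  have hl : (Real.log 2 : ℂ) ≠ 0 := by exact_mod_cast (Real.log_pos one_lt_two).ne'
  have hterm : ∀ m : ℕ, transferTerm c 1 0 density.1 m z =
      (Real.log 2 : ℂ)⁻¹ * ((z + ((m : ℂ) + 1))⁻¹ - (z + (((m + 1 : ℕ) : ℂ) + 1))⁻¹) := by
    intro m
    have h0 := add_natCast_ne_zero hz m
    have h1 := add_natCast_ne_zero hz (m + 1)
    rw [transferTerm_one_zero, evalAt_density (inv_mem_disc hz m)]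
    push_cast at h1 ⊢
    have h2 : 1 + 1 / (z + ((m : ℂ) + 1)) = (z + ((m : ℂ) + 1 + 1)) / (z + ((m : ℂ) + 1)) := by
      field_simp
      ring
    rw [h2]
    field_simp
    ring
  have hpart : ∀ n : ℕ, ∑ m ∈ Finset.range n, transferTerm c 1 0 density.1 m z =
      (Real.log 2 : ℂ)⁻¹ * ((z + 1)⁻¹ - (z + ((n : ℂ) + 1))⁻¹) := by
    intro n
    rw [Finset.sum_congr rfl fun m _ => hterm m, ← Finset.mul_sum,
      Finset.sum_range_sub' (fun m : ℕ => (z + ((m : ℂ) + 1))⁻¹)]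
    simp
  simp_rw [hpart]
  have hlim : Tendsto (fun n : ℕ => (z + ((n : ℂ) + 1))⁻¹) atTop (𝓝 0) := by
    refine tendsto_inv₀_cobounded.comp ?_
    rw [← tendsto_norm_atTop_iff_cobounded]
    refine tendsto_atTop_mono (fun n => ?_) tendsto_natCast_atTop_atTop
    refine le_trans ?_ (Complex.re_le_norm _)
    linarith [re_add_lower hz n]
  have := (tendsto_const_nhds (x := (Real.log 2 : ℂ)⁻¹)).mul
    ((tendsto_const_nhds (x := (z + 1)⁻¹)).sub hlim)
  rw [evalAt_density hz]
  convert this using 2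
  rw [sub_zero, add_comm z 1, one_div, mul_inv]

end GaussEuclid

end

/-! ### Analytic perturbation of a simple dominant eigenvalue. -/

open scoped ContDiff in
/-- Analytic continuation of a simple isolated eigenvector along an analytic family of operators. -/
theorem exists_contDiffAt_eigenvector {E X : Type*} [NormedAddCommGroup E] [NormedSpace ℂ E]
    [CompleteSpace E] [NormedAddCommGroup X] [NormedSpace ℂ X] [CompleteSpace X]
    {A : E → X →L[ℂ] X} {p₀ : E} (hA : ContDiffAt ℂ ω A p₀) {l : X →L[ℂ] ℂ} {x₀ : X}
    (hx : A p₀ x₀ = x₀) (hlx : l x₀ = 1)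
    (hl : ∀ x, l (A p₀ x) = l x) (hu : IsUnit (1 - (A p₀ - l.smulRight x₀))) :
    ∃ u : E → X, ContDiffAt ℂ ω u p₀ ∧ u p₀ = x₀ ∧
      ∀ᶠ p in 𝓝 p₀, A p (u p) = l (A p (u p)) • u p := by
  have hA' : ContDiffAt ℂ ω (fun q : E × X => A q.1) (p₀, x₀) :=
    ContDiffAt.comp (p₀, x₀) (g := A) hA contDiffAt_fst
  -- A zero of `Φ(p, ·)` is a vector `x` with `A p x = l (A p x) • x`, so `l` also reads off the
  -- eigenvalue.
  set Φ : E × X → X := fun q => A q.1 q.2 - l (A q.1 q.2) • q.2 with hΦ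
  have hΦc : ContDiffAt ℂ ω Φ (p₀, x₀) := by
    have h1 : ContDiffAt ℂ ω (fun q : E × X => A q.1 q.2) (p₀, x₀) :=
      hA'.clm_apply contDiffAt_snd
    exact h1.sub ((l.contDiff.contDiffAt.comp _ h1).smul contDiffAt_snd)
  -- The partial derivative in `x` is, up to sign, the operator assumed invertible, so the implicit
  -- function theorem applies.
  have hd : fderiv ℂ Φ (p₀, x₀) ∘L .inr ℂ E X = -(1 - (A p₀ - l.smulRight x₀)) := by
    have h1 : HasFDerivAt (fun x : X => Φ (p₀, x)) (fderiv ℂ Φ (p₀, x₀) ∘L .inr ℂ E X) x₀ :=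
      HasFDerivAt.comp x₀ (hΦc.differentiableAt (by simp)).hasFDerivAt
        (hasFDerivAt_prodMk_right p₀ x₀)
    have h2 : HasFDerivAt (fun x : X => A p₀ x - l (A p₀ x) • x)
        (A p₀ - (l (A p₀ x₀) • ContinuousLinearMap.id ℂ X + (l ∘L A p₀).smulRight x₀)) x₀ :=
      (A p₀).hasFDerivAt.sub ((l ∘L A p₀).hasFDerivAt.smul (hasFDerivAt_id x₀))
    rw [h1.unique h2]
    ext x
    simp [hx, hlx, hl]
    abel
  have hinv : (fderiv ℂ Φ (p₀, x₀) ∘L .inr ℂ E X).IsInvertible := by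
    rw [hd]
    obtain ⟨v, hv⟩ := hu.neg
    rw [← hv]
    exact ⟨ContinuousLinearEquiv.unitsEquiv ℂ X v, rfl⟩
  refine ⟨hΦc.implicitFunction (by simp) hinv, hΦc.contDiffAt_implicitFunction (by simp) hinv,
    hΦc.implicitFunction_apply_self (by simp) hinv, ?_⟩
  filter_upwards [hΦc.eventually_apply_implicitFunction (by simp) hinv] with p hp
  have h0 : Φ (p₀, x₀) = 0 := by simp [hΦ, hx, hlx]
  rw [h0] at hp
  exact sub_eq_zero.mp hp

/-- By spectral mapping `zⁿ` lies in the spectrum of `aⁿ`. A bound on one power is an open condition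
on `a`, which is how the spectral gap passes to nearby parameters. -/
theorem spectralRadius_lt_one_of_norm_pow_lt_one {A : Type*} [NormedRing A] [NormedAlgebra ℂ A]
    [CompleteSpace A] [NormOneClass A] {a : A} {n : ℕ} (h : ‖a ^ n‖ < 1) :
    spectralRadius ℂ a < 1 := by
  have : Nontrivial A := NormOneClass.nontrivial
  have h1 : spectralRadius ℂ a < (1 : NNReal) := by
    refine spectrum.spectralRadius_lt_of_forall_lt a fun z hz => ?_
    have h2 := (spectrum.norm_le_norm_of_mem (spectrum.pow_mem_pow a n hz)).trans_lt h
    rw [norm_pow] at h2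
    by_contra! h3
    exact absurd h2 (not_lt.mpr (one_le_pow₀ (by exact_mod_cast h3)))
  simpa using h1

/-- Gelfand's formula: eventually `‖aⁿ‖ < rⁿ` for some `r < 1`. -/
theorem exists_norm_pow_lt_of_spectralRadius_lt_one {A : Type*} [NormedRing A] [NormedAlgebra ℂ A]
    [CompleteSpace A] {a : A} (h : spectralRadius ℂ a < 1) {ε : ℝ} (hε : 0 < ε) :
    ∃ n, ‖a ^ n‖ < ε := by
  obtain ⟨r, hr, hr1⟩ := exists_between h
  lift r to NNReal using (hr1.trans ENNReal.one_lt_top).ne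
  have hr1' : (r : ℝ) < 1 := by exact_mod_cast hr1
  have h1 := (spectrum.pow_nnnorm_pow_one_div_tendsto_nhds_spectralRadius a).eventually_lt_const hr
  have h2 := (tendsto_pow_atTop_nhds_zero_of_lt_one r.2 hr1').eventually_lt_const hε
  obtain ⟨n, hn, hn2, hn0⟩ := (h1.and (h2.and (eventually_gt_atTop 0))).exists
  refine ⟨n, lt_trans ?_ hn2⟩
  rw [one_div, ENNReal.rpow_inv_lt_iff (by positivity)] at hn
  simp only [ENNReal.rpow_natCast] at hn
  exact_mod_cast hn

set_option synthInstance.maxHeartbeats 200000 in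
set_option maxHeartbeats 1000000 in
open scoped ContDiff in
/-- Analytic perturbation of a simple eigenvalue `1` which dominates the rest of the spectrum. -/
theorem exists_analytic_rank_one_decomposition {E X : Type*} [NormedAddCommGroup E]
    [NormedSpace ℂ E] [CompleteSpace E] [NormedAddCommGroup X] [NormedSpace ℂ X] [CompleteSpace X]
    {A : E → X →L[ℂ] X} {p₀ : E} (hA : ContDiffAt ℂ ω A p₀) {l : X →L[ℂ] ℂ} {x₀ : X}
    (hx : A p₀ x₀ = x₀) (hlx : l x₀ = 1) (hl : ∀ x, l (A p₀ x) = l x)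
    (hρ : spectralRadius ℂ (A p₀ - l.smulRight x₀) < 1) :
    ∃ (lam : E → ℂ) (P : E → X →L[ℂ] X), ContDiffAt ℂ ω lam p₀ ∧ ContDiffAt ℂ ω P p₀ ∧
      ContDiffAt ℂ ω (fun p => A p - lam p • P p) p₀ ∧
      ∀ᶠ p in 𝓝 p₀, (P p).comp (A p - lam p • P p) = 0 ∧ (A p - lam p • P p).comp (P p) = 0 ∧
        (P p).comp (P p) = P p ∧ Module.finrank ℂ (LinearMap.range (P p).toLinearMap) = 1 ∧
        LinearMap.range (P p).toLinearMap =
          Module.End.eigenspace (A p).toLinearMap (lam p) ∧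
        spectralRadius ℂ (A p - lam p • P p) < 1 := by
  have hxne : x₀ ≠ 0 := by rintro rfl; simp at hlx
  have : Nontrivial X := ⟨x₀, 0, hxne⟩
  have hunit : IsUnit (1 - (A p₀ - l.smulRight x₀)) := by
    have h1 : (1 : ℂ) ∈ resolventSet ℂ (A p₀ - l.smulRight x₀) :=
      spectrum.mem_resolventSet_of_spectralRadius_lt (by simpa using hρ)
    simpa [spectrum.mem_resolventSet_iff] using h1
  obtain ⟨u, huc, hu0, hu⟩ := exists_contDiffAt_eigenvector hA hx hlx hl hunit
  -- `R B` is the transpose of `B`. The left eigenvector comes from the same continuation lemma on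
  -- the dual space, with `l` and evaluation at `x₀` exchanging roles.
  set R : (X →L[ℂ] X) →L[ℂ] (X →L[ℂ] ℂ) →L[ℂ] (X →L[ℂ] ℂ) :=
    (ContinuousLinearMap.compL ℂ X X ℂ).flip with hR
  have hRa : ∀ (B : X →L[ℂ] X) (y : X →L[ℂ] ℂ) (x : X), R B y x = y (B x) := fun _ _ _ => rfl
  have hRunit : IsUnit (1 - (R (A p₀) -
      (ContinuousLinearMap.apply ℂ ℂ x₀).smulRight l)) := by
    have h1 : 1 - (R (A p₀) - (ContinuousLinearMap.apply ℂ ℂ x₀).smulRight l) =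
        R (1 - (A p₀ - l.smulRight x₀)) := by
      ext y x
      simp [hRa, mul_comm]
    obtain ⟨v, hv⟩ := hunit
    rw [h1, ← hv]
    refine ⟨⟨R v, R ↑v⁻¹, ?_, ?_⟩, rfl⟩
    · ext y x
      change y (((↑v⁻¹ * v : X →L[ℂ] X)) x) = y x
      simp
    · ext y x
      change y (((v * ↑v⁻¹ : X →L[ℂ] X)) x) = y x
      simp
  have hRA : ContDiffAt ℂ ω (fun p => R (A p)) p₀ := by fun_prop
  obtain ⟨m, hmc, hm0, hm⟩ := exists_contDiffAt_eigenvector (A := fun p => R (A p))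
    hRA (l := ContinuousLinearMap.apply ℂ ℂ x₀) (x₀ := l)
    (by ext x; simp [hRa, hl]) (by simpa using hlx) (by intro y; simp [hRa, hx]) hRunit
  set lam : E → ℂ := fun p => l (A p (u p)) with hlam
  -- The rank-one projection built from the right eigenvector `u` and the left eigenvector `m`; the
  -- scalar makes it idempotent.
  set P : E → X →L[ℂ] X := fun p => (m p (u p))⁻¹ • (m p).smulRight (u p) with hP
  have hmu : ContDiffAt ℂ ω (fun p => m p (u p)) p₀ := hmc.clm_apply huc
  have hmu0 : m p₀ (u p₀) ≠ 0 := by rw [hm0, hu0, hlx]; exact one_ne_zero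
  have hlamc : ContDiffAt ℂ ω lam p₀ := l.contDiff.contDiffAt.comp p₀ (hA.clm_apply huc)
  have hPc : ContDiffAt ℂ ω P p₀ := (hmu.inv hmu0).smul (hmc.smulRight huc)
  have hP0 : P p₀ = l.smulRight x₀ := by simp [hP, hm0, hu0, hlx]
  have hlam0 : lam p₀ = 1 := by simp [hlam, hu0, hx, hlx]
  -- The value 1/2 separates `‖Nⁿ‖` from `|λ|ⁿ`, which is 1 at `p₀`. Near `p₀` this keeps the
  -- spectral radius of `N` below 1 and also prevents `λ` from being an eigenvalue of `N`.
  obtain ⟨n, hn⟩ := exists_norm_pow_lt_of_spectralRadius_lt_one hρ (ε := 1 / 2) (by norm_num)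
  have hNev : ∀ᶠ p in 𝓝 p₀, ‖(A p - lam p • P p) ^ n‖ < 1 / 2 := by
    have h1 : ContinuousAt (fun p => ‖(A p - lam p • P p) ^ n‖) p₀ :=
      ((hA.continuousAt.sub (hlamc.continuousAt.smul hPc.continuousAt)).pow n).norm
    refine h1.eventually_lt_const ?_
    simpa [hlam0, hP0] using hn
  have hlamev : ∀ᶠ p in 𝓝 p₀, 1 / 2 < ‖lam p‖ ^ n := by
    have h1 : ContinuousAt (fun p => ‖lam p‖ ^ n) p₀ := (hlamc.continuousAt.norm).pow n
    refine h1.eventually_const_lt ?_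
    simp [hlam0]
    norm_num
  refine ⟨lam, P, hlamc, hPc, hA.sub (hlamc.smul hPc), ?_⟩
  filter_upwards [hu, hm, hmu.continuousAt.eventually_ne hmu0, hNev, hlamev]
    with p hup hmp hne hN hl2
  have hAu : A p (u p) = lam p • u p := hup
  have hmA : ∀ x, m p (A p x) = lam p * m p x := by
    have h1 : ∀ x, m p (A p x) = m p (A p x₀) * m p x := fun x => by
      simpa [hRa] using congrArg (fun y : X →L[ℂ] ℂ => y x) hmp
    have h2 := h1 (u p)
    rw [hAu, map_smul, smul_eq_mul] at h2
    intro x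
    rw [h1 x, mul_right_cancel₀ hne h2]
  have hPx : ∀ x, P p x = ((m p (u p))⁻¹ * m p x) • u p := fun x => by simp [hP, smul_smul]
  have hPu : P p (u p) = u p := by rw [hPx, inv_mul_cancel₀ hne, one_smul]
  have hu_ne : u p ≠ 0 := by intro h; simp [h] at hne
  have hAP : ∀ x, A p (P p x) = lam p • P p x := fun x => by
    rw [hPx, map_smul, hAu, smul_comm]
  have hPA : ∀ x, P p (A p x) = lam p • P p x := fun x => by
    rw [hPx, hPx, hmA, smul_smul]; ring_nf
  have hPP : ∀ x, P p (P p x) = P p x := fun x => by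
    rw [hPx x, map_smul, hPu]
  have hrange : LinearMap.range (P p).toLinearMap = Submodule.span ℂ {u p} := by
    ext x
    simp only [LinearMap.mem_range, Submodule.mem_span_singleton]
    constructor
    · rintro ⟨y, rfl⟩
      exact ⟨_, (hPx y).symm⟩
    · rintro ⟨a, rfl⟩
      exact ⟨a • u p, by simp [hPu]⟩
  refine ⟨?_, ?_, ?_, ?_, ?_, ?_⟩
  · ext x
    simp [hPA, hPP]
  · ext x
    simp [hAP, hPP]
  · ext x
    simp [hPP]
  · rw [hrange]
    exact finrank_span_singleton hu_ne
  · ext x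
    rw [Module.End.mem_eigenspace_iff]
    constructor
    · rintro ⟨y, rfl⟩
      exact hAP y
    · intro hxe
      have hxe' : A p x = lam p • x := hxe
      -- The component of an eigenvector in the kernel of `P` would be an eigenvector of `N` for
      -- `λ`, contradicting `‖Nⁿ‖ < |λ|ⁿ`.
      set y := x - P p x with hy
      have hNy : (A p - lam p • P p) y = lam p • y := by
        simp [hy, hAP, hPP, hxe', smul_sub]
      have hpow : ∀ k : ℕ, ((A p - lam p • P p) ^ k) y = lam p ^ k • y := by
        intro k
        induction k with
        | zero => simp
        | succ k ih =>
          rw [pow_succ, mul_apply_eq_comp, hNy, map_smul, ih, smul_smul, pow_succ']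
      have hy0 : y = 0 := by
        by_contra hy0
        have hypos := norm_pos_iff.mpr hy0
        have h1 := ((A p - lam p • P p) ^ n).le_opNorm y
        rw [hpow, norm_smul, norm_pow] at h1
        have h2 := le_of_mul_le_mul_right h1 hypos
        linarith
      exact ⟨x, (sub_eq_zero.mp hy0).symm⟩
  · exact spectralRadius_lt_one_of_norm_pow_lt_one (hN.trans (by norm_num))

/-! ### Joint analyticity of the transfer operator in `(s, ω)`. -/

noncomputable section

open scoped ContDiff

section Generic

variable {X Y E : Type*} [NormedAddCommGroup X] [NormedSpace ℂ X] [CompleteSpace X]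
  [NormedAddCommGroup Y] [NormedSpace ℂ Y] [CompleteSpace Y]
  [NormedAddCommGroup E] [NormedSpace ℂ E]

/-- The holomorphic family of operators `w ↦ exp (w M) ∘ C`. -/
def expComp (M C : X →L[ℂ] X) (w : ℂ) : X →L[ℂ] X :=
  (NormedSpace.exp (w • M)).comp C

theorem differentiable_expComp (M C : X →L[ℂ] X) : Differentiable ℂ (expComp M C) := fun w =>
  ((hasDerivAt_exp_smul_const (𝕂 := ℂ) M w).differentiableAt).clm_comp (differentiableAt_const _)

/-- In the application `e` is evaluation at `z` and `M` is multiplication by `-log (z + n)`, so the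
operator exponential acts as the scalar `(z + n)^{-w}`. -/
theorem expComp_apply_of_left_eigenvector {M : X →L[ℂ] X} {e : X →L[ℂ] ℂ} {a : ℂ}
    (he : ∀ x, e (M x) = a * e x) (C : X →L[ℂ] X) (w : ℂ) (x : X) :
    e (expComp M C w x) = Complex.exp (w * a) * e (C x) := by
  have h1 := NormedSpace.exp_series_hasSum_exp' (𝕂 := ℂ) (w • M)
  have h2 := (e.comp (ContinuousLinearMap.apply ℂ X (C x))).hasSum h1
  have h3 := (NormedSpace.exp_series_hasSum_exp' (𝕂 := ℂ) (w * a)).mul_right (e (C x))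
  rw [← Complex.exp_eq_exp_ℂ] at h3
  refine h2.unique (h3.congr_fun ?_)
  intro n
  have h4 : ∀ k : ℕ, e (((w • M) ^ k) (C x)) = (w * a) ^ k * e (C x) := by
    intro k
    induction k with
    | zero => simp
    | succ k ih =>
      rw [pow_succ', mul_apply_eq_comp, smul_apply, map_smul, he, ih, pow_succ', smul_eq_mul]
      ring
  change e (((n.factorial : ℂ)⁻¹ • (w • M) ^ n) (C x)) = _
  rw [smul_apply, map_smul, h4, smul_eq_mul, smul_eq_mul, mul_assoc]

/-- Evaluation at `m` is continuous and multiplicative, so it passes through the exponential series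
term by term. -/
theorem exp_smul_boundedContinuousFunction_apply (a : BoundedContinuousFunction ℕ ℂ) (z : ℂ)
    (m : ℕ) : NormedSpace.exp (z • a) m = Complex.exp (z * a m) := by
  have h1 := NormedSpace.exp_series_hasSum_exp' (𝕂 := ℂ) (z • a)
  have h2 := (BoundedContinuousFunction.evalCLM ℂ m :
      BoundedContinuousFunction ℕ ℂ →L[ℂ] ℂ).hasSum h1
  have h3 := NormedSpace.exp_series_hasSum_exp' (𝕂 := ℂ) (z * a m)
  rw [← Complex.exp_eq_exp_ℂ] at h3
  exact h2.unique h3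

/-- The operator `∑ exp (z a(m)) exp (w M_m) C_m`. -/
def expCompSum (M C : ℕ → X →L[ℂ] X) (a : ℕ → ℂ) (z w : ℂ) : X →L[ℂ] X :=
  ∑' m, Complex.exp (z * a m) • expComp (M m) (C m) w

theorem hasSum_expCompSum_apply {M C : ℕ → X →L[ℂ] X} {u : ℕ → ℝ} (hu : Summable u) {w : ℂ}
    (hTu : ∀ m, ‖expComp (M m) (C m) w‖ ≤ u m) (a : BoundedContinuousFunction ℕ ℂ) (z : ℂ)
    {e : X →L[ℂ] ℂ} {b : ℕ → ℂ} (he : ∀ m x, e (M m x) = b m * e x) (x : X) :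
    HasSum (fun m => Complex.exp (z * a m) * (Complex.exp (w * b m) * e (C m x)))
      (e (expCompSum M C a z w x)) := by
  have hsum : Summable fun m => Complex.exp (z * a m) • expComp (M m) (C m) w := by
    refine Summable.of_norm_bounded (hu.mul_left (Real.exp (‖z‖ * ‖a‖))) fun m => ?_
    rw [norm_smul]
    refine mul_le_mul ?_ (hTu m) (norm_nonneg _) (by positivity)
    rw [Complex.norm_exp]
    refine Real.exp_le_exp.mpr ((Complex.re_le_norm _).trans ?_)
    rw [norm_mul]
    exact mul_le_mul_of_nonneg_left (a.norm_coe_le_norm m) (norm_nonneg _)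
  have h1 := (e.comp (ContinuousLinearMap.apply ℂ X x)).hasSum hsum.hasSum
  refine h1.congr_fun fun m => ?_
  change _ = e ((Complex.exp (z * a m) • expComp (M m) (C m) w) x)
  rw [smul_apply, map_smul, expComp_apply_of_left_eigenvector (he m), smul_eq_mul]

/-- A series `∑ exp (z a(m)) T_m(w)`, with `a` bounded and `∑ T_m` uniformly absolutely
convergent, is jointly analytic in `(z, w)`. -/
theorem contDiffAt_tsum_exp_smul {T : ℕ → ℂ → Y} {U : Set ℂ} {u : ℕ → ℝ} (hU : IsOpen U)
    (hT : ∀ m, Differentiable ℂ (T m)) (hu : Summable u) (hTu : ∀ m, ∀ w ∈ U, ‖T m w‖ ≤ u m)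
    (a : BoundedContinuousFunction ℕ ℂ) {z w : E → ℂ} {p₀ : E} (hz : ContDiffAt ℂ ω z p₀)
    (hw : ContDiffAt ℂ ω w p₀) (hwU : w p₀ ∈ U) :
    ContDiffAt ℂ ω (fun p => ∑' m, Complex.exp (z p * a m) • T m (w p)) p₀ := by
  -- The two variables are separated: the series is the operator `∑ S m w`, holomorphic in `w`
  -- alone, applied to the bounded sequence `exp (z a)`, analytic in `z` alone.
  let S : ℕ → ℂ → BoundedContinuousFunction ℕ ℂ →L[ℂ] Y := fun m w =>
    (BoundedContinuousFunction.evalCLM ℂ m).smulRight (T m w)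
  have hSb : ∀ m, ∀ w ∈ U, ‖S m w‖ ≤ u m := fun m w hw => by
    refine le_trans ?_ (hTu m w hw)
    refine ContinuousLinearMap.opNorm_le_bound _ (norm_nonneg _) fun b => ?_
    rw [ContinuousLinearMap.smulRight_apply, norm_smul, mul_comm]
    exact mul_le_mul_of_nonneg_left (b.norm_coe_le_norm m) (norm_nonneg _)
  have hSd : DifferentiableOn ℂ (fun w => ∑' m, S m w) U := by
    refine Complex.differentiableOn_tsum_of_summable_norm (E := BoundedContinuousFunction ℕ ℂ →L[ℂ] Y)
      (F := S) hu (fun m => ?_) hU hSb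
    have : Differentiable ℂ fun w : ℂ => (ContinuousLinearMap.smulRightL ℂ
        (BoundedContinuousFunction ℕ ℂ) Y (BoundedContinuousFunction.evalCLM ℂ m)) (T m w) :=
      (ContinuousLinearMap.differentiable _).comp (hT m)
    exact this.differentiableOn
  have h1 : ContDiffAt ℂ ω (fun w => ∑' m, S m w) (w p₀) :=
    (hSd.analyticAt (hU.mem_nhds hwU)).contDiffAt
  have h2 : ContDiffAt ℂ ω (fun p => ∑' m, S m (w p)) p₀ :=
    ContDiffAt.comp (g := fun w => ∑' m, S m w) p₀ h1 hw
  have h3 : ContDiffAt ℂ ω (fun p => NormedSpace.exp (z p • a)) p₀ :=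
    ContDiffAt.comp (g := NormedSpace.exp) p₀ (NormedSpace.exp_analytic (𝕂 := ℂ) _).contDiffAt
      (hz.smul contDiffAt_const)
  refine (h2.clm_apply h3).congr_of_eventuallyEq ?_
  filter_upwards [hw.continuousAt.eventually_mem (hU.mem_nhds hwU)] with p hp
  have h4 : Summable fun m => S m (w p) := Summable.of_norm_bounded hu fun m => hSb m _ hp
  have h5 := (ContinuousLinearMap.apply ℂ Y (NormedSpace.exp (z p • a))).hasSum h4.hasSum
  refine Eq.trans ?_ h5.tsum_eq
  refine tsum_congr fun m => ?_
  rw [← exp_smul_boundedContinuousFunction_apply]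
  rfl

theorem contDiffAt_expCompSum {M C : ℕ → X →L[ℂ] X} {U : Set ℂ} {u : ℕ → ℝ} (hU : IsOpen U)
    (hu : Summable u) (hTu : ∀ m, ∀ w ∈ U, ‖expComp (M m) (C m) w‖ ≤ u m)
    (a : BoundedContinuousFunction ℕ ℂ) {z w : E → ℂ} {p₀ : E} (hz : ContDiffAt ℂ ω z p₀)
    (hw : ContDiffAt ℂ ω w p₀) (hwU : w p₀ ∈ U) :
    ContDiffAt ℂ ω (fun p => expCompSum M C a (z p) (w p)) p₀ :=
  contDiffAt_tsum_exp_smul hU (fun m => differentiable_expComp (M m) (C m)) hu hTu a hz hw hwU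

end Generic

namespace GaussEuclid

theorem norm_mul_evalAt_le {G φ : ℂ → ℂ} {C : ℝ} (hC : ∀ z ∈ disc, ‖G z‖ ≤ C) (f : Hinf) :
    ∀ z ∈ disc, ‖G z * evalAt (φ z) f‖ ≤ C * ‖f‖ := fun z hz => by
  rw [norm_mul]
  exact mul_le_mul (hC z hz) (norm_evalAt_le _ _) (norm_nonneg _)
    ((norm_nonneg _).trans (hC z hz))

/-- The weighted composition operator `f ↦ G · (f ∘ φ)` on `H^∞(𝔻)`, as a linear map. -/
def weightedCompLin (G φ : ℂ → ℂ) (hG : DifferentiableOn ℂ G disc) (hφ : DifferentiableOn ℂ φ disc)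
    (hm : Set.MapsTo φ disc disc) (hb : ∃ C, ∀ z ∈ disc, ‖G z‖ ≤ C) : Hinf →ₗ[ℂ] Hinf where
  toFun := fun f => Hinf.of (fun z => G z * evalAt (φ z) f)
        (hG.mul ((differentiableOn_evalAt f).comp hφ hm)) ⟨_, norm_mul_evalAt_le hb.choose_spec f⟩
  map_add' := fun f g => Hinf.ext_evalAt fun z hz => by
        rw [evalAt_of _ _ hz, map_add, map_add, evalAt_of _ _ hz, evalAt_of _ _ hz, mul_add]
  map_smul' := fun a f => Hinf.ext_evalAt fun z hz => by
        rw [evalAt_of _ _ hz, RingHom.id_apply, map_smul, map_smul, evalAt_of _ _ hz, smul_eq_mul,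
          smul_eq_mul, mul_left_comm]

theorem weightedCompLin_apply (G φ : ℂ → ℂ) (hG : DifferentiableOn ℂ G disc)
    (hφ : DifferentiableOn ℂ φ disc) (hm : Set.MapsTo φ disc disc)
    (hb : ∃ C, ∀ z ∈ disc, ‖G z‖ ≤ C) (f : Hinf) {z : ℂ} (hz : z ∈ disc) :
    evalAt z (weightedCompLin G φ hG hφ hm hb f) = G z * evalAt (φ z) f := by
  unfold weightedCompLin
  exact evalAt_of (F := fun z => G z * evalAt (φ z) f)
    (hG.mul ((differentiableOn_evalAt f).comp hφ hm)) ⟨_, norm_mul_evalAt_le hb.choose_spec f⟩ hz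

/-- The weighted composition operator `f ↦ G · (f ∘ φ)` on `H^∞(𝔻)`. -/
def weightedComp (G φ : ℂ → ℂ) (hG : DifferentiableOn ℂ G disc) (hφ : DifferentiableOn ℂ φ disc)
    (hm : Set.MapsTo φ disc disc) (hb : ∃ C, ∀ z ∈ disc, ‖G z‖ ≤ C) : Hinf →L[ℂ] Hinf :=
  (weightedCompLin G φ hG hφ hm hb).mkContinuous hb.choose
    -- The bound for `G` is nonnegative because it holds at the centre 2/3 of the disc.
    (fun f => Hinf.norm_le (mul_nonneg ((norm_nonneg _).trans (hb.choose_spec (2 / 3)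
      (by simp [disc]))) (norm_nonneg _)) fun z hz => by
        rw [weightedCompLin_apply _ _ _ _ _ _ _ hz]
        exact norm_mul_evalAt_le hb.choose_spec f z hz)

theorem evalAt_weightedComp {G φ : ℂ → ℂ} (hG : DifferentiableOn ℂ G disc)
    (hφ : DifferentiableOn ℂ φ disc) (hm : Set.MapsTo φ disc disc)
    (hb : ∃ C, ∀ z ∈ disc, ‖G z‖ ≤ C) (f : Hinf) {z : ℂ} (hz : z ∈ disc) :
    evalAt z (weightedComp G φ hG hφ hm hb f) = G z * evalAt (φ z) f :=
  weightedCompLin_apply G φ hG hφ hm hb f hz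

theorem add_natCast_mem_slitPlane {z : ℂ} (hz : z ∈ disc) (m : ℕ) :
    z + ((m : ℂ) + 1) ∈ Complex.slitPlane :=
  Or.inl (lt_trans (by positivity) (re_add_lower hz m))

theorem le_norm_add_natCast {z : ℂ} (hz : z ∈ disc) (m : ℕ) :
    (m : ℝ) + 2 / 3 ≤ ‖z + ((m : ℂ) + 1)‖ :=
  (re_add_lower hz m).le.trans (Complex.re_le_norm _)

/-- A crude bound, linear in `m`, is enough: it only makes each multiplication operator bounded.
Uniformity in `m` comes from `norm_exp_neg_log_le`. -/
theorem norm_log_add_natCast_le {z : ℂ} (hz : z ∈ disc) (m : ℕ) :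
    ‖-Complex.log (z + ((m : ℂ) + 1))‖ ≤ (m : ℝ) + 3 + Real.pi := by
  rw [norm_neg]
  set w := z + ((m : ℂ) + 1) with hw
  have hlow := le_norm_add_natCast hz m
  have hm : (0 : ℝ) ≤ m := m.cast_nonneg
  have hpos : 0 < ‖w‖ := by linarith
  have hup : ‖w‖ ≤ (m : ℝ) + 3 := by
    have h1 : ‖z‖ ≤ 5 / 3 := by
      have h2 : ‖z - 2 / 3‖ < 1 := by simpa [disc, Metric.mem_ball, dist_eq_norm] using hz
      have h3 : ‖z‖ ≤ ‖z - 2 / 3‖ + ‖(2 / 3 : ℂ)‖ := by simpa using norm_add_le (z - 2 / 3) (2 / 3)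
      have h4 : ‖(2 / 3 : ℂ)‖ = 2 / 3 := by simp
      linarith
    have h5 : ‖(m : ℂ) + 1‖ ≤ (m : ℝ) + 1 := by
      simpa using norm_add_le (m : ℂ) 1
    linarith [norm_add_le z ((m : ℂ) + 1)]
  refine (Complex.norm_le_abs_re_add_abs_im _).trans (add_le_add ?_ ?_)
  · rw [Complex.log_re, abs_le]
    constructor
    · have h1 := Real.log_le_sub_one_of_pos (inv_pos.mpr hpos)
      rw [Real.log_inv] at h1
      have h2 : ‖w‖⁻¹ ≤ (2 / 3 : ℝ)⁻¹ := inv_anti₀ (by norm_num) (by linarith)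
      norm_num at h2
      linarith
    · linarith [Real.log_le_sub_one_of_pos hpos]
  · rw [Complex.log_im]
    exact Complex.abs_arg_le_pi w

theorem differentiableOn_log_add_natCast (m : ℕ) :
    DifferentiableOn ℂ (fun z => -Complex.log (z + ((m : ℂ) + 1))) disc := fun _ hz =>
  (((differentiableAt_id.add_const _).clog (add_natCast_mem_slitPlane hz m)).neg
    ).differentiableWithinAt

theorem differentiableOn_inv_add_natCast (m : ℕ) :
    DifferentiableOn ℂ (fun z => 1 / (z + ((m : ℂ) + 1))) disc :=
  (differentiableOn_const (1 : ℂ)).div (by fun_prop) fun _ hz => add_natCast_ne_zero hz m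

/-- Multiplication by `-log (z + n)`, `n = m + 1`. -/
def negLogMul (m : ℕ) : Hinf →L[ℂ] Hinf :=
  weightedComp (fun z => -Complex.log (z + ((m : ℂ) + 1))) id (differentiableOn_log_add_natCast m)
    differentiableOn_id (Set.mapsTo_id _) ⟨_, fun _ hz => norm_log_add_natCast_le hz m⟩

/-- Composition with the inverse branch `z ↦ 1 / (z + n)`, `n = m + 1`. -/
def branchComp (m : ℕ) : Hinf →L[ℂ] Hinf :=
  weightedComp (fun _ => 1) (fun z => 1 / (z + ((m : ℂ) + 1))) (differentiableOn_const 1)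
    (differentiableOn_inv_add_natCast m) (fun _ hz => inv_mem_disc hz m) ⟨1, by simp⟩

theorem evalAt_negLogMul (m : ℕ) (f : Hinf) {z : ℂ} (hz : z ∈ disc) :
    evalAt z (negLogMul m f) = -Complex.log (z + ((m : ℂ) + 1)) * evalAt z f :=
  evalAt_weightedComp _ _ _ _ f hz

theorem evalAt_branchComp (m : ℕ) (f : Hinf) {z : ℂ} (hz : z ∈ disc) :
    evalAt z (branchComp m f) = evalAt (1 / (z + ((m : ℂ) + 1))) f := by
  have h1 : evalAt z (branchComp m f) = 1 * evalAt (1 / (z + ((m : ℂ) + 1))) f :=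
    evalAt_weightedComp _ _ _ _ _ hz
  rw [h1, one_mul]

/-- The argument of `z + n` costs at most `exp (3π)`. Since `|z + n| ≥ m + 2/3 ≥ (m + 1) / (3/2)`,
the modulus costs `(3/2)^3` and leaves the summable power `(m + 1)^(-3/2)`. -/
theorem norm_exp_neg_log_le {z : ℂ} (hz : z ∈ disc) (m : ℕ) {w : ℂ} (hw : 3 / 2 ≤ w.re)
    (hw' : ‖w‖ ≤ 3) :
    ‖Complex.exp (w * -Complex.log (z + ((m : ℂ) + 1)))‖ ≤
      Real.exp (3 * Real.pi) * ((3 / 2) ^ (3 : ℝ) * ((m : ℝ) + 1) ^ (-(3 / 2) : ℝ)) := by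
  set ζ := z + ((m : ℂ) + 1) with hζ
  have hlow := le_norm_add_natCast hz m
  have hm : (0 : ℝ) ≤ m := m.cast_nonneg
  have hlog : Real.log (m + 1) - Real.log (3 / 2) ≤ Real.log ‖ζ‖ := by
    rw [← Real.log_div (by positivity) (by positivity)]
    refine Real.log_le_log (by positivity) (le_trans ?_ hlow)
    rw [div_le_iff₀ (by norm_num)]
    linarith
  have hre : w.re ≤ 3 := (Complex.re_le_norm w).trans hw'
  have him : |w.im| ≤ 3 := (Complex.abs_im_le_norm w).trans hw'
  have harg := Complex.abs_arg_le_pi ζ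
  have hlm : 0 ≤ Real.log ((m : ℝ) + 1) := Real.log_nonneg (by linarith)
  have hl32 : 0 ≤ Real.log (3 / 2 : ℝ) := Real.log_nonneg (by norm_num)
  rw [Complex.norm_exp, Real.rpow_def_of_pos (by norm_num), Real.rpow_def_of_pos (by positivity),
    ← Real.exp_add, ← Real.exp_add]
  refine Real.exp_le_exp.mpr ?_
  simp only [Complex.mul_re, Complex.neg_re, Complex.neg_im, Complex.log_re, Complex.log_im]
  have h1 : w.im * Complex.arg ζ ≤ 3 * Real.pi := by
    refine (le_abs_self _).trans ?_
    rw [abs_mul]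
    exact mul_le_mul him harg (abs_nonneg _) (by norm_num)
  have h2 : w.re * (Real.log (m + 1) - Real.log (3 / 2)) ≤ w.re * Real.log ‖ζ‖ :=
    mul_le_mul_of_nonneg_left hlog (by linarith)
  nlinarith [mul_le_mul_of_nonneg_right hw hlm, mul_le_mul_of_nonneg_right hre hl32]

theorem norm_expComp_branch_le (m : ℕ) {w : ℂ} (hw : 3 / 2 ≤ w.re) (hw' : ‖w‖ ≤ 3) :
    ‖expComp (negLogMul m) (branchComp m) w‖ ≤
      Real.exp (3 * Real.pi) * ((3 / 2) ^ (3 : ℝ) * ((m : ℝ) + 1) ^ (-(3 / 2) : ℝ)) := by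
  refine ContinuousLinearMap.opNorm_le_bound _ (by positivity) fun f => ?_
  refine Hinf.norm_le (by positivity) fun z hz => ?_
  rw [expComp_apply_of_left_eigenvector (fun f => evalAt_negLogMul m f hz) (branchComp m) w f,
    evalAt_branchComp m f hz, norm_mul]
  exact mul_le_mul (norm_exp_neg_log_le hz m hw hw') (norm_evalAt_le _ _) (norm_nonneg _)
    (by positivity)

theorem summable_branch_bound : Summable fun m : ℕ =>
    Real.exp (3 * Real.pi) * ((3 / 2 : ℝ) ^ (3 : ℝ) * ((m : ℝ) + 1) ^ (-(3 / 2) : ℝ)) := by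
  refine ((?_ : Summable _).mul_left _).mul_left _
  have := (Real.summable_nat_rpow (p := (-(3 / 2) : ℝ))).mpr (by norm_num)
  rw [← summable_nat_add_iff 1] at this
  simpa using this

/-- A neighbourhood of the exponent `2` on which the series of the operator converges uniformly. -/
def expoRegion : Set ℂ := {w | 3 / 2 < w.re} ∩ Metric.ball 0 3

theorem isOpen_expoRegion : IsOpen expoRegion :=
  (isOpen_lt continuous_const Complex.continuous_re).inter Metric.isOpen_ball

/-- The bounded sequence `n ↦ c(n)`, indexed by `m = n - 1`. -/
def costSeq (c : ℕ → ℝ) (hc : ∃ B : ℝ, ∀ n, 1 ≤ n → |c n| ≤ B) : BoundedContinuousFunction ℕ ℂ :=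
  BoundedContinuousFunction.ofNormedAddCommGroup (fun m : ℕ => (c (m + 1) : ℂ))
    continuous_of_discreteTopology hc.choose
    (fun m => by simpa using hc.choose_spec (m + 1) (by omega))

theorem costSeq_apply (c : ℕ → ℝ) (hc : ∃ B : ℝ, ∀ n, 1 ≤ n → |c n| ≤ B) (m : ℕ) :
    costSeq c hc m = (c (m + 1) : ℂ) := rfl

/-- Checked pointwise: the principal power in `transferTerm` is by definition `exp (w log (z + n))`.
This transfers joint analyticity from the exponential series. -/
theorem transferOperator_eq_expCompSum {c : ℕ → ℝ} (hc : ∃ B : ℝ, ∀ n, 1 ≤ n → |c n| ≤ B)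
    {s o : ℂ} (h : expo c s o ∈ expoRegion) :
    transferOperator c s o = expCompSum negLogMul branchComp (costSeq c hc) o (expo c s o) := by
  have hadm : Admissible c s o := ⟨hc, by have : (3 / 2 : ℝ) < _ := h.1; linarith⟩
  ext1 f
  refine Hinf.ext_evalAt fun z hz => ?_
  rw [evalAt_transferOperator hadm f hz, transferFun]
  have h1 := hasSum_expCompSum_apply summable_branch_bound
    (fun m => norm_expComp_branch_le m (le_of_lt h.1) (by simpa using (Metric.mem_ball.mp h.2).le))
    (costSeq c hc) o (fun m f => evalAt_negLogMul m f hz) f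
  refine Eq.trans ?_ h1.tsum_eq
  refine tsum_congr fun m => ?_
  rw [evalAt_branchComp m f hz, transferTerm,
    Complex.cpow_def_of_ne_zero (add_natCast_ne_zero hz m), evalAt_apply,
    div_eq_mul_inv, ← Complex.exp_neg, mul_assoc]
  simp only [costSeq_apply]
  ring_nf

theorem contDiffAt_transferOperator {c : ℕ → ℝ} (hc : ∃ B : ℝ, ∀ n, 1 ≤ n → |c n| ≤ B) :
    ContDiffAt ℂ ω (fun p : ℂ × ℂ => transferOperator c p.1 p.2) (1, 0) := by
  have hmem : expo c 1 0 ∈ expoRegion := by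
    rw [expo_one_zero]
    constructor
    · change (3 / 2 : ℝ) < (2 : ℂ).re
      norm_num
    · simp
      norm_num
  have hexpo : ContDiff ℂ ω (fun p : ℂ × ℂ => expo c p.1 p.2) := by
    unfold expo
    fun_prop
  have hev : ∀ᶠ p : ℂ × ℂ in 𝓝 (1, 0), expo c p.1 p.2 ∈ expoRegion :=
    hexpo.continuous.continuousAt.eventually_mem (isOpen_expoRegion.mem_nhds hmem)
  have h1 := contDiffAt_expCompSum (X := Hinf) (p₀ := ((1, 0) : ℂ × ℂ)) (z := fun p : ℂ × ℂ => p.2)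
    (w := fun p : ℂ × ℂ => expo c p.1 p.2) isOpen_expoRegion summable_branch_bound
    (fun m w hw => norm_expComp_branch_le m (le_of_lt hw.1)
      (by simpa using (Metric.mem_ball.mp hw.2).le)) (costSeq c hc)
    contDiffAt_snd hexpo.contDiffAt hmem
  refine h1.congr_of_eventuallyEq ?_
  filter_upwards [hev] with p hp
  exact transferOperator_eq_expCompSum hc hp

end GaussEuclid

end

/-! ### Inverse branches of the Gauss map and duality. -/

noncomputable section

namespace GaussEuclid

theorem iUnion_Ioc_one_div : ⋃ m : ℕ, Set.Ioc (1 / ((m : ℝ) + 2)) (1 / ((m : ℝ) + 1)) =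
    Set.Ioc (0 : ℝ) 1 := by
  ext x
  simp only [Set.mem_iUnion, Set.mem_Ioc]
  constructor
  · rintro ⟨m, h1, h2⟩
    have hm : (0 : ℝ) ≤ m := m.cast_nonneg
    refine ⟨lt_trans (by positivity) h1, h2.trans ?_⟩
    rw [div_le_one (by positivity)]
    linarith
  · rintro ⟨h0, h1⟩
    have hx1 : 1 ≤ 1 / x := by rwa [one_le_div h0]
    have hf := Nat.floor_le (zero_le_one.trans hx1)
    have hf' := Nat.lt_floor_add_one (1 / x)
    obtain ⟨m, hm⟩ : ∃ m, ⌊1 / x⌋₊ = m + 1 :=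
      Nat.exists_eq_succ_of_ne_zero (Nat.one_le_iff_ne_zero.mp (Nat.le_floor (by simpa using hx1)))
    rw [hm] at hf hf'
    push_cast at hf hf'
    refine ⟨m, ?_, ?_⟩
    · rw [div_lt_comm₀ (by positivity) h0]
      linarith
    · rwa [le_div_comm₀ h0 (by positivity)]

theorem floor_one_div_of_mem {m : ℕ} {y : ℝ}
    (hy : y ∈ Set.Ioc (1 / ((m : ℝ) + 2)) (1 / ((m : ℝ) + 1))) : ⌊1 / y⌋₊ = m + 1 := by
  have hm : (0 : ℝ) ≤ m := m.cast_nonneg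
  have h0 : 0 < y := lt_trans (by positivity) hy.1
  rw [Nat.floor_eq_iff (by positivity)]
  push_cast
  constructor
  · rw [le_div_comm₀ (by positivity) h0]
    exact hy.2
  · rw [div_lt_comm₀ h0 (by positivity)]
    have : (m : ℝ) + 1 + 1 = m + 2 := by ring
    rw [this]
    exact hy.1

theorem pairwise_disjoint_Ioc_one_div : Pairwise (Function.onFun Disjoint fun m : ℕ =>
    Set.Ioc (1 / ((m : ℝ) + 2)) (1 / ((m : ℝ) + 1))) := by
  intro m n hmn
  refine Set.disjoint_left.mpr fun y hy hy' => hmn ?_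
  have := (floor_one_div_of_mem hy).symm.trans (floor_one_div_of_mem hy')
  omega

theorem image_branch (m : ℕ) : (fun x : ℝ => 1 / (x + ((m : ℝ) + 1))) '' Set.Ioo 0 1 =
    Set.Ioo (1 / ((m : ℝ) + 2)) (1 / ((m : ℝ) + 1)) := by
  have hm : (0 : ℝ) ≤ m := m.cast_nonneg
  ext y
  simp only [Set.mem_image, Set.mem_Ioo]
  constructor
  · rintro ⟨x, ⟨h0, h1⟩, rfl⟩
    constructor
    · exact one_div_lt_one_div_of_lt (by positivity) (by linarith)
    · exact one_div_lt_one_div_of_lt (by positivity) (by linarith)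
  · rintro ⟨h1, h2⟩
    have h0 : 0 < y := lt_trans (by positivity) h1
    refine ⟨1 / y - (m + 1), ⟨?_, ?_⟩, ?_⟩
    · rw [lt_div_comm₀ h0 (by positivity)] at h2
      linarith
    · rw [div_lt_comm₀ (by positivity) h0] at h1
      linarith
    · simp

theorem hasDerivWithinAt_branch (m : ℕ) : ∀ x ∈ Set.Ioo (0 : ℝ) 1,
    HasDerivWithinAt (fun x : ℝ => 1 / (x + ((m : ℝ) + 1))) (-(1 / (x + ((m : ℝ) + 1)) ^ 2))
      (Set.Ioo 0 1) x := by
  intro x hx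
  have hm : (0 : ℝ) ≤ m := m.cast_nonneg
  have h0 : x + ((m : ℝ) + 1) ≠ 0 := by linarith [hx.1]
  have h := ((hasDerivAt_id x).add_const ((m : ℝ) + 1)).inv h0
  simp only [id, one_div] at h ⊢
  refine HasDerivAt.hasDerivWithinAt (h.congr_deriv ?_)
  ring

theorem injOn_branch (m : ℕ) : Set.InjOn (fun x : ℝ => 1 / (x + ((m : ℝ) + 1))) (Set.Ioo 0 1) := by
  intro x hx y hy hxy
  simpa using hxy

variable {E : Type*} [NormedAddCommGroup E] [NormedSpace ℝ E]

/-- Change of variables along the inverse branch `x ↦ 1/(x + n)`; passing to open intervals loses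
only null sets. -/
theorem integral_branch (m : ℕ) (F : ℝ → E) :
    ∫ y in Set.Ioc (1 / ((m : ℝ) + 2)) (1 / ((m : ℝ) + 1)), F y =
      ∫ x in Set.Ioo (0 : ℝ) 1, (1 / (x + ((m : ℝ) + 1)) ^ 2) • F (1 / (x + ((m : ℝ) + 1))) := by
  rw [integral_Ioc_eq_integral_Ioo, ← image_branch,
    integral_image_eq_integral_abs_deriv_smul measurableSet_Ioo (hasDerivWithinAt_branch m)
      (injOn_branch m)]
  refine setIntegral_congr_fun measurableSet_Ioo fun x _ => ?_
  simp only [abs_neg]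
  rw [abs_of_nonneg (by positivity)]

theorem integrableOn_branch (m : ℕ) {F : ℝ → E} (hF : IntegrableOn F (Set.Ioc 0 1)) :
    IntegrableOn (fun x : ℝ => (1 / (x + ((m : ℝ) + 1)) ^ 2) • F (1 / (x + ((m : ℝ) + 1))))
      (Set.Ioo 0 1) := by
  have h1 : IntegrableOn F ((fun x : ℝ => 1 / (x + ((m : ℝ) + 1))) '' Set.Ioo 0 1) := by
    rw [image_branch]
    refine hF.mono_set (Set.Ioo_subset_Ioc_self.trans ?_)
    rw [← iUnion_Ioc_one_div]
    exact Set.subset_iUnion (fun m : ℕ => Set.Ioc (1 / ((m : ℝ) + 2)) (1 / ((m : ℝ) + 1))) m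
  rw [integrableOn_image_iff_integrableOn_abs_deriv_smul measurableSet_Ioo
    (hasDerivWithinAt_branch m) (injOn_branch m)] at h1
  refine h1.congr_fun (fun x _ => ?_) measurableSet_Ioo
  simp only [abs_neg]
  rw [abs_of_nonneg (by positivity)]

theorem hasSum_integral_Ioc_one_div {F : ℝ → E} (hF : IntegrableOn F (Set.Ioc 0 1)) :
    HasSum (fun m : ℕ => ∫ y in Set.Ioc (1 / ((m : ℝ) + 2)) (1 / ((m : ℝ) + 1)), F y)
      (∫ y in Set.Ioc (0 : ℝ) 1, F y) := by
  have h := hasSum_integral_iUnion (μ := volume) (f := F) (fun _ => measurableSet_Ioc)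
    pairwise_disjoint_Ioc_one_div (by rwa [iUnion_Ioc_one_div])
  rwa [iUnion_Ioc_one_div] at h

/-- Change of variables for the Gauss map, summed over all of its inverse branches. -/
theorem integral_tsum_branch {F : ℝ → E} (hF : IntegrableOn F (Set.Ioc 0 1)) :
    ∫ x in Set.Ioc (0 : ℝ) 1,
      ∑' m : ℕ, (1 / (x + ((m : ℝ) + 1)) ^ 2) • F (1 / (x + ((m : ℝ) + 1))) =
      ∫ y in Set.Ioc (0 : ℝ) 1, F y := by
  rw [integral_Ioc_eq_integral_Ioo]
  -- Exchanging sum and integral needs absolute summability, which is the same partition identity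
  -- for `‖F‖`.
  have h1 : Summable fun m : ℕ => ∫ x in Set.Ioo (0 : ℝ) 1,
      ‖(1 / (x + ((m : ℝ) + 1)) ^ 2) • F (1 / (x + ((m : ℝ) + 1)))‖ := by
    refine (hasSum_integral_Ioc_one_div hF.norm).summable.congr fun m => ?_
    rw [integral_branch]
    refine setIntegral_congr_fun measurableSet_Ioo fun x _ => ?_
    rw [norm_smul, smul_eq_mul, Real.norm_of_nonneg (by positivity)]
  have h2 := hasSum_integral_of_summable_integral_norm (fun m => integrableOn_branch m hF) h1
  refine h2.unique ?_
  refine (hasSum_integral_Ioc_one_div hF).congr_fun fun m => ?_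
  rw [integral_branch]

theorem gaussMap_branch {x : ℝ} (hx : x ∈ Set.Ioo (0 : ℝ) 1) (m : ℕ) :
    gaussMap (1 / (x + ((m : ℝ) + 1))) = x := by
  have h1 : ⌊x + ((m : ℝ) + 1)⌋ = (m : ℤ) + 1 := by
    rw [Int.floor_eq_iff]
    push_cast
    constructor <;> linarith [hx.1, hx.2]
  rw [gaussMap, one_div_one_div, h1]
  push_cast
  ring

theorem measurable_gaussMap : Measurable gaussMap := by
  unfold gaussMap
  have : Measurable fun x : ℝ => 1 / x := by fun_prop
  exact this.sub ((measurable_from_top (f := fun n : ℤ => (n : ℝ))).comp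
    (Int.measurable_floor.comp this))

theorem measurable_psi (c : ℕ → ℝ) : Measurable (psi c) := by
  unfold psi
  refine Measurable.ite ?_ ?_ measurable_const
  · exact (measurableSet_Ioc : MeasurableSet (Set.Ioc (0 : ℝ) 1))
  · have h1 : Measurable fun x : ℝ => 1 / x := by fun_prop
    exact ((measurable_from_top (f := c)).comp (Nat.measurable_floor.comp h1)).add
      (Real.measurable_log.const_mul _)

theorem psi_of_mem {c : ℕ → ℝ} {y : ℝ} (hy : y ∈ Set.Ioc (0 : ℝ) 1) :
    psi c y = c ⌊1 / y⌋₊ + mean c * Real.log y := if_pos hy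

theorem branch_mem {x : ℝ} (hx : x ∈ Set.Ioo (0 : ℝ) 1) (m : ℕ) :
    1 / (x + ((m : ℝ) + 1)) ∈ Set.Ioc (1 / ((m : ℝ) + 2)) (1 / ((m : ℝ) + 1)) := by
  have h : 1 / (x + ((m : ℝ) + 1)) ∈ (fun x : ℝ => 1 / (x + ((m : ℝ) + 1))) '' Set.Ioo 0 1 :=
    ⟨x, hx, rfl⟩
  rw [image_branch] at h
  exact Set.Ioo_subset_Ioc_self h

/-- The weight of the transfer operator: `x ^ (2 s - 2) * exp (ω ψ(x))`. -/
def weight (c : ℕ → ℝ) (s o : ℂ) (x : ℝ) : ℂ :=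
  Complex.exp ((2 * s - 2) * (Real.log x : ℂ) + o * (psi c x : ℂ))

/-- The factor `(x + n)^{-2}` is split off as the Jacobian of the branch. With `y = 1/(x + n)` the
rest, `y^{2s - 2 + μω} e^{ω c(n)}`, is `weight` at `y`, because `ψ` contains the term `μ log y`. -/
theorem evalAt_transferOperator_real {c : ℕ → ℝ} {s o : ℂ} (h : Admissible c s o) (f : Hinf)
    {x : ℝ} (hx : x ∈ Set.Ioo (0 : ℝ) 1) :
    evalAt x (transferOperator c s o f) = ∑' m : ℕ, (1 / (x + ((m : ℝ) + 1)) ^ 2) •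
      (weight c s o (1 / (x + ((m : ℝ) + 1))) * evalAt ((1 / (x + ((m : ℝ) + 1)) : ℝ) : ℂ) f) := by
  rw [evalAt_transferOperator h f (mem_disc_of_mem_Icc (Set.Ioo_subset_Icc_self hx)), transferFun]
  refine tsum_congr fun m => ?_
  have hm : (0 : ℝ) ≤ m := m.cast_nonneg
  have hr : 0 < x + ((m : ℝ) + 1) := by linarith [hx.1]
  have hb := branch_mem hx m
  have hb' : 1 / (x + ((m : ℝ) + 1)) ∈ Set.Ioc (0 : ℝ) 1 := by
    rw [← iUnion_Ioc_one_div]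
    exact Set.mem_iUnion.mpr ⟨m, hb⟩
  have hcast : (x : ℂ) + ((m : ℂ) + 1) = ((x + ((m : ℝ) + 1) : ℝ) : ℂ) := by push_cast; ring
  have hlog : Real.log (1 / (x + ((m : ℝ) + 1))) = -Real.log (x + ((m : ℝ) + 1)) := by
    rw [one_div, Real.log_inv]
  have hsq : ((1 / (x + ((m : ℝ) + 1)) ^ 2 : ℝ) : ℂ) =
      Complex.exp (-2 * (Real.log (x + ((m : ℝ) + 1)) : ℂ)) := by
    rw [show (-2 * (Real.log (x + ((m : ℝ) + 1)) : ℂ)) =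
      ((-2 * Real.log (x + ((m : ℝ) + 1)) : ℝ) : ℂ) by push_cast; ring, ← Complex.ofReal_exp]
    congr 1
    rw [show -2 * Real.log (x + ((m : ℝ) + 1)) = -Real.log ((x + ((m : ℝ) + 1)) ^ 2) by
      rw [Real.log_pow]; push_cast; ring, Real.exp_neg, Real.exp_log (by positivity), one_div]
  rw [Complex.real_smul, hsq, weight, psi_of_mem hb', floor_one_div_of_mem hb, hlog, transferTerm,
    ← evalAt_apply, hcast, Complex.cpow_def_of_ne_zero (by exact_mod_cast hr.ne'),
    ← Complex.ofReal_log hr.le, ← Complex.exp_sub, ← mul_assoc, ← Complex.exp_add]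
  congr 2
  · rw [expo]
    push_cast
    ring
  · push_cast
    rfl

/-- Duality between the transfer operator and composition with the Gauss map. -/
theorem integral_transferOperator_mul {c : ℕ → ℝ} {s o : ℂ} (h : Admissible c s o) (f : Hinf)
    (g : ℝ → ℂ) (hint : IntegrableOn (fun y : ℝ => weight c s o y * evalAt y f * g (gaussMap y))
      (Set.Ioc 0 1)) :
    ∫ x in Set.Ioc (0 : ℝ) 1, evalAt x (transferOperator c s o f) * g x =
      ∫ y in Set.Ioc (0 : ℝ) 1, weight c s o y * evalAt y f * g (gaussMap y) := by
  rw [← integral_tsum_branch hint, integral_Ioc_eq_integral_Ioo, integral_Ioc_eq_integral_Ioo]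
  refine setIntegral_congr_fun measurableSet_Ioo fun x hx => ?_
  rw [evalAt_transferOperator_real h f hx, ← tsum_mul_right]
  refine tsum_congr fun m => ?_
  rw [gaussMap_branch hx, smul_mul_assoc]

theorem weight_one_zero (c : ℕ → ℝ) (x : ℝ) : weight c 1 0 x = 1 := by simp [weight]

theorem integral_transferOperator_one_zero_mul {c : ℕ → ℝ}
    (hc : ∃ B : ℝ, ∀ n, 1 ≤ n → |c n| ≤ B) (f : Hinf) {g : ℝ → ℂ} (hg : Measurable g)
    (hgb : ∃ C, ∀ x, ‖g x‖ ≤ C) :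
    ∫ x in Set.Ioc (0 : ℝ) 1, evalAt x (transferOperator c 1 0 f) * g x =
      ∫ y in Set.Ioc (0 : ℝ) 1, evalAt y f * g (gaussMap y) := by
  rw [integral_transferOperator_mul (admissible_one_zero hc) f g]
  · simp_rw [weight_one_zero, one_mul]
  · simp_rw [weight_one_zero, one_mul]
    exact integrable_evalAt_mul (g := fun y => g (gaussMap y)) (hg.comp measurable_gaussMap)
      ⟨hgb.choose, fun x => hgb.choose_spec _⟩ f

theorem meanCLM_transferOperator {c : ℕ → ℝ} (hc : ∃ B : ℝ, ∀ n, 1 ≤ n → |c n| ≤ B) (f : Hinf) :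
    meanCLM (transferOperator c 1 0 f) = meanCLM f := by
  have := integral_transferOperator_one_zero_mul hc f (g := fun _ => 1) measurable_const
    ⟨1, by simp⟩
  simpa [meanCLM_apply] using this

end GaussEuclid

end

/-! ### Maximum principle, compactness and the spectral gap at `(1, 0)`. -/

noncomputable section

theorem isCompactOperator_smulRight {X Y : Type*} [NormedAddCommGroup X] [NormedSpace ℂ X]
    [NormedAddCommGroup Y] [NormedSpace ℂ Y] (l : X →L[ℂ] ℂ) (y : Y) :
    IsCompactOperator (l.smulRight y) := by
  have h1 : IsCompactOperator l := isCompactOperator_of_locallyCompactSpace_dom l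
  exact h1.clm_comp (ContinuousLinearMap.toSpanSingleton ℂ y)

theorem isCompactOperator_sum {X Y ι : Type*} [NormedAddCommGroup X] [NormedSpace ℂ X]
    [NormedAddCommGroup Y] [NormedSpace ℂ Y] (s : Finset ι) {T : ι → X →L[ℂ] Y}
    (hT : ∀ i, IsCompactOperator (T i)) : IsCompactOperator (∑ i ∈ s, T i : X →L[ℂ] Y) := by
  classical
  induction s using Finset.induction_on with
  | empty =>
    rw [Finset.sum_empty]
    exact isCompactOperator_zero
  | insert i s hi ih =>
    rw [Finset.sum_insert hi]
    exact (hT i).add ih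

namespace GaussEuclid

/-- Identity theorem: 0 is an interior point of the disc, so it may serve as the accumulation point.
-/
theorem Hinf.eq_of_eq_on_seq_tendsto_zero {f g : Hinf} {y : ℕ → ℂ} (hy : Tendsto y atTop (𝓝 0))
    (hy0 : ∀ n, y n ≠ 0) (h : ∀ n, evalAt (y n) f = evalAt (y n) g) : f = g := by
  have hmem0 : (0 : ℂ) ∈ disc := by
    simpa using mem_disc_of_mem_Icc (x := 0) (by simp)
  refine Hinf.ext_evalAt ?_
  have han : AnalyticOnNhd ℂ (fun z => evalAt z f) disc :=
    (differentiableOn_evalAt f).analyticOnNhd isOpen_disc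
  have hang : AnalyticOnNhd ℂ (fun z => evalAt z g) disc :=
    (differentiableOn_evalAt g).analyticOnNhd isOpen_disc
  refine han.eqOn_of_preconnected_of_frequently_eq hang
    (convex_ball _ _).isPreconnected hmem0 ?_
  have ht : Tendsto y atTop (𝓝[≠] 0) :=
    tendsto_nhdsWithin_iff.mpr ⟨hy, Eventually.of_forall hy0⟩
  exact ht.frequently (Eventually.of_forall h).frequently

/-- Rigidity in the maximum principle: an eigenfunction of the Gauss operator for an eigenvalue of
modulus at least one is a multiple of the Gauss density. -/
theorem eq_smul_density_of_eigenvector {c : ℕ → ℝ} (hc : ∃ B : ℝ, ∀ n, 1 ≤ n → |c n| ≤ B)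
    {f : Hinf} {lam : ℂ} (hlam : 1 ≤ ‖lam‖) (hf : transferOperator c 1 0 f = lam • f) :
    ∃ a : ℂ, f = a • density := by
  have hadm := admissible_one_zero hc
  set h : ℝ → ℂ := fun x => evalAt x f / evalAt x density with hh
  have hcont : ContinuousOn h (Set.Icc 0 1) :=
    (continuousOn_evalAt_real f).div (continuousOn_evalAt_real density) fun x hx =>
      evalAt_density_ne_zero (mem_disc_of_mem_Icc hx)
  -- Here `x` maximises `|f / density|` on `[0, 1]`. Conjugation by the density turns the operator
  -- into an averaging operator.
  obtain ⟨x, hx, hmax⟩ := isCompact_Icc.exists_isMaxOn ⟨0, by simp⟩ hcont.norm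
  have hxd := mem_disc_of_mem_Icc hx
  set M := ‖h x‖ with hM
  set y : ℕ → ℝ := fun m => 1 / (x + ((m : ℝ) + 1)) with hy
  have hr : ∀ m : ℕ, (m : ℝ) + 1 ≤ x + ((m : ℝ) + 1) := fun m => by linarith [hx.1]
  have hrpos : ∀ m : ℕ, 0 < x + ((m : ℝ) + 1) := fun m => lt_of_lt_of_le (by positivity) (hr m)
  have hymem : ∀ m, y m ∈ Set.Icc (0 : ℝ) 1 := fun m => by
    refine ⟨(one_div_pos.mpr (hrpos m)).le, ?_⟩
    rw [hy, div_le_one (hrpos m)]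
    exact le_trans (by have : (0 : ℝ) ≤ m := m.cast_nonneg
                       linarith) (hr m)
  have hfx : ∀ t ∈ Set.Icc (0 : ℝ) 1, evalAt t f = h t * evalAt t density := fun t ht =>
    (div_mul_cancel₀ _ (evalAt_density_ne_zero (mem_disc_of_mem_Icc ht))).symm
  have hxi : ∀ t ∈ Set.Icc (0 : ℝ) 1, 0 < xi t := fun t ht => by
    have := Real.log_pos one_lt_two
    have h1 := ht.1
    unfold xi
    positivity
  set p : ℕ → ℝ := fun m => 1 / (x + ((m : ℝ) + 1)) ^ 2 * xi (y m) / xi x with hp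
  have hp0 : ∀ m, 0 < p m := fun m =>
    div_pos (mul_pos (by have := hrpos m; positivity) (hxi _ (hymem m))) (hxi x hx)
  have hcast : ∀ m : ℕ, 1 / ((x : ℂ) + ((m : ℂ) + 1)) = (y m : ℂ) := fun m => by
    simp only [hy]
    push_cast
    rfl
  have hcast2 : ∀ m : ℕ, (x : ℂ) + ((m : ℂ) + 1) = ((x + ((m : ℝ) + 1) : ℝ) : ℂ) := fun m => by
    push_cast
    rfl
  have hsum : ∀ F : Hinf, HasSum (fun m : ℕ => ((1 / (x + ((m : ℝ) + 1)) ^ 2 : ℝ) : ℂ) *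
      evalAt (y m) F) (evalAt x (transferOperator c 1 0 F)) := fun F => by
    rw [evalAt_transferOperator hadm F hxd]
    refine (transferTerm_summable hadm F.1 hxd).hasSum.congr_fun fun m => ?_
    rw [transferTerm_one_zero, hcast, hcast2]
    push_cast
    rfl
  have hxix : (xi x : ℂ) ≠ 0 := by exact_mod_cast (hxi x hx).ne'
  -- Invariance of the density says that the positive weights `p` have total mass one.
  have hpsum : HasSum p 1 := by
    have h1 := (hsum density).div_const (xi x : ℂ)
    rw [transferOperator_density hc, evalAt_density_real hx, div_self hxix] at h1
    have h2 : HasSum (fun m => ((p m : ℝ) : ℂ)) ((1 : ℝ) : ℂ) := by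
      rw [Complex.ofReal_one]
      refine h1.congr_fun fun m => ?_
      rw [evalAt_density_real (hymem m), hp]
      push_cast
      rfl
    exact_mod_cast h2
  have hhsum : HasSum (fun m => (p m : ℂ) * h (y m)) (lam * h x) := by
    have h1 := (hsum f).div_const (xi x : ℂ)
    rw [hf, map_smul, smul_eq_mul] at h1
    have h3 : lam * evalAt x f / (xi x : ℂ) = lam * h x := by
      rw [mul_div_assoc, ← evalAt_density_real hx]
    rw [h3] at h1
    refine h1.congr_fun fun m => ?_
    rw [hfx _ (hymem m), evalAt_density_real (hymem m), hp]
    push_cast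
    ring
  set a := lam * h x with ha
  have hle : ∀ m, ‖h (y m)‖ ≤ M := fun m => hmax (hymem m)
  have haM : ‖a‖ ≤ M := by
    have h1 := tsum_of_norm_bounded (hpsum.mul_right M) (f := fun m => (p m : ℂ) * h (y m))
      (fun m => by
        rw [norm_mul, Complex.norm_real, Real.norm_of_nonneg (hp0 m).le]
        exact mul_le_mul_of_nonneg_left (hle m) (hp0 m).le)
    rwa [hhsum.tsum_eq, one_mul] at h1
  have hMa : ‖a‖ = M := by
    refine le_antisymm haM ?_
    rw [ha, norm_mul]
    exact le_mul_of_one_le_left (norm_nonneg _) hlam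
  -- The average `a` of the values `h (y m)` has modulus `M`, and each value has modulus at most
  -- `M`. These nonnegative defects have weighted sum zero, so every one of them vanishes.
  have hre : HasSum (fun m => p m * (M ^ 2 - (starRingEnd ℂ a * h (y m)).re)) 0 := by
    have h1 := Complex.hasSum_re (hhsum.mul_left (starRingEnd ℂ a))
    have h2 := (hpsum.mul_right (M ^ 2)).sub h1
    have h3 : 1 * M ^ 2 - (starRingEnd ℂ a * a).re = 0 := by
      rw [← Complex.normSq_eq_conj_mul_self, Complex.ofReal_re, Complex.normSq_eq_norm_sq, hMa]
      ring
    rw [h3] at h2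
    refine h2.congr_fun fun m => ?_
    rw [mul_left_comm, Complex.re_ofReal_mul]
    ring
  have hre_le : ∀ m, (starRingEnd ℂ a * h (y m)).re ≤ M ^ 2 := fun m => by
    refine (Complex.re_le_norm _).trans ?_
    rw [norm_mul, RCLike.norm_conj, hMa, sq]
    exact mul_le_mul_of_nonneg_left (hle m) (norm_nonneg _)
  have hzero := (hasSum_zero_iff_of_nonneg (fun m =>
    mul_nonneg (hp0 m).le (sub_nonneg.mpr (hre_le m)))).mp hre
  have heq : ∀ m, h (y m) = a := fun m => by
    have h1 : M ^ 2 - (starRingEnd ℂ a * h (y m)).re = 0 := by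
      have := congrFun hzero m
      simpa [(hp0 m).ne'] using this
    have h2 : Complex.normSq (h (y m) - a) ≤ 0 := by
      rw [Complex.normSq_sub, Complex.normSq_eq_norm_sq, Complex.normSq_eq_norm_sq, hMa,
        mul_comm (h (y m))]
      have h3 : ‖h (y m)‖ ^ 2 ≤ M ^ 2 := pow_le_pow_left₀ (norm_nonneg _) (hle m) 2
      linarith
    exact sub_eq_zero.mp (Complex.normSq_eq_zero.mp (le_antisymm h2 (Complex.normSq_nonneg _)))
  -- The points `y m = 1/(x + m + 1)` tend to 0, so the equality on them spreads to the whole disc.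
  refine ⟨a, Hinf.eq_of_eq_on_seq_tendsto_zero (y := fun m => (y m : ℂ)) ?_ (fun m => ?_)
    fun m => ?_⟩
  · rw [← Complex.ofReal_zero]
    refine (Complex.continuous_ofReal.tendsto 0).comp ?_
    refine squeeze_zero (fun m => (hymem m).1) (fun m => ?_)
      tendsto_one_div_add_atTop_nhds_zero_nat
    exact one_div_le_one_div_of_le (by positivity) (hr m)
  · exact Complex.ofReal_ne_zero.mpr (one_div_pos.mpr (hrpos m)).ne'
  · rw [hfx _ (hymem m), heq, map_smul, smul_eq_mul]

/-- Inversion sends the half-plane `Re w > 2/3` onto the disc with diameter from 0 to 3/2, whose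
farthest point from 2/3 is 3/2, at distance 5/6. This strict contraction of the disc is the source
of compactness. -/
theorem inv_mem_closedBall {z : ℂ} (hz : z ∈ disc) (m : ℕ) :
    ‖1 / (z + ((m : ℂ) + 1)) - 2 / 3‖ ≤ 5 / 6 := by
  have hre := re_add_lower hz m
  have hne := add_natCast_ne_zero hz m
  set w : ℂ := z + ((m : ℂ) + 1) with hw
  have hm : (0 : ℝ) ≤ m := Nat.cast_nonneg m
  have hwn : 0 < ‖w‖ := norm_pos_iff.mpr hne
  have heq : 1 / w - 2 / 3 = (3 - 2 * w) / (3 * w) := by field_simp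
  have hkey : ‖3 - 2 * w‖ ≤ 5 / 2 * ‖w‖ := by
    refine le_of_sq_le_sq ?_ (by positivity)
    rw [mul_pow, Complex.sq_norm, Complex.sq_norm, Complex.normSq_apply, Complex.normSq_apply]
    have e1 : (3 - 2 * w : ℂ).re = 3 - 2 * w.re := by simp
    have e2 : (3 - 2 * w : ℂ).im = -2 * w.im := by simp
    rw [e1, e2]
    nlinarith [sq_nonneg w.im]
  rw [heq, norm_div, norm_mul, div_le_iff₀ (by simpa using hwn)]
  simp only [Complex.norm_ofNat]
  linarith

/-- Cauchy's estimate on a circle of radius 11/12, chosen strictly between 5/6 and 1. -/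
theorem iteratedDeriv_center_bound (f : Hinf) (k : ℕ) :
    ‖iteratedDeriv k (fun z => evalAt z f) (2 / 3)‖ ≤ k.factorial * ‖f‖ / (11 / 12) ^ k := by
  refine Complex.norm_iteratedDeriv_le_of_forall_mem_sphere_norm_le k (by norm_num) ?_
    fun z _ => norm_evalAt_le z f
  refine ((differentiableOn_evalAt f).mono ?_).diffContOnCl
  rw [closure_ball _ (by norm_num)]
  exact Metric.closedBall_subset_ball (by norm_num)

theorem contDiffAt_evalAt_center (f : Hinf) (k : ℕ) :
    ContDiffAt ℂ k (fun z => evalAt z f) (2 / 3) :=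
  ((differentiableOn_evalAt f).analyticAt (isOpen_disc.mem_nhds (by simp [disc]))).contDiffAt

theorem norm_taylorCoeff_aux (f : Hinf) (k : ℕ) :
    ‖(k.factorial : ℂ)⁻¹ * iteratedDeriv k (fun z => evalAt z f) (2 / 3)‖ ≤
      (12 / 11) ^ k * ‖f‖ := by
  have hk : (0 : ℝ) < k.factorial := by exact_mod_cast k.factorial_pos
  have h := iteratedDeriv_center_bound f k
  rw [norm_mul, norm_inv, Complex.norm_natCast, inv_mul_le_iff₀ hk]
  refine h.trans (le_of_eq ?_)
  rw [mul_div_assoc, div_eq_mul_inv, ← inv_pow, mul_comm ‖f‖, inv_div]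

/-- The `k`-th Taylor coefficient at the centre of the disc, as a linear functional. -/
def taylorCoeff (k : ℕ) : Hinf →L[ℂ] ℂ :=
  LinearMap.mkContinuous
    { toFun := fun f => (k.factorial : ℂ)⁻¹ * iteratedDeriv k (fun z => evalAt z f) (2 / 3)
      map_add' := fun f g => by
        simp only [map_add]
        rw [iteratedDeriv_fun_add (contDiffAt_evalAt_center f k) (contDiffAt_evalAt_center g k),
          mul_add]
      map_smul' := fun a f => by
        simp only [map_smul, smul_eq_mul, RingHom.id_apply]
        rw [iteratedDeriv_const_mul_field, mul_left_comm] } ((12 / 11) ^ k)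
    (fun f => norm_taylorCoeff_aux f k)

theorem taylorCoeff_apply (k : ℕ) (f : Hinf) :
    taylorCoeff k f = (k.factorial : ℂ)⁻¹ * iteratedDeriv k (fun z => evalAt z f) (2 / 3) := rfl

theorem norm_taylorCoeff_le (k : ℕ) (f : Hinf) : ‖taylorCoeff k f‖ ≤ (12 / 11) ^ k * ‖f‖ :=
  norm_taylorCoeff_aux f k

/-- The monomial `(z - 2/3)^k` as an element of `H^∞(𝔻)`. -/
def centeredMonomial (k : ℕ) : Hinf :=
  Hinf.of (fun z => (z - 2 / 3) ^ k) (by fun_prop) ⟨1, fun z hz => by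
    rw [norm_pow]
    refine pow_le_one₀ (norm_nonneg _) (le_of_lt ?_)
    simpa [disc, Metric.mem_ball, dist_eq_norm] using hz⟩

/-- Truncation of the Taylor series at the centre of the disc. -/
def taylorTrunc (K : ℕ) : Hinf →L[ℂ] Hinf :=
  ∑ k ∈ Finset.range K, (taylorCoeff k).smulRight (centeredMonomial k)

/-- On the smaller ball the Taylor series is dominated by a geometric one of ratio `(12/11)(5/6) =
10/11`; the factor 11 is the sum of that series. -/
theorem norm_sub_taylorTrunc_le (K : ℕ) (f : Hinf) {z : ℂ} (hz : ‖z - 2 / 3‖ ≤ 5 / 6) :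
    ‖evalAt z (f - taylorTrunc K f)‖ ≤ (10 / 11) ^ K * 11 * ‖f‖ := by
  have hzd : z ∈ disc := by
    rw [disc, Metric.mem_ball, dist_eq_norm]
    linarith
  have h1 : HasSum (fun k : ℕ => taylorCoeff k f * (z - 2 / 3) ^ k) (evalAt z f) := by
    refine (Complex.hasSum_taylorSeries_on_ball (differentiableOn_evalAt f) hzd).congr_fun
      fun k => ?_
    rw [taylorCoeff_apply, smul_eq_mul, smul_eq_mul]
    ring
  have h2 : evalAt z (taylorTrunc K f) =
      ∑ k ∈ Finset.range K, taylorCoeff k f * (z - 2 / 3) ^ k := by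
    rw [taylorTrunc, sum_apply, map_sum]
    refine Finset.sum_congr rfl fun k _ => ?_
    rw [ContinuousLinearMap.smulRight_apply, map_smul, smul_eq_mul, centeredMonomial,
      evalAt_of _ _ hzd]
  have h3 := (hasSum_nat_add_iff' K).mpr h1
  rw [map_sub, h2, ← h3.tsum_eq]
  have hg : HasSum (fun i : ℕ => (10 / 11 : ℝ) ^ i) 11 := by
    have := hasSum_geometric_of_lt_one (r := (10 / 11 : ℝ)) (by norm_num) (by norm_num)
    norm_num at this
    exact this
  refine tsum_of_norm_bounded ((hg.mul_left ((10 / 11) ^ K)).mul_right ‖f‖) fun i => ?_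
  rw [norm_mul, norm_pow, ← pow_add]
  calc ‖taylorCoeff (i + K) f‖ * ‖z - 2 / 3‖ ^ (i + K)
      ≤ ((12 / 11) ^ (i + K) * ‖f‖) * (5 / 6) ^ (i + K) :=
        mul_le_mul (norm_taylorCoeff_le _ _) (pow_le_pow_left₀ (norm_nonneg _) hz _)
          (by positivity) (by positivity)
    _ = (10 / 11) ^ (K + i) * ‖f‖ := by
        rw [mul_right_comm, ← mul_pow, add_comm i K,
          show (12 / 11 * (5 / 6) : ℝ) = 10 / 11 by norm_num]

theorem isCompactOperator_taylorTrunc (K : ℕ) : IsCompactOperator (taylorTrunc K) :=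
  isCompactOperator_sum (X := Hinf) (Y := Hinf) (Finset.range K)
    fun k => isCompactOperator_smulRight (taylorCoeff k) (centeredMonomial k)

/-- The operator reads `f` only at the points `1/(z + n)`, so only its size on the ball of radius
5/6 matters. -/
theorem exists_norm_transferOperator_le {c : ℕ → ℝ} (hc : ∃ B : ℝ, ∀ n, 1 ≤ n → |c n| ≤ B) :
    ∃ S : ℝ, 0 ≤ S ∧ ∀ (f : Hinf) (δ : ℝ), (∀ z, ‖z - 2 / 3‖ ≤ 5 / 6 → ‖evalAt z f‖ ≤ δ) →
      ‖transferOperator c 1 0 f‖ ≤ S * δ := by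
  have hadm := admissible_one_zero hc
  have hs : Summable fun m : ℕ => 1 / ((m : ℝ) + 2 / 3) ^ 2 := by
    have h0 : Summable fun m : ℕ => 3 * (1 / ((m + 1 : ℕ) : ℝ) ^ 2) :=
      (((summable_nat_add_iff 1).mpr (Real.summable_one_div_nat_pow.mpr one_lt_two))).mul_left 3
    refine Summable.of_nonneg_of_le (fun m => by positivity) (fun m => ?_) h0
    have hm : (0 : ℝ) ≤ m := m.cast_nonneg
    push_cast
    rw [mul_one_div, div_le_div_iff₀ (by positivity) (by positivity)]
    nlinarith
  refine ⟨∑' m : ℕ, 1 / ((m : ℝ) + 2 / 3) ^ 2, tsum_nonneg fun m => by positivity,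
    fun f δ hδ => ?_⟩
  have hδ0 : 0 ≤ δ := (norm_nonneg _).trans (hδ (2 / 3) (by norm_num))
  refine Hinf.norm_le (mul_nonneg (tsum_nonneg fun m => by positivity) hδ0) fun z hz => ?_
  rw [evalAt_transferOperator hadm f hz, transferFun]
  refine tsum_of_norm_bounded (hs.hasSum.mul_right δ) fun m => ?_
  have hm : (0 : ℝ) ≤ m := m.cast_nonneg
  have hlow : (m : ℝ) + 2 / 3 ≤ ‖z + ((m : ℂ) + 1)‖ :=
    (re_add_lower hz m).le.trans (Complex.re_le_norm _)
  rw [transferTerm_one_zero, norm_mul, norm_div, norm_one, norm_pow]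
  refine mul_le_mul ?_ (hδ _ (inv_mem_closedBall hz m)) (norm_nonneg _) (by positivity)
  exact one_div_le_one_div_of_le (by positivity) (pow_le_pow_left₀ (by positivity) hlow 2)

/-- Composing with Taylor truncations gives finite-rank operators, and the truncation error is
uniformly small exactly where the operator evaluates. -/
theorem isCompactOperator_transferOperator {c : ℕ → ℝ}
    (hc : ∃ B : ℝ, ∀ n, 1 ≤ n → |c n| ≤ B) : IsCompactOperator (transferOperator c 1 0) := by
  obtain ⟨S, hS0, hS⟩ := exists_norm_transferOperator_le hc
  have hcomp : ∀ K, IsCompactOperator ((transferOperator c 1 0).comp (taylorTrunc K)) := fun K =>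
    (isCompactOperator_taylorTrunc K).clm_comp (transferOperator c 1 0)
  refine isCompactOperator_of_tendsto (l := atTop)
    (F := fun K => (transferOperator c 1 0).comp (taylorTrunc K)) ?_
    (Eventually.of_forall hcomp)
  rw [tendsto_iff_norm_sub_tendsto_zero]
  have hlim : Tendsto (fun K : ℕ => S * ((10 / 11 : ℝ) ^ K * 11)) atTop (𝓝 0) := by
    have := ((tendsto_pow_atTop_nhds_zero_of_lt_one (r := (10 / 11 : ℝ)) (by norm_num)
      (by norm_num)).mul_const 11).const_mul S
    simpa using this
  refine squeeze_zero (fun K => norm_nonneg _) (fun K => ?_) hlim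
  rw [norm_sub_rev]
  refine ContinuousLinearMap.opNorm_le_bound _ (by positivity) fun f => ?_
  have h1 : (transferOperator c 1 0 - (transferOperator c 1 0).comp (taylorTrunc K)) f =
      transferOperator c 1 0 (f - taylorTrunc K f) := by
    rw [map_sub]
    rfl
  rw [h1, mul_assoc]
  exact hS _ _ fun z hz => norm_sub_taylorTrunc_le K f hz

theorem density_ne_zero : density ≠ 0 := by
  intro h
  have := meanCLM_density
  rw [h, map_zero] at this
  exact zero_ne_one this

/-- The spectral gap of the Gauss operator on `H^∞(𝔻)`. -/
theorem spectralRadius_transferOperator_sub_lt {c : ℕ → ℝ}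
    (hc : ∃ B : ℝ, ∀ n, 1 ≤ n → |c n| ≤ B) :
    spectralRadius ℂ (transferOperator c 1 0 - meanCLM.smulRight density) < 1 := by
  have : Nontrivial Hinf := ⟨density, 0, density_ne_zero⟩
  set N := transferOperator c 1 0 - meanCLM.smulRight density with hN
  have hcomp : IsCompactOperator N :=
    (isCompactOperator_transferOperator hc).sub (isCompactOperator_smulRight meanCLM density)
  have h : spectralRadius ℂ N < (1 : NNReal) := by
    refine spectrum.spectralRadius_lt_of_forall_lt N fun z hz => ?_
    by_contra! hz1
    have hz1' : 1 ≤ ‖z‖ := by exact_mod_cast hz1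
    have hz0 : z ≠ 0 := by
      rintro rfl
      simp at hz1'
      linarith
    -- By the Fredholm alternative it suffices to exclude eigenvalues.
    have heig := (hcomp.hasEigenvalue_or_mem_resolventSet hz0).resolve_right hz
    obtain ⟨f, hf⟩ := heig.exists_hasEigenvector
    have hf0 := hf.2
    have hNf : N f = z • f := hf.apply_eq_smul
    have hNf' : transferOperator c 1 0 f - meanCLM f • density = z • f := hNf
    -- The integral vanishes on the range of `N`, and `z ≠ 0`. So `f` is also an eigenfunction of
    -- the Gauss operator, hence a multiple of the density with zero integral.
    have hmean : meanCLM f = 0 := by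
      have h1 := congrArg meanCLM hNf'
      rw [map_sub, map_smul, map_smul, meanCLM_transferOperator hc, meanCLM_density, smul_eq_mul,
        mul_one, sub_self, smul_eq_mul] at h1
      exact (mul_eq_zero.mp h1.symm).resolve_left hz0
    rw [hmean, zero_smul, sub_zero] at hNf'
    obtain ⟨a, ha⟩ := eq_smul_density_of_eigenvector hc hz1' hNf'
    rw [ha, map_smul, meanCLM_density, smul_eq_mul, mul_one] at hmean
    exact hf0 (by rw [ha, hmean, zero_smul])
  simpa using h

end GaussEuclid

end

/-! ### Existence of a leading eigenvalue function. -/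

noncomputable section

open scoped ContDiff

namespace GaussEuclid

theorem eventually_admissible {c : ℕ → ℝ} (hc : ∃ B : ℝ, ∀ n, 1 ≤ n → |c n| ≤ B) :
    ∀ᶠ p : ℂ × ℂ in 𝓝 (1, 0), Admissible c p.1 p.2 := by
  have h1 : Continuous fun p : ℂ × ℂ => (expo c p.1 p.2).re := by
    unfold expo
    fun_prop
  have h2 : (1 : ℝ) < (expo c ((1, 0) : ℂ × ℂ).1 ((1, 0) : ℂ × ℂ).2).re :=
    (admissible_one_zero hc).2
  exact (h1.continuousAt.eventually_const_lt h2).mono fun p hp => ⟨hc, hp⟩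

theorem exists_isLeadingDecomposition {c : ℕ → ℝ} (hc : ∃ B : ℝ, ∀ n, 1 ≤ n → |c n| ≤ B) :
    ∃ (V : Set (ℂ × ℂ)) (lam : ℂ × ℂ → ℂ) (P N : ℂ × ℂ → (Hinf →L[ℂ] Hinf)),
      IsLeadingDecomposition c V lam P N := by
  have hA := contDiffAt_transferOperator hc
  obtain ⟨lam, P, hlam, hP, hN, hev⟩ := exists_analytic_rank_one_decomposition (X := Hinf) hA
    (l := meanCLM) (x₀ := density) (transferOperator_density hc) meanCLM_density
    (meanCLM_transferOperator hc) (spectralRadius_transferOperator_sub_lt hc)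
  have hall := (eventually_admissible hc).and (hlam.analyticAt.eventually_analyticAt.and
    (hP.analyticAt.eventually_analyticAt.and (hN.analyticAt.eventually_analyticAt.and hev)))
  obtain ⟨V, hV, hVo, hmem⟩ := eventually_nhds_iff.mp hall
  exact ⟨V, lam, P, fun p => transferOperator c p.1 p.2 - lam p • P p,
    { isOpen := hVo
      mem := hmem
      admissible := fun p hp => (hV p hp).1
      lam_analytic := fun p hp => (hV p hp).2.1
      P_analytic := fun p hp => (hV p hp).2.2.1
      N_analytic := fun p hp => (hV p hp).2.2.2.1
      decomp := fun p _ => by abel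
      P_comp_N := fun p hp => (hV p hp).2.2.2.2.1
      N_comp_P := fun p hp => (hV p hp).2.2.2.2.2.1
      P_proj := fun p hp => (hV p hp).2.2.2.2.2.2.1
      finrank_range := fun p hp => (hV p hp).2.2.2.2.2.2.2.1
      range_eq_eigenspace := fun p hp => (hV p hp).2.2.2.2.2.2.2.2.1
      spectralRadius_lt := fun p hp => (hV p hp).2.2.2.2.2.2.2.2.2 }⟩

end GaussEuclid

end

/-! ### Variance of Birkhoff sums by martingale-coboundary decomposition. -/

noncomputable section

section Martingale

variable {Ω : Type*} [MeasurableSpace Ω] {γ : Measure Ω} {T : Ω → Ω}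

/-- Orthogonality to bounded functions extends to `L²` by truncation and dominated convergence.
Birkhoff sums need this, since they are only square integrable. -/
theorem integral_mul_comp_eq_zero_of_memLp (hT : MeasurePreserving T γ γ)
    {m : Ω → ℝ} (hm : MemLp m 2 γ)
    (horth : ∀ g : Ω → ℝ, Measurable g → (∃ C, ∀ x, |g x| ≤ C) → ∫ x, m x * g (T x) ∂γ = 0)
    {g : Ω → ℝ} (hgm : Measurable g) (hg : MemLp g 2 γ) : ∫ x, m x * g (T x) ∂γ = 0 := by
  set t : ℕ → Ω → ℝ := fun k x => max (-(k : ℝ)) (min k (g x)) with ht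
  have habs : ∀ k x, |t k x| ≤ |g x| := fun k x => by
    have hk : (0 : ℝ) ≤ k := k.cast_nonneg
    rw [abs_le]
    constructor
    · exact le_max_of_le_right (le_min (by linarith [abs_nonneg (g x)]) (neg_abs_le _))
    · exact max_le (by linarith [abs_nonneg (g x)]) ((min_le_right _ _).trans (le_abs_self _))
  have hbd : ∀ k x, |t k x| ≤ k := fun k x => by
    rw [abs_le]
    exact ⟨le_max_left _ _, max_le (by linarith [(k.cast_nonneg : (0 : ℝ) ≤ k)]) (min_le_left _ _)⟩
  have htm : ∀ k, Measurable (t k) := fun k => measurable_const.max (measurable_const.min hgm)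
  have hlim : ∀ x, Tendsto (fun k => t k x) atTop (𝓝 (g x)) := fun x => by
    refine tendsto_const_nhds.congr' ?_
    filter_upwards [eventually_ge_atTop ⌈|g x|⌉₊] with k hk
    have hk' : |g x| ≤ k := (Nat.le_ceil _).trans (by exact_mod_cast hk)
    rw [abs_le] at hk'
    simp only [ht]
    rw [min_eq_right hk'.2, max_eq_right hk'.1]
  have hint : Integrable (fun x => |m x| * |g (T x)|) γ :=
    MemLp.integrable_mul (hm.abs) ((hg.comp_measurePreserving hT).abs)
  have h := tendsto_integral_of_dominated_convergence (μ := γ)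
    (F := fun k x => m x * t k (T x)) (f := fun x => m x * g (T x))
    (fun x => |m x| * |g (T x)|)
    (fun k => hm.1.mul ((htm k).comp hT.measurable).aestronglyMeasurable) hint
    (fun k => Eventually.of_forall fun x => by
      rw [norm_mul]
      exact mul_le_mul_of_nonneg_left (habs k _) (norm_nonneg _))
    (Eventually.of_forall fun x => (hlim (T x)).const_mul _)
  refine tendsto_nhds_unique h ?_
  simp_rw [horth _ (htm _) ⟨_, hbd _⟩]
  exact tendsto_const_nhds

theorem memLp_sum_iterate (hT : MeasurePreserving T γ γ) {m : Ω → ℝ} (hm : MemLp m 2 γ) (n : ℕ) :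
    MemLp (fun x => ∑ k ∈ Finset.range n, m (T^[k] x)) 2 γ :=
  memLp_finsetSum _ fun k _ => hm.comp_measurePreserving (hT.iterate k)

/-- Peel off the first term: the sum of length `n + 1` is `m + M ∘ T` with `M` the sum of length
`n`. The cross term vanishes by orthogonality and `M ∘ T` has the second moment of `M`. -/
theorem integral_sq_sum_iterate (hT : MeasurePreserving T γ γ) {m : Ω → ℝ} (hmm : Measurable m)
    (hm : MemLp m 2 γ)
    (horth : ∀ g : Ω → ℝ, Measurable g → (∃ C, ∀ x, |g x| ≤ C) → ∫ x, m x * g (T x) ∂γ = 0)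
    (n : ℕ) :
    ∫ x, (∑ k ∈ Finset.range n, m (T^[k] x)) ^ 2 ∂γ = n * ∫ x, m x ^ 2 ∂γ := by
  induction n with
  | zero => simp
  | succ n ih =>
    set M : Ω → ℝ := fun x => ∑ k ∈ Finset.range n, m (T^[k] x) with hM
    have hMm : Measurable M := Finset.measurable_fun_sum _ fun k _ =>
      hmm.comp (hT.measurable.iterate k)
    have hML : MemLp M 2 γ := memLp_sum_iterate hT hm n
    have h1 : ∀ x, (∑ k ∈ Finset.range (n + 1), m (T^[k] x)) ^ 2 =
        m x ^ 2 + 2 * (m x * M (T x)) + M (T x) ^ 2 := fun x => by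
      rw [Finset.sum_range_succ', hM]
      simp only [Function.iterate_succ, Function.comp, Function.iterate_zero, id]
      ring
    have hMT : ∫ x, M (T x) ^ 2 ∂γ = ∫ x, M x ^ 2 ∂γ := by
      have h := integral_map hT.measurable.aemeasurable (f := fun x => M x ^ 2)
        (hMm.pow_const 2).aestronglyMeasurable (μ := γ)
      rw [hT.map_eq] at h
      exact h.symm
    simp_rw [h1]
    have hi1 : Integrable (fun x => m x ^ 2) γ := hm.integrable_sq
    have hi2 : Integrable (fun x => 2 * (m x * M (T x))) γ :=
      (MemLp.integrable_mul hm (hML.comp_measurePreserving hT)).const_mul 2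
    have hi3 : Integrable (fun x => M (T x) ^ 2) γ := (hML.comp_measurePreserving hT).integrable_sq
    have hi12 : Integrable (fun x => m x ^ 2 + 2 * (m x * M (T x))) γ := hi1.add hi2
    rw [integral_add hi12 hi3, integral_add hi1 hi2, integral_const_mul,
      integral_mul_comp_eq_zero_of_memLp hT hm horth hMm hML, hMT, ih]
    push_cast
    ring

variable [IsProbabilityMeasure γ]

/-- The variance of a Birkhoff sum which is a martingale up to a bounded coboundary. -/
theorem tendsto_variance_of_martingale_coboundary (hT : MeasurePreserving T γ γ) {ψ h : Ω → ℝ}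
    (hψm : Measurable ψ) (hψ : MemLp ψ 2 γ) (hhm : Measurable h) {C : ℝ} (hC : ∀ x, |h x| ≤ C)
    (horth : ∀ g : Ω → ℝ, Measurable g → (∃ C, ∀ x, |g x| ≤ C) →
      ∫ x, (ψ x + h x) * g (T x) ∂γ = ∫ x, h x * g x ∂γ) :
    Tendsto (fun n : ℕ => 1 / (n : ℝ) * ∫ x, (∑ k ∈ Finset.range n, ψ (T^[k] x)) ^ 2 ∂γ) atTop
      (𝓝 (∫ x, (ψ x + h x - h (T x)) ^ 2 ∂γ)) ∧
    ∫ x, (ψ x + h x - h (T x)) ^ 2 ∂γ = ∫ x, ψ x ^ 2 ∂γ + 2 * ∫ x, ψ x * h x ∂γ := by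
  have hh : MemLp h 2 γ := MemLp.of_bound hhm.aestronglyMeasurable C (Eventually.of_forall hC)
  have hhT : MemLp (fun x => h (T x)) 2 γ := hh.comp_measurePreserving hT
  set m : Ω → ℝ := fun x => ψ x + h x - h (T x) with hm_def
  have hmm : Measurable m := (hψm.add hhm).sub (hhm.comp hT.measurable)
  have hm : MemLp m 2 γ := (hψ.add hh).sub hhT
  have hcomp : ∀ f : Ω → ℝ, Measurable f → ∫ x, f (T x) ∂γ = ∫ x, f x ∂γ := fun f hf => by
    have h := integral_map hT.measurable.aemeasurable (f := f) hf.aestronglyMeasurable (μ := γ)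
    rw [hT.map_eq] at h
    exact h.symm
  have horth' : ∀ g : Ω → ℝ, Measurable g → (∃ C, ∀ x, |g x| ≤ C) →
      ∫ x, m x * g (T x) ∂γ = 0 := fun g hg hgb => by
    have hgL : MemLp (fun x => g (T x)) 2 γ :=
      MemLp.of_bound (hg.comp hT.measurable).aestronglyMeasurable hgb.choose
        (Eventually.of_forall fun x => hgb.choose_spec (T x))
    have h1 : ∀ x, m x * g (T x) = (ψ x + h x) * g (T x) - h (T x) * g (T x) := fun x => by
      rw [hm_def]; ring
    simp_rw [h1]
    have hi1 : Integrable (fun x => (ψ x + h x) * g (T x)) γ := (hψ.add hh).integrable_mul hgL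
    have hi2 : Integrable (fun x => h (T x) * g (T x)) γ := hhT.integrable_mul hgL
    rw [integral_sub hi1 hi2, horth g hg hgb, hcomp (fun x => h x * g x) (hhm.mul hg), sub_self]
  have hsq := integral_sq_sum_iterate hT hmm hm horth'
  set v := ∫ x, m x ^ 2 ∂γ with hv
  have hv0 : 0 ≤ v := integral_nonneg fun x => sq_nonneg _
  refine ⟨?_, ?_⟩
  · set M : ℕ → Ω → ℝ := fun n x => ∑ k ∈ Finset.range n, m (T^[k] x) with hM
    set S : ℕ → Ω → ℝ := fun n x => ∑ k ∈ Finset.range n, ψ (T^[k] x) with hS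
    -- The coboundary telescopes, so the two Birkhoff sums differ by a function bounded by `2C`.
    have hSM : ∀ n x, S n x = M n x + (h (T^[n] x) - h x) := fun n x => by
      have h1 : M n x = S n x + ∑ k ∈ Finset.range n, (h (T^[k] x) - h (T^[k + 1] x)) := by
        rw [hM, hS]
        simp only
        rw [← Finset.sum_add_distrib]
        refine Finset.sum_congr rfl fun k _ => ?_
        rw [hm_def, Function.iterate_succ_apply']
        ring
      rw [h1, Finset.sum_range_sub' (fun k => h (T^[k] x))]
      simp only [Function.iterate_zero, id]
      ring
    have hML : ∀ n, MemLp (M n) 2 γ := memLp_sum_iterate hT hm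
    have hSL : ∀ n, MemLp (S n) 2 γ := memLp_sum_iterate hT hψ
    have hbound : ∀ n : ℕ, 0 < n → |1 / (n : ℝ) * ∫ x, S n x ^ 2 ∂γ - v| ≤
        (v + 4 * C ^ 2) * (1 / √(n : ℝ)) + 4 * C ^ 2 * (1 / (n : ℝ)) := by
      intro n hn
      have hn' : (0 : ℝ) < n := by exact_mod_cast hn
      have hsn : 0 < √(n : ℝ) := Real.sqrt_pos.mpr hn'
      have hss : √(n : ℝ) * √(n : ℝ) = n := Real.mul_self_sqrt hn'.le
      have hpt : ∀ x, |S n x ^ 2 - M n x ^ 2| ≤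
          (1 / √(n : ℝ)) * M n x ^ 2 + (√(n : ℝ) + 1) * (4 * C ^ 2) := by
        intro x
        have hd : (h (T^[n] x) - h x) ^ 2 ≤ 4 * C ^ 2 := by
          have h1 := abs_le.mp (hC (T^[n] x))
          have h2 := abs_le.mp (hC x)
          have h3 : |h (T^[n] x) - h x| ≤ 2 * C := by
            rw [abs_le]
            constructor <;> linarith
          have h4 := pow_le_pow_left₀ (abs_nonneg _) h3 2
          rw [sq_abs] at h4
          linarith
        rw [hSM]
        set d := h (T^[n] x) - h x
        set a := M n x
        -- Young's inequality with weight `√n`: since `∫ M²` has order `n`, both terms contribute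
        -- `O(√n)` and disappear after division by `n`.
        have key : ∀ e : ℝ, 2 * a * e ≤ (1 / √(n : ℝ)) * a ^ 2 + √(n : ℝ) * e ^ 2 := fun e => by
          have h1 : 0 ≤ (1 / √(n : ℝ)) * (a - √(n : ℝ) * e) ^ 2 := by positivity
          have h2 : (1 / √(n : ℝ)) * (a - √(n : ℝ) * e) ^ 2 =
              (1 / √(n : ℝ)) * a ^ 2 - 2 * a * e + √(n : ℝ) * e ^ 2 := by
            field_simp
            ring
          linarith
        have k1 := key d
        have k2 := key (-d)
        have k3 := mul_le_mul_of_nonneg_left hd hsn.le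
        rw [neg_sq] at k2
        rw [abs_le]
        constructor <;> nlinarith [sq_nonneg d]
      have hI : |∫ x, S n x ^ 2 ∂γ - n * v| ≤ √(n : ℝ) * v + (√(n : ℝ) + 1) * (4 * C ^ 2) := by
        rw [← hsq n, ← integral_sub (hSL n).integrable_sq (hML n).integrable_sq]
        refine abs_integral_le_integral_abs.trans ?_
        have hiM : Integrable (fun x => (1 / √(n : ℝ)) * M n x ^ 2) γ :=
          (hML n).integrable_sq.const_mul _
        refine (integral_mono
          (((hSL n).integrable_sq.sub (hML n).integrable_sq).abs)
          (hiM.add (integrable_const _)) hpt).trans (le_of_eq ?_)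
        simp only [Pi.add_apply]
        rw [integral_add hiM (integrable_const _), integral_const_mul, integral_const, hsq n]
        simp only [probReal_univ, smul_eq_mul, one_mul]
        rw [← mul_assoc]
        congr 2
        field_simp
        rw [sq, hss]
      have h1 : 1 / (n : ℝ) * ∫ x, S n x ^ 2 ∂γ - v =
          1 / (n : ℝ) * (∫ x, S n x ^ 2 ∂γ - n * v) := by
        field_simp
      rw [h1, abs_mul, abs_of_pos (by positivity)]
      refine (mul_le_mul_of_nonneg_left hI (by positivity)).trans (le_of_eq ?_)
      have h2 : 1 / √(n : ℝ) = √(n : ℝ) / n := by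
        rw [div_eq_div_iff hsn.ne' hn'.ne', hss, one_mul]
      rw [h2]
      field_simp
      ring
    rw [tendsto_iff_norm_sub_tendsto_zero]
    have hlim : Tendsto (fun n : ℕ => (v + 4 * C ^ 2) * (1 / √(n : ℝ)) +
        4 * C ^ 2 * (1 / (n : ℝ))) atTop (𝓝 0) := by
      have h1 : Tendsto (fun n : ℕ => 1 / √(n : ℝ)) atTop (𝓝 0) :=
        tendsto_const_nhds.div_atTop
          (Real.tendsto_sqrt_atTop.comp tendsto_natCast_atTop_atTop)
      have h2 : Tendsto (fun n : ℕ => 1 / (n : ℝ)) atTop (𝓝 0) := tendsto_one_div_atTop_nhds_zero_nat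
      simpa using (h1.const_mul (v + 4 * C ^ 2)).add (h2.const_mul (4 * C ^ 2))
    refine squeeze_zero' (Eventually.of_forall fun n => norm_nonneg _) ?_ hlim
    filter_upwards [eventually_gt_atTop 0] with n hn
    exact hbound n hn
  -- Expand `m² = (ψ + h)² - (ψ + h) h ∘ T - m h ∘ T`. The last term integrates to zero by
  -- orthogonality, and the middle one cancels `∫ h²`.
  · have h1 : ∀ x, m x ^ 2 = ψ x ^ 2 + 2 * (ψ x * h x) + (h x * h x) -
        (ψ x + h x) * h (T x) - m x * h (T x) := fun x => by
      rw [hm_def]; ring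
    have i1 : Integrable (fun x => ψ x ^ 2) γ := hψ.integrable_sq
    have i2 : Integrable (fun x => 2 * (ψ x * h x)) γ := (hψ.integrable_mul hh).const_mul 2
    have i3 : Integrable (fun x => h x * h x) γ := hh.integrable_mul hh
    have i4 : Integrable (fun x => (ψ x + h x) * h (T x)) γ := (hψ.add hh).integrable_mul hhT
    have i5 : Integrable (fun x => m x * h (T x)) γ := hm.integrable_mul hhT
    have i12 : Integrable (fun x => ψ x ^ 2 + 2 * (ψ x * h x)) γ := i1.add i2
    have i13 : Integrable (fun x => ψ x ^ 2 + 2 * (ψ x * h x) + h x * h x) γ := i12.add i3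
    have i14 : Integrable (fun x => ψ x ^ 2 + 2 * (ψ x * h x) + h x * h x -
      (ψ x + h x) * h (T x)) γ := i13.sub i4
    rw [hv]
    simp_rw [h1]
    rw [integral_sub i14 i5, integral_sub i13 i4, integral_add i12 i3, integral_add i1 i2,
      horth' h hhm ⟨C, hC⟩, horth h hhm ⟨C, hC⟩, integral_const_mul]
    ring

/-- Testing the relation for `k` with `g = k` gives `∫ (k ∘ T - k)² = 0`, so `k` is invariant.
Testing the relation for `h` with `g = k` then leaves `∫ ψ k = 0`. It is applied with `k` the
imaginary part of the quotient `w`. -/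
theorem integral_mul_eq_zero_of_invariant (hT : MeasurePreserving T γ γ) {ψ h k : Ω → ℝ}
    (hψ : MemLp ψ 2 γ) (hhm : Measurable h) {C : ℝ} (hC : ∀ x, |h x| ≤ C)
    (horth : ∀ g : Ω → ℝ, Measurable g → (∃ C, ∀ x, |g x| ≤ C) →
      ∫ x, (ψ x + h x) * g (T x) ∂γ = ∫ x, h x * g x ∂γ)
    (hkm : Measurable k) {D : ℝ} (hD : ∀ x, |k x| ≤ D)
    (hk : ∀ g : Ω → ℝ, Measurable g → (∃ C, ∀ x, |g x| ≤ C) →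
      ∫ x, k x * g (T x) ∂γ = ∫ x, k x * g x ∂γ) :
    ∫ x, ψ x * k x ∂γ = 0 := by
  have hh : MemLp h 2 γ := MemLp.of_bound hhm.aestronglyMeasurable C (Eventually.of_forall hC)
  have hkL : MemLp k 2 γ := MemLp.of_bound hkm.aestronglyMeasurable D (Eventually.of_forall hD)
  have hkT : MemLp (fun x => k (T x)) 2 γ := hkL.comp_measurePreserving hT
  have hkk : ∫ x, k (T x) ^ 2 ∂γ = ∫ x, k x ^ 2 ∂γ := by
    have h := integral_map hT.measurable.aemeasurable (f := fun x => k x ^ 2)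
      (hkm.pow_const 2).aestronglyMeasurable (μ := γ)
    rw [hT.map_eq] at h
    exact h.symm
  have hzero : ∫ x, (k (T x) - k x) ^ 2 ∂γ = 0 := by
    have h1 : ∀ x, (k (T x) - k x) ^ 2 = k (T x) ^ 2 - 2 * (k x * k (T x)) + k x ^ 2 :=
      fun x => by ring
    have i1 : Integrable (fun x => k (T x) ^ 2) γ := hkT.integrable_sq
    have i2 : Integrable (fun x => 2 * (k x * k (T x))) γ := (hkL.integrable_mul hkT).const_mul 2
    have i12 : Integrable (fun x => k (T x) ^ 2 - 2 * (k x * k (T x))) γ := i1.sub i2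
    simp_rw [h1]
    rw [integral_add i12 hkL.integrable_sq, integral_sub i1 i2, integral_const_mul,
      hk k hkm ⟨D, hD⟩, hkk]
    simp_rw [← sq]
    ring
  have hae : ∀ᵐ x ∂γ, k (T x) = k x := by
    have hi : Integrable (fun x => (k (T x) - k x) ^ 2) γ := (hkT.sub hkL).integrable_sq
    rw [integral_eq_zero_iff_of_nonneg (fun x => sq_nonneg _) hi] at hzero
    filter_upwards [hzero] with x hx
    exact sub_eq_zero.mp (pow_eq_zero_iff two_ne_zero |>.mp hx)
  have h2 := horth k hkm ⟨D, hD⟩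
  have h3 : ∫ x, (ψ x + h x) * k (T x) ∂γ = ∫ x, ψ x * k x + h x * k x ∂γ := by
    refine integral_congr_ae ?_
    filter_upwards [hae] with x hx
    rw [hx]
    ring
  have i1 : Integrable (fun x => ψ x * k x) γ := hψ.integrable_mul hkL
  have i2 : Integrable (fun x => h x * k x) γ := hh.integrable_mul hkL
  rw [h3, integral_add i1 i2] at h2
  linarith

end Martingale

end

/-! ### Comparison of Taylor coefficients and exponential moments. -/

noncomputable section

/-- Cauchy's estimate on a circle of radius `R` gives `n! K R^(m - n)`; let `R` tend to 0. -/
theorem iteratedDeriv_eq_zero_of_norm_le_pow {H : ℂ → ℂ} (hH : AnalyticAt ℂ H 0) {K : ℝ} {m n : ℕ}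
    (hK : ∀ᶠ t in 𝓝 (0 : ℂ), ‖H t‖ ≤ K * ‖t‖ ^ m) (hn : n < m) : iteratedDeriv n H 0 = 0 := by
  obtain ⟨ε, hε, hball⟩ := Metric.eventually_nhds_iff_ball.mp (hK.and hH.eventually_analyticAt)
  have hlim : Tendsto (fun R : ℝ => n.factorial * K * R ^ (m - n)) (𝓝[>] 0) (𝓝 0) := by
    have h1 : Continuous fun R : ℝ => n.factorial * K * R ^ (m - n) := by fun_prop
    have h2 := h1.tendsto 0
    rw [zero_pow (by omega), mul_zero] at h2
    exact h2.mono_left nhdsWithin_le_nhds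
  rw [← norm_le_zero_iff]
  refine ge_of_tendsto hlim ?_
  filter_upwards [Ioo_mem_nhdsGT hε] with R hR
  have hd : DifferentiableOn ℂ H (Metric.ball 0 ε) := fun z hz =>
    (hball z hz).2.differentiableAt.differentiableWithinAt
  have h1 := Complex.norm_iteratedDeriv_le_of_forall_mem_sphere_norm_le (c := 0) (R := R)
    (C := K * R ^ m) (f := H) n hR.1
    (DifferentiableOn.diffContOnCl (hd.mono ((Metric.closure_ball_subset_closedBall).trans
      (Metric.closedBall_subset_ball hR.2)))) fun z hz => by
        have hz' : ‖z‖ = R := by simpa using hz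
        have := (hball z (by rw [Metric.mem_ball, dist_zero_right, hz']; exact hR.2)).1
        rwa [hz'] at this
  refine h1.trans (le_of_eq ?_)
  have hR0 : R ≠ 0 := hR.1.ne'
  obtain ⟨k, rfl⟩ : ∃ k, m = n + k := ⟨m - n, by omega⟩
  rw [Nat.add_sub_cancel_left, pow_add]
  field_simp

section Expansion

variable {X : Type*} [NormedAddCommGroup X] [NormedSpace ℂ X] {lam : ℂ → ℂ} {v : ℂ → X}

/-- First order comparison of coefficients in `λ(t) ℓ(v(t)) = Λ₀(v(t)) + t Λ₁(v(t)) + O(t²)`. -/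
theorem first_order_of_expansion (hlam : AnalyticAt ℂ lam 0) (hv : AnalyticAt ℂ v 0)
    {l Λ₀ Λ₁ Λ₂ : X →L[ℂ] ℂ} {K : ℝ}
    (h : ∀ᶠ t in 𝓝 (0 : ℂ),
      ‖lam t * l (v t) - (Λ₀ (v t) + t * Λ₁ (v t) + t ^ 2 / 2 * Λ₂ (v t))‖ ≤ K * ‖t‖ ^ 3) :
    deriv lam 0 * l (v 0) + lam 0 * l (deriv v 0) = Λ₀ (deriv v 0) + Λ₁ (v 0) := by
  have hL : ∀ L : X →L[ℂ] ℂ, AnalyticAt ℂ (fun t => L (v t)) 0 := fun L =>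
    (L.analyticAt _).comp hv
  have hd : ∀ L : X →L[ℂ] ℂ, HasDerivAt (fun t => L (v t)) (L (deriv v 0)) 0 := fun L =>
    L.hasFDerivAt.comp_hasDerivAt 0 hv.differentiableAt.hasDerivAt
  have hA : AnalyticAt ℂ (fun t =>
      lam t * l (v t) - (Λ₀ (v t) + t * Λ₁ (v t) + t ^ 2 / 2 * Λ₂ (v t))) 0 := by
    exact (hlam.mul (hL l)).sub (((hL Λ₀).add (analyticAt_id.mul (hL Λ₁))).add
      (((analyticAt_id.pow 2).div_const).mul (hL Λ₂)))
  have h1 := iteratedDeriv_eq_zero_of_norm_le_pow hA h (n := 1) (by norm_num)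
  rw [iteratedDeriv_one] at h1
  have h2 := (hlam.differentiableAt.hasDerivAt.mul (hd l)).sub
    (((hd Λ₀).add ((hasDerivAt_id (0 : ℂ)).mul (hd Λ₁))).add
      ((((hasDerivAt_id (0 : ℂ)).pow 2).div_const 2).mul (hd Λ₂)))
  have h3 := h2.deriv
  have h4 : deriv lam 0 * l (v 0) + lam 0 * l (deriv v 0) -
      (Λ₀ (deriv v 0) + Λ₁ (v 0)) = 0 := by
    refine Eq.trans ?_ (h3.symm.trans h1)
    simp
  exact sub_eq_zero.mp h4

/-- Second order comparison of coefficients in `λ(t) = 1 + t Λ₁(v(t)) + t² / 2 Λ₂(v(t)) + O(t³)`. -/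
theorem second_order_of_expansion (hlam : AnalyticAt ℂ lam 0) (hv : AnalyticAt ℂ v 0)
    {Λ₁ Λ₂ : X →L[ℂ] ℂ} {K : ℝ}
    (h : ∀ᶠ t in 𝓝 (0 : ℂ),
      ‖lam t - (1 + t * Λ₁ (v t) + t ^ 2 / 2 * Λ₂ (v t))‖ ≤ K * ‖t‖ ^ 3) :
    iteratedDeriv 2 lam 0 = Λ₂ (v 0) + 2 * Λ₁ (deriv v 0) := by
  have hL : ∀ L : X →L[ℂ] ℂ, AnalyticAt ℂ (fun t => L (v t)) 0 := fun L =>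
    (L.analyticAt _).comp hv
  have hd : ∀ L : X →L[ℂ] ℂ, HasDerivAt (fun t => L (v t)) (L (deriv v 0)) 0 := fun L =>
    L.hasFDerivAt.comp_hasDerivAt 0 hv.differentiableAt.hasDerivAt
  -- Factoring out `t` makes the second derivative at 0 equal to `2 G'(0)`, so only the first
  -- derivative of `v` is needed.
  set G : ℂ → ℂ := fun t => Λ₁ (v t) + t / 2 * Λ₂ (v t) with hG
  have hGa : AnalyticAt ℂ G 0 := by
    exact (hL Λ₁).add ((analyticAt_id.div_const).mul (hL Λ₂))
  have hGd : deriv G 0 = Λ₁ (deriv v 0) + 1 / 2 * Λ₂ (v 0) := by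
    have h2 := (hd Λ₁).add (((hasDerivAt_id (0 : ℂ)).div_const 2).mul (hd Λ₂))
    refine h2.deriv.trans ?_
    simp
  have hA : AnalyticAt ℂ (fun t => lam t - (1 + t * G t)) 0 :=
    hlam.sub (analyticAt_const.add (analyticAt_id.mul hGa))
  have h1 := iteratedDeriv_eq_zero_of_norm_le_pow hA (K := K) (m := 3) (n := 2)
    (h.mono fun t ht => by
      refine le_trans (le_of_eq ?_) ht
      congr 1
      simp only [hG]
      ring) (by norm_num)
  have hev : deriv (fun t => lam t - (1 + t * G t)) =ᶠ[𝓝 0]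
      fun t => deriv lam t - (G t + t * deriv G t) := by
    filter_upwards [hlam.eventually_analyticAt, hGa.eventually_analyticAt] with t ht1 ht2
    have h2 := ht1.differentiableAt.hasDerivAt.sub
      (((hasDerivAt_id t).mul ht2.differentiableAt.hasDerivAt).const_add 1)
    refine h2.deriv.trans ?_
    simp
  rw [iteratedDeriv_succ, iteratedDeriv_one, hev.deriv_eq] at h1
  have h2 := hlam.deriv.differentiableAt.hasDerivAt.sub
    (hGa.differentiableAt.hasDerivAt.add
      ((hasDerivAt_id (0 : ℂ)).mul hGa.deriv.differentiableAt.hasDerivAt))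
  have h3 := h2.deriv
  have h4 : deriv (deriv lam) 0 - (deriv G 0 + deriv G 0) = 0 := by
    refine Eq.trans ?_ (h3.symm.trans h1)
    simp
  rw [iteratedDeriv_succ, iteratedDeriv_one, sub_eq_zero.mp h4, hGd]
  ring

end Expansion

namespace GaussEuclid

theorem integrable_evalAt_mul_of_integrable {w : ℝ → ℂ}
    (hw : Integrable w (volume.restrict (Set.Ioc 0 1))) (f : Hinf) :
    Integrable (fun x : ℝ => evalAt x f * w x) (volume.restrict (Set.Ioc 0 1)) :=
  hw.bdd_mul (aestronglyMeasurable_evalAt f) (Eventually.of_forall fun x => norm_evalAt_le x f)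

theorem exists_integral_functional {w : ℝ → ℂ}
    (hw : Integrable w (volume.restrict (Set.Ioc 0 1))) :
    ∃ Λ : Hinf →L[ℂ] ℂ, ∀ f, Λ f = ∫ x in Set.Ioc (0 : ℝ) 1, evalAt x f * w x := by
  refine ⟨LinearMap.mkContinuous
    { toFun := fun f => ∫ x in Set.Ioc (0 : ℝ) 1, evalAt x f * w x
      map_add' := fun f₁ f₂ => by
        simp only [map_add, add_mul]
        exact integral_add (integrable_evalAt_mul_of_integrable hw f₁)
          (integrable_evalAt_mul_of_integrable hw f₂)
      map_smul' := fun a f => by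
        simp only [map_smul, smul_eq_mul, mul_assoc, RingHom.id_apply]
        exact integral_const_mul a _ } (∫ x in Set.Ioc (0 : ℝ) 1, ‖w x‖) fun f => ?_, fun f => rfl⟩
  refine (norm_integral_le_of_norm_le (hw.norm.const_mul ‖f‖)
    (Eventually.of_forall fun x => ?_)).trans (le_of_eq ?_)
  · rw [norm_mul]
    exact mul_le_mul_of_nonneg_right (norm_evalAt_le _ _) (norm_nonneg _)
  · rw [integral_const_mul, mul_comm]

section ExpMoment

variable {φ : ℝ → ℝ} {δ : ℝ}

theorem abs_pow_le_exp (hδ : 0 < δ) (n : ℕ) (x : ℝ) :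
    |x| ^ n ≤ n.factorial / δ ^ n * Real.exp (δ * |x|) := by
  have h := Real.pow_div_factorial_le_exp (δ * |x|) (by positivity) n
  rw [div_le_iff₀ (by positivity), mul_pow] at h
  rw [div_mul_eq_mul_div, le_div_iff₀ (by positivity)]
  linarith

/-- The moment is assumed with `2δ`: one half absorbs the power of `|φ|`, the other pays for `exp (δ
|φ|)`. -/
theorem integrable_pow_mul_exp {ρ : Measure ℝ} (hδ : 0 < δ) (hφ : Measurable φ)
    (hint : Integrable (fun x => Real.exp (2 * δ * |φ x|)) ρ) (n : ℕ) :
    Integrable (fun x => |φ x| ^ n * Real.exp (δ * |φ x|)) ρ := by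
  refine (hint.const_mul (n.factorial / δ ^ n)).mono' (by fun_prop) (Eventually.of_forall fun x => ?_)
  rw [Real.norm_of_nonneg (by positivity)]
  refine (mul_le_mul_of_nonneg_right (abs_pow_le_exp hδ n (φ x)) (Real.exp_nonneg _)).trans
    (le_of_eq ?_)
  rw [mul_assoc, ← Real.exp_add]
  ring_nf

theorem integrable_pow_mul_of_exp {ρ : Measure ℝ} (hδ : 0 < δ) (hφ : Measurable φ)
    (hint : Integrable (fun x => Real.exp (2 * δ * |φ x|)) ρ) (n : ℕ) {g : ℝ → ℂ}
    (hg : Measurable g) {C : ℝ} (hC : ∀ x, ‖g x‖ ≤ C) :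
    Integrable (fun x => (φ x : ℂ) ^ n * g x) ρ := by
  have h0 : Integrable (fun x => (φ x : ℂ) ^ n) ρ := by
    refine (integrable_pow_mul_exp hδ hφ hint n).mono' (by fun_prop) (Eventually.of_forall fun x => ?_)
    rw [norm_pow, Complex.norm_real, Real.norm_eq_abs]
    exact le_mul_of_one_le_right (by positivity) (Real.one_le_exp (by positivity))
  exact h0.mul_bdd hg.aestronglyMeasurable (Eventually.of_forall hC)

theorem integrable_exp_mul {ρ : Measure ℝ} (hδ : 0 < δ) (hφ : Measurable φ)
    (hint : Integrable (fun x => Real.exp (2 * δ * |φ x|)) ρ) {t : ℂ} (ht : ‖t‖ ≤ δ) {g : ℝ → ℂ}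
    (hg : Measurable g) {C : ℝ} (hC : ∀ x, ‖g x‖ ≤ C) :
    Integrable (fun x => Complex.exp (t * φ x) * g x) ρ := by
  have h0 : Integrable (fun x => Complex.exp (t * φ x)) ρ := by
    refine hint.mono' (by fun_prop) (Eventually.of_forall fun x => ?_)
    rw [Complex.norm_exp]
    refine Real.exp_le_exp.mpr ((Complex.re_le_norm _).trans ?_)
    rw [norm_mul, Complex.norm_real, Real.norm_eq_abs]
    exact mul_le_mul_of_nonneg_right (by linarith) (abs_nonneg _)
  exact h0.mul_bdd hg.aestronglyMeasurable (Eventually.of_forall hC)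

theorem norm_exp_sub_two_le (w : ℂ) :
    ‖Complex.exp w - (1 + w + w ^ 2 / 2)‖ ≤ ‖w‖ ^ 3 * Real.exp ‖w‖ := by
  have h := Complex.norm_exp_sub_sum_le_norm_mul_exp w 3
  simpa [Finset.sum_range_succ, Nat.factorial] using h

/-- The cubic Taylor remainder of `exp` is dominated by `|φ|³ exp (δ |φ|)`. The constant does not
depend on `f`, so `f` may itself vary with `t`. -/
theorem exists_norm_integral_exp_sub_le (hδ : 0 < δ) (hφ : Measurable φ)
    (hint : Integrable (fun x => Real.exp (2 * δ * |φ x|)) (volume.restrict (Set.Ioc 0 1)))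
    {g : ℝ → ℂ} (hg : Measurable g) {C : ℝ} (hC : ∀ x, ‖g x‖ ≤ C) :
    ∃ K : ℝ, 0 ≤ K ∧ ∀ t : ℂ, ‖t‖ ≤ δ → ∀ f : Hinf,
      ‖(∫ x in Set.Ioc (0 : ℝ) 1, evalAt x f * (Complex.exp (t * φ x) * g x)) -
        ((∫ x in Set.Ioc (0 : ℝ) 1, evalAt x f * ((φ x : ℂ) ^ 0 * g x)) +
          t * (∫ x in Set.Ioc (0 : ℝ) 1, evalAt x f * ((φ x : ℂ) ^ 1 * g x)) +
          t ^ 2 / 2 * ∫ x in Set.Ioc (0 : ℝ) 1, evalAt x f * ((φ x : ℂ) ^ 2 * g x))‖ ≤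
        K * ‖f‖ * ‖t‖ ^ 3 := by
  have hC0 : 0 ≤ C := (norm_nonneg _).trans (hC 0)
  refine ⟨(∫ x in Set.Ioc (0 : ℝ) 1, |φ x| ^ 3 * Real.exp (δ * |φ x|)) * C, by positivity,
    fun t ht f => ?_⟩
  have hi : ∀ n : ℕ, Integrable (fun x : ℝ => evalAt x f * ((φ x : ℂ) ^ n * g x))
      (volume.restrict (Set.Ioc 0 1)) := fun n =>
    integrable_evalAt_mul_of_integrable (integrable_pow_mul_of_exp hδ hφ hint n hg hC) f
  have he : Integrable (fun x : ℝ => evalAt x f * (Complex.exp (t * φ x) * g x))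
      (volume.restrict (Set.Ioc 0 1)) :=
    integrable_evalAt_mul_of_integrable (integrable_exp_mul hδ hφ hint ht hg hC) f
  have h01 : Integrable (fun x : ℝ => evalAt x f * ((φ x : ℂ) ^ 0 * g x) +
      t * (evalAt x f * ((φ x : ℂ) ^ 1 * g x))) (volume.restrict (Set.Ioc 0 1)) :=
    (hi 0).add ((hi 1).const_mul t)
  have h012 : Integrable (fun x : ℝ => evalAt x f * ((φ x : ℂ) ^ 0 * g x) +
      t * (evalAt x f * ((φ x : ℂ) ^ 1 * g x)) + t ^ 2 / 2 * (evalAt x f * ((φ x : ℂ) ^ 2 * g x)))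
      (volume.restrict (Set.Ioc 0 1)) := h01.add ((hi 2).const_mul (t ^ 2 / 2))
  rw [← integral_const_mul t, ← integral_const_mul (t ^ 2 / 2), ← integral_add (hi 0)
    ((hi 1).const_mul t), ← integral_add h01 ((hi 2).const_mul (t ^ 2 / 2)),
    ← integral_sub he h012]
  refine (norm_integral_le_of_norm_le ((integrable_pow_mul_exp hδ hφ hint 3).mul_const
    (C * ‖f‖ * ‖t‖ ^ 3)) (Eventually.of_forall fun x => ?_)).trans (le_of_eq ?_)
  · have h1 : evalAt x f * (Complex.exp (t * φ x) * g x) -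
        (evalAt x f * ((φ x : ℂ) ^ 0 * g x) + t * (evalAt x f * ((φ x : ℂ) ^ 1 * g x)) +
          t ^ 2 / 2 * (evalAt x f * ((φ x : ℂ) ^ 2 * g x))) =
        evalAt x f * (Complex.exp (t * φ x) - (1 + t * φ x + (t * φ x) ^ 2 / 2)) * g x := by ring
    rw [h1, norm_mul, norm_mul]
    have h2 : ‖Complex.exp (t * φ x) - (1 + t * φ x + (t * φ x) ^ 2 / 2)‖ ≤
        |φ x| ^ 3 * Real.exp (δ * |φ x|) * ‖t‖ ^ 3 := by
      refine (norm_exp_sub_two_le _).trans ?_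
      rw [norm_mul, Complex.norm_real, Real.norm_eq_abs, mul_pow]
      have h3 : Real.exp (‖t‖ * |φ x|) ≤ Real.exp (δ * |φ x|) :=
        Real.exp_le_exp.mpr (mul_le_mul_of_nonneg_right ht (abs_nonneg _))
      calc ‖t‖ ^ 3 * |φ x| ^ 3 * Real.exp (‖t‖ * |φ x|)
          ≤ ‖t‖ ^ 3 * |φ x| ^ 3 * Real.exp (δ * |φ x|) :=
            mul_le_mul_of_nonneg_left h3 (by positivity)
        _ = _ := by ring
    calc _ ≤ ‖f‖ * (|φ x| ^ 3 * Real.exp (δ * |φ x|) * ‖t‖ ^ 3) * C := by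
          gcongr
          · exact norm_evalAt_le _ _
          · exact hC x
      _ = _ := by ring
  · rw [integral_mul_const]
    ring

end ExpMoment

end GaussEuclid

end

/-! ### Derivatives of an arbitrary leading eigenvalue function. -/

noncomputable section

/-- If `P x = 0` then `N` fixes `x`, impossible when a power of `N` has norm below one. Applying `P`
to `L x = x` then gives `a = 1`. -/
theorem eigenvalue_eq_one_of_decomposition {X : Type*} [NormedAddCommGroup X] [NormedSpace ℂ X]
    [CompleteSpace X] {L P N : X →L[ℂ] X} {a : ℂ} {x : X} (hx : x ≠ 0) (hL : L x = x)
    (hdec : L = a • P + N) (hPN : P.comp N = 0) (hPP : P.comp P = P) (hN : spectralRadius ℂ N < 1) :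
    a = 1 ∧ P x ≠ 0 := by
  have hLx : x = a • P x + N x := by
    conv_lhs => rw [← hL, hdec]
    rfl
  have hP : P x ≠ 0 := by
    intro h0
    have hNx : N x = x := by
      rw [h0, smul_zero, zero_add] at hLx
      exact hLx.symm
    obtain ⟨n, hn⟩ := exists_norm_pow_lt_of_spectralRadius_lt_one hN one_pos
    have hpow : (N ^ n) x = x := by
      clear hn
      induction n with
      | zero => simp
      | succ n ih =>
        rw [pow_succ]
        change (N ^ n) (N x) = x
        rw [hNx, ih]
    have h1 := (N ^ n).le_opNorm x
    rw [hpow] at h1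
    have h2 : 0 < ‖x‖ := norm_pos_iff.mpr hx
    nlinarith
  refine ⟨?_, hP⟩
  have h1 : P x = a • P x := by
    conv_lhs => rw [hLx]
    rw [map_add, map_smul]
    have e1 : P (P x) = P x := congrArg (fun Q : X →L[ℂ] X => Q x) hPP
    have e2 : P (N x) = 0 := congrArg (fun Q : X →L[ℂ] X => Q x) hPN
    rw [e1, e2, add_zero]
  have h2 : (1 - a) • P x = 0 := by
    rw [sub_smul, one_smul, ← h1, sub_self]
  rcases smul_eq_zero.mp h2 with h | h
  · exact (sub_eq_zero.mp h).symm
  · exact absurd h hP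

/-- The normalised image of a fixed vector under an analytic family of operators. -/
theorem exists_analytic_normalized {E X : Type*} [NormedAddCommGroup E] [NormedSpace ℂ E]
    [NormedAddCommGroup X] [NormedSpace ℂ X] {P : E → X →L[ℂ] X}
    {q : ℂ → E} (hP : AnalyticAt ℂ P (q 0)) (hq : AnalyticAt ℂ q 0) {x : X} {l : X →L[ℂ] ℂ}
    (hx : P (q 0) x = x) (hl : l x = 1) :
    AnalyticAt ℂ (fun t => (l (P (q t) x))⁻¹ • P (q t) x) 0 ∧
      ∀ᶠ t in 𝓝 0, l (P (q t) x) ≠ 0 := by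
  have h1 : AnalyticAt ℂ (fun t => P (q t)) 0 := AnalyticAt.fun_comp hP hq
  have h2 : AnalyticAt ℂ (fun t => P (q t) x) 0 :=
    ((ContinuousLinearMap.apply ℂ X x).analyticAt _).fun_comp h1
  have h3 : AnalyticAt ℂ (fun t => l (P (q t) x)) 0 := (l.analyticAt _).fun_comp h2
  have h4 : l (P (q 0) x) ≠ 0 := by rw [hx, hl]; exact one_ne_zero
  exact ⟨(h3.inv h4).smul h2, h3.continuousAt.eventually_ne h4⟩

namespace GaussEuclid

theorem IsLeadingDecomposition.lam_one_zero {c : ℕ → ℝ} {V : Set (ℂ × ℂ)} {lam : ℂ × ℂ → ℂ}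
    {P N : ℂ × ℂ → (Hinf →L[ℂ] Hinf)} (hd : IsLeadingDecomposition c V lam P N) :
    lam (1, 0) = 1 ∧ P (1, 0) density = density := by
  have hc := (hd.admissible _ hd.mem).1
  have hL := transferOperator_density hc
  have h1 := (eigenvalue_eq_one_of_decomposition (X := Hinf) density_ne_zero hL
    (hd.decomp _ hd.mem) (hd.P_comp_N _ hd.mem) (hd.P_proj _ hd.mem)
    (hd.spectralRadius_lt _ hd.mem)).1
  refine ⟨h1, ?_⟩
  have h2 : density ∈ LinearMap.range (P (1, 0)).toLinearMap := by
    rw [hd.range_eq_eigenspace _ hd.mem, Module.End.mem_eigenspace_iff, h1, one_smul]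
    exact hL
  obtain ⟨y, hy⟩ := h2
  have hy' : P (1, 0) y = density := hy
  rw [← hy']
  exact congrArg (fun Q : Hinf →L[ℂ] Hinf => Q y) (hd.P_proj _ hd.mem)

theorem IsLeadingDecomposition.transferOperator_P {c : ℕ → ℝ} {V : Set (ℂ × ℂ)} {lam : ℂ × ℂ → ℂ}
    {P N : ℂ × ℂ → (Hinf →L[ℂ] Hinf)} (hd : IsLeadingDecomposition c V lam P N) {p : ℂ × ℂ}
    (hp : p ∈ V) (f : Hinf) : transferOperator c p.1 p.2 (P p f) = lam p • P p f := by
  have h2 : P p f ∈ LinearMap.range (P p).toLinearMap := ⟨f, rfl⟩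
  rw [hd.range_eq_eigenspace _ hp, Module.End.mem_eigenspace_iff] at h2
  exact h2

theorem weight_line (c : ℕ → ℝ) (a b : ℝ) (t : ℂ) (x : ℝ) :
    weight c (1 + a * t) (b * t) x =
      Complex.exp (t * ((2 * a * Real.log x + b * psi c x : ℝ) : ℂ)) := by
  rw [weight]
  congr 1
  push_cast
  ring

/-- The derivatives of the leading eigenvalue along the line `t ↦ (1 + a t, b t)`, in terms of the
logarithmic derivative `φ = 2 a log + b ψ` of the weight. -/
theorem IsLeadingDecomposition.exists_derivatives {c : ℕ → ℝ} {V : Set (ℂ × ℂ)} {lam : ℂ × ℂ → ℂ}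
    {P N : ℂ × ℂ → (Hinf →L[ℂ] Hinf)} (hd : IsLeadingDecomposition c V lam P N) (a b : ℝ)
    {φ : ℝ → ℝ} (hφ : φ = fun x => 2 * a * Real.log x + b * psi c x) {δ : ℝ} (hδ : 0 < δ)
    (hint : Integrable (fun x => Real.exp (2 * δ * |φ x|)) (volume.restrict (Set.Ioc 0 1))) :
    ∃ f₁ : Hinf, AnalyticAt ℂ (fun t : ℂ => lam (1 + a * t, b * t)) 0 ∧
      deriv (fun t : ℂ => lam (1 + a * t, b * t)) 0 =
        ∫ x in Set.Ioc (0 : ℝ) 1, evalAt x density * φ x ∧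
      iteratedDeriv 2 (fun t : ℂ => lam (1 + a * t, b * t)) 0 =
        (∫ x in Set.Ioc (0 : ℝ) 1, evalAt x density * (φ x : ℂ) ^ 2) +
          2 * ∫ x in Set.Ioc (0 : ℝ) 1, evalAt x f₁ * φ x ∧
      ∀ g : ℝ → ℂ, Measurable g → (∃ C, ∀ x, ‖g x‖ ≤ C) →
        deriv (fun t : ℂ => lam (1 + a * t, b * t)) 0 *
            (∫ x in Set.Ioc (0 : ℝ) 1, evalAt x density * g x) +
          (∫ x in Set.Ioc (0 : ℝ) 1, evalAt x f₁ * g x) =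
        (∫ x in Set.Ioc (0 : ℝ) 1, evalAt x f₁ * g (gaussMap x)) +
          ∫ x in Set.Ioc (0 : ℝ) 1, evalAt x density * (φ x * g (gaussMap x)) := by
  have hφm : Measurable φ := by
    rw [hφ]
    exact (Real.measurable_log.const_mul _).add ((measurable_psi c).const_mul _)
  obtain ⟨hlam1, hPd⟩ := hd.lam_one_zero
  set q : ℂ → ℂ × ℂ := fun t => (1 + a * t, b * t) with hq
  have hq0 : q 0 = (1, 0) := by simp [hq]
  have hqa : AnalyticAt ℂ q 0 := by
    rw [hq]
    exact (analyticAt_const.add (analyticAt_const.mul analyticAt_id)).prod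
      (analyticAt_const.mul analyticAt_id)
  have hlamA : AnalyticAt ℂ lam (q 0) := by rw [hq0]; exact hd.lam_analytic _ hd.mem
  have hla : AnalyticAt ℂ (fun t => lam (q t)) 0 := AnalyticAt.fun_comp hlamA hqa
  obtain ⟨hva, hne⟩ := exists_analytic_normalized (X := Hinf) (P := P) (q := q) (x := density)
    (l := meanCLM) (by rw [hq0]; exact hd.P_analytic _ hd.mem) hqa (by rw [hq0]; exact hPd)
    meanCLM_density
  -- Normalising the integral of `v(t)` to 1 removes the unknown `v''(0)` from the second-order
  -- formula.
  set v : ℂ → Hinf := fun t => (meanCLM (P (q t) density))⁻¹ • P (q t) density with hv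
  have hv0 : v 0 = density := by
    rw [hv]
    simp only [hq0]
    rw [hPd, meanCLM_density, inv_one, one_smul]
  have hqV : ∀ᶠ t in 𝓝 0, q t ∈ V := hqa.continuousAt.eventually_mem
    (by rw [hq0]; exact hd.isOpen.mem_nhds hd.mem)
  have hδev : ∀ᶠ t : ℂ in 𝓝 0, ‖t‖ ≤ δ := by
    filter_upwards [Metric.closedBall_mem_nhds (0 : ℂ) hδ] with t ht
    simpa using ht
  have hmean : ∀ᶠ t in 𝓝 0, meanCLM (v t) = 1 := by
    filter_upwards [hne] with t ht
    rw [hv]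
    simp only [map_smul, smul_eq_mul]
    exact inv_mul_cancel₀ ht
  have hbd : ∀ᶠ t in 𝓝 0, ‖v t‖ ≤ ‖density‖ + 1 := by
    have h1 := hva.continuousAt.norm.eventually_lt_const
      (show ‖v 0‖ < ‖density‖ + 1 by rw [hv0]; linarith)
    exact h1.mono fun t ht => ht.le
  -- The eigenvalue equation in weak form. Along the line the weight is exactly `exp (t φ)`, so all
  -- the dependence on the parameters is in one exponential.
  have hdual : ∀ g : ℝ → ℂ, Measurable g → (∃ C, ∀ x, ‖g x‖ ≤ C) → ∀ᶠ t in 𝓝 0,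
      lam (q t) * (∫ x in Set.Ioc (0 : ℝ) 1, evalAt x (v t) * g x) =
        ∫ x in Set.Ioc (0 : ℝ) 1, evalAt x (v t) * (Complex.exp (t * φ x) * g (gaussMap x)) := by
    intro g hg ⟨C, hC⟩
    filter_upwards [hqV, hδev] with t htV htδ
    have h1 : transferOperator c (q t).1 (q t).2 (v t) = lam (q t) • v t := by
      rw [hv]
      simp only [map_smul]
      rw [hd.transferOperator_P htV, smul_comm]
    have h2 : ∀ y : ℝ, weight c (q t).1 (q t).2 y * evalAt y (v t) * g (gaussMap y) =
        evalAt y (v t) * (Complex.exp (t * φ y) * g (gaussMap y)) := fun y => by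
      rw [hq, hφ]
      simp only
      rw [weight_line]
      ring
    have h3 := integral_transferOperator_mul (hd.admissible _ htV) (v t) g (by
      simp_rw [h2]
      exact integrable_evalAt_mul_of_integrable (integrable_exp_mul hδ hφm hint htδ
        (g := fun y => g (gaussMap y)) (hg.comp measurable_gaussMap) fun x => hC _) (v t))
    simp_rw [h2, h1, map_smul, smul_eq_mul, mul_assoc] at h3
    rw [integral_const_mul] at h3
    exact h3
  have hexp : ∀ g : ℝ → ℂ, Measurable g → (∃ C, ∀ x, ‖g x‖ ≤ C) →
      ∃ Λ : ℕ → (Hinf →L[ℂ] ℂ), (∀ n f, Λ n f =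
        ∫ x in Set.Ioc (0 : ℝ) 1, evalAt x f * ((φ x : ℂ) ^ n * g (gaussMap x))) ∧
      ∃ K : ℝ, ∀ᶠ t in 𝓝 0, ‖lam (q t) * (∫ x in Set.Ioc (0 : ℝ) 1, evalAt x (v t) * g x) -
        (Λ 0 (v t) + t * Λ 1 (v t) + t ^ 2 / 2 * Λ 2 (v t))‖ ≤ K * ‖t‖ ^ 3 := by
    intro g hg ⟨C, hC⟩
    have hgT : Measurable fun x => g (gaussMap x) := hg.comp measurable_gaussMap
    choose Λ hΛ using fun n : ℕ => exists_integral_functional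
      (integrable_pow_mul_of_exp hδ hφm hint n hgT fun x => hC _)
    obtain ⟨K, hK0, hK⟩ := exists_norm_integral_exp_sub_le hδ hφm hint hgT fun x => hC _
    -- The factor `‖density‖ + 1` bounds `‖v t‖` near 0.
    refine ⟨Λ, hΛ, K * (‖density‖ + 1), ?_⟩
    filter_upwards [hdual g hg ⟨C, hC⟩, hδev, hbd] with t h1 h2 h3
    rw [h1, hΛ, hΛ, hΛ]
    refine (hK t h2 (v t)).trans ?_
    gcongr
  have hone : ∀ g : ℝ → ℂ, Measurable g → (∃ C, ∀ x, ‖g x‖ ≤ C) →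
      deriv (fun t : ℂ => lam (q t)) 0 * (∫ x in Set.Ioc (0 : ℝ) 1, evalAt x density * g x) +
          (∫ x in Set.Ioc (0 : ℝ) 1, evalAt x (deriv v 0) * g x) =
        (∫ x in Set.Ioc (0 : ℝ) 1, evalAt x (deriv v 0) * g (gaussMap x)) +
          ∫ x in Set.Ioc (0 : ℝ) 1, evalAt x density * (φ x * g (gaussMap x)) := by
    intro g hg hgb
    obtain ⟨Λ, hΛ, K, hK⟩ := hexp g hg hgb
    have h := first_order_of_expansion (X := Hinf) hla hva (l := integralCLM g hg hgb) (Λ₀ := Λ 0)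
      (Λ₁ := Λ 1) (Λ₂ := Λ 2) (K := K) hK
    rw [hΛ, hΛ, hv0, hq0, hlam1, one_mul] at h
    simpa only [integralCLM_apply, pow_zero, one_mul, pow_one] using h
  have hmean1 : meanCLM (deriv v 0) = 0 := by
    have h1 : HasDerivAt (fun t => meanCLM (v t)) (meanCLM (deriv v 0)) 0 :=
      meanCLM.hasFDerivAt.comp_hasDerivAt 0 hva.differentiableAt.hasDerivAt
    exact h1.unique ((hasDerivAt_const (0 : ℂ) (1 : ℂ)).congr_of_eventuallyEq hmean)
  have hg1 : ∃ C : ℝ, ∀ _ : ℝ, ‖(1 : ℂ)‖ ≤ C := ⟨1, by simp⟩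
  have hfirst : deriv (fun t : ℂ => lam (q t)) 0 =
      ∫ x in Set.Ioc (0 : ℝ) 1, evalAt x density * φ x := by
    -- With `g = 1` the unknown `v'(0)` drops out, its integral being zero by the normalisation.
    have h := hone (fun _ => 1) measurable_const hg1
    simp only [mul_one] at h
    rw [← meanCLM_apply, ← meanCLM_apply, hmean1, meanCLM_density] at h
    simpa using h
  refine ⟨deriv v 0, hla, hfirst, ?_, hone⟩
  obtain ⟨Λ, hΛ, K, hK⟩ := hexp (fun _ => 1) measurable_const hg1
  have hsec := second_order_of_expansion (X := Hinf) hla hva (Λ₁ := Λ 1) (Λ₂ := Λ 2) (K := K) (by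
    filter_upwards [hK, hmean] with t ht hmt
    have h0 : Λ 0 (v t) = 1 := by
      rw [hΛ]
      simp only [pow_zero, mul_one]
      rw [← meanCLM_apply, hmt]
    simp only [mul_one] at ht
    rwa [h0, ← meanCLM_apply, hmt, mul_one] at ht)
  rw [hΛ, hΛ, hv0] at hsec
  simpa only [pow_one, mul_one] using hsec

end GaussEuclid

end

/-! ### Moments of `ψ`, the Gauss measure, entropy and mean. -/

noncomputable section

namespace GaussEuclid

theorem measurable_xi : Measurable xi := by
  unfold xi
  fun_prop

theorem xi_pos {x : ℝ} (hx : x ∈ Set.Ioc (0 : ℝ) 1) : 0 < xi x := by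
  have hl := Real.log_pos one_lt_two
  have := hx.1
  unfold xi
  positivity

theorem xi_le {x : ℝ} (hx : x ∈ Set.Ioc (0 : ℝ) 1) : xi x ≤ 1 / Real.log 2 := by
  have hl := Real.log_pos one_lt_two
  unfold xi
  refine one_div_le_one_div_of_le hl ?_
  nlinarith [hx.1]

theorem le_xi {x : ℝ} (hx : x ∈ Set.Ioc (0 : ℝ) 1) : 1 / (2 * Real.log 2) ≤ xi x := by
  have hl := Real.log_pos one_lt_two
  have := hx.1
  unfold xi
  refine one_div_le_one_div_of_le (by positivity) ?_
  nlinarith [hx.2]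

theorem exists_abs_psi_le {c : ℕ → ℝ} (hc : ∃ B : ℝ, ∀ n, 1 ≤ n → |c n| ≤ B) :
    ∃ K : ℝ, 0 ≤ K ∧ ∀ x ∈ Set.Ioc (0 : ℝ) 1, |psi c x| ≤ K * (1 - Real.log x) := by
  obtain ⟨B, hB⟩ := hc
  have hB0 : 0 ≤ B := (abs_nonneg _).trans (hB 1 le_rfl)
  refine ⟨B + |mean c|, by positivity, fun x hx => ?_⟩
  have hlog : Real.log x ≤ 0 := Real.log_nonpos hx.1.le hx.2
  have hfl : 1 ≤ ⌊1 / x⌋₊ := Nat.le_floor (by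
    rw [Nat.cast_one, one_le_div hx.1]
    exact hx.2)
  rw [psi_of_mem hx]
  refine (abs_add_le _ _).trans ?_
  rw [abs_mul, abs_of_nonpos hlog]
  have h1 := hB _ hfl
  nlinarith [abs_nonneg (mean c)]

theorem integrable_inv_sqrt :
    Integrable (fun x : ℝ => x ^ (-(1 / 2) : ℝ)) (volume.restrict (Set.Ioc 0 1)) := by
  have h := intervalIntegral.intervalIntegrable_rpow' (a := 0) (b := 1) (r := -(1 / 2))
    (by norm_num)
  rwa [intervalIntegrable_iff_integrableOn_Ioc_of_le zero_le_one] at h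

/-- A function with at most logarithmic growth has an exponential moment. -/
theorem exists_integrable_exp_of_log_bound {φ : ℝ → ℝ} (hφ : Measurable φ) {K : ℝ} (hK : 0 ≤ K)
    (hb : ∀ x ∈ Set.Ioc (0 : ℝ) 1, |φ x| ≤ K * (1 - Real.log x)) :
    ∃ δ : ℝ, 0 < δ ∧
      Integrable (fun x => Real.exp (2 * δ * |φ x|)) (volume.restrict (Set.Ioc 0 1)) := by
  -- With this `δ` one has `2 δ (K + 1) = 1/2`, so the exponential is at most `e^{1/2} x^{-1/2}`.
  -- Using `K + 1` covers `K = 0`.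
  refine ⟨1 / (4 * (K + 1)), by positivity,
    (integrable_inv_sqrt.const_mul (Real.exp (1 / 2))).mono' (by fun_prop) ?_⟩
  filter_upwards [ae_restrict_mem measurableSet_Ioc] with x hx
  have hlog : Real.log x ≤ 0 := Real.log_nonpos hx.1.le hx.2
  rw [Real.norm_of_nonneg (Real.exp_nonneg _), Real.rpow_def_of_pos hx.1, ← Real.exp_add]
  refine Real.exp_le_exp.mpr ?_
  have h1 : |φ x| ≤ (K + 1) * (1 - Real.log x) := (hb x hx).trans (by nlinarith)
  calc 2 * (1 / (4 * (K + 1))) * |φ x|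
      ≤ 2 * (1 / (4 * (K + 1))) * ((K + 1) * (1 - Real.log x)) :=
        mul_le_mul_of_nonneg_left h1 (by positivity)
    _ = 1 / 2 + Real.log x * -(1 / 2) := by
        field_simp
        ring

theorem exists_integrable_exp_line {c : ℕ → ℝ} (hc : ∃ B : ℝ, ∀ n, 1 ≤ n → |c n| ≤ B) (a b : ℝ) :
    ∃ δ : ℝ, 0 < δ ∧ Integrable
      (fun x => Real.exp (2 * δ * |2 * a * Real.log x + b * psi c x|))
      (volume.restrict (Set.Ioc 0 1)) := by
  obtain ⟨K, hK0, hK⟩ := exists_abs_psi_le hc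
  refine exists_integrable_exp_of_log_bound (φ := fun x => 2 * a * Real.log x + b * psi c x)
    ((Real.measurable_log.const_mul _).add ((measurable_psi c).const_mul _))
    (K := 2 * |a| + |b| * K) (by positivity) fun x hx => ?_
  have hlog : Real.log x ≤ 0 := Real.log_nonpos hx.1.le hx.2
  refine (abs_add_le _ _).trans ?_
  rw [abs_mul, abs_mul, abs_mul, abs_two, abs_of_nonpos hlog]
  have h1 := mul_le_mul_of_nonneg_left (hK x hx) (abs_nonneg b)
  nlinarith [abs_nonneg a]

theorem integrable_log : Integrable Real.log (volume.restrict (Set.Ioc 0 1)) := by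
  have h := intervalIntegral.intervalIntegrable_log' (a := 0) (b := 1)
  rwa [intervalIntegrable_iff_integrableOn_Ioc_of_le zero_le_one] at h

/-! ### The Gauss measure -/

/-- The invariant measure of the Gauss map. -/
def gaussMeasure : Measure ℝ :=
  (volume.restrict (Set.Ioc 0 1)).withDensity fun x => (Real.toNNReal (xi x) : ENNReal)

theorem measurable_toNNReal_xi : Measurable fun x => Real.toNNReal (xi x) :=
  measurable_xi.real_toNNReal

section

variable {E : Type*} [NormedAddCommGroup E] [NormedSpace ℝ E]

theorem toNNReal_xi_smul_ae (F : ℝ → E) :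
    (fun x => Real.toNNReal (xi x) • F x) =ᵐ[volume.restrict (Set.Ioc 0 1)]
      fun x => xi x • F x := by
  filter_upwards [ae_restrict_mem measurableSet_Ioc] with x hx
  rw [NNReal.smul_def, Real.coe_toNNReal _ (xi_pos hx).le]

theorem integral_gaussMeasure (F : ℝ → E) :
    ∫ x, F x ∂gaussMeasure = ∫ x in Set.Ioc (0 : ℝ) 1, xi x • F x := by
  rw [gaussMeasure, integral_withDensity_eq_integral_smul measurable_toNNReal_xi]
  exact integral_congr_ae (toNNReal_xi_smul_ae F)

theorem integrable_gaussMeasure_iff {F : ℝ → E} :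
    Integrable F gaussMeasure ↔
      Integrable (fun x => xi x • F x) (volume.restrict (Set.Ioc 0 1)) := by
  rw [gaussMeasure, integrable_withDensity_iff_integrable_smul measurable_toNNReal_xi]
  exact integrable_congr (toNNReal_xi_smul_ae F)

theorem integrable_gaussMeasure {F : ℝ → E} (hF : Integrable F (volume.restrict (Set.Ioc 0 1))) :
    Integrable F gaussMeasure := by
  rw [integrable_gaussMeasure_iff]
  refine (hF.norm.const_mul (1 / Real.log 2)).mono'
    (measurable_xi.aestronglyMeasurable.smul hF.1) ?_
  filter_upwards [ae_restrict_mem measurableSet_Ioc] with x hx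
  rw [norm_smul, Real.norm_of_nonneg (xi_pos hx).le]
  exact mul_le_mul_of_nonneg_right (xi_le hx) (norm_nonneg _)

end

theorem ae_gaussMeasure_iff {p : ℝ → Prop} :
    (∀ᵐ x ∂gaussMeasure, p x) ↔ ∀ᵐ x ∂volume.restrict (Set.Ioc (0 : ℝ) 1), p x := by
  rw [gaussMeasure, ae_withDensity_iff measurable_toNNReal_xi.coe_nnreal_ennreal]
  refine eventually_congr ?_
  filter_upwards [ae_restrict_mem measurableSet_Ioc] with x hx
  have h : (Real.toNNReal (xi x) : ENNReal) ≠ 0 := by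
    simpa using xi_pos hx
  simp only [ne_eq, h, not_false_eq_true, forall_const]

theorem integral_evalAt_density_mul (F : ℝ → ℂ) :
    ∫ x in Set.Ioc (0 : ℝ) 1, evalAt x density * F x = ∫ x, F x ∂gaussMeasure := by
  rw [integral_gaussMeasure]
  refine setIntegral_congr_fun measurableSet_Ioc fun x hx => ?_
  rw [evalAt_density_real (Set.Ioc_subset_Icc_self hx), Complex.real_smul]

instance : IsProbabilityMeasure gaussMeasure := by
  have h1 : Integrable (fun _ : ℝ => (1 : ℝ)) gaussMeasure :=
    integrable_gaussMeasure (integrable_const _)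
  have h2 : IsFiniteMeasure gaussMeasure := by
    rw [integrable_const_iff] at h1
    simpa using h1
  have h3 := integral_gaussMeasure (fun _ : ℝ => (1 : ℝ))
  simp only [smul_eq_mul, mul_one, integral_xi] at h3
  rw [integral_const, smul_eq_mul, mul_one] at h3
  refine ⟨?_⟩
  rw [← ENNReal.toReal_eq_one_iff]
  exact h3

theorem measurePreserving_gaussMap : MeasurePreserving gaussMap gaussMeasure gaussMeasure := by
  refine ⟨measurable_gaussMap, ?_⟩
  ext A hA
  rw [Measure.map_apply measurable_gaussMap hA]
  -- At `(1, 0)` the cost plays no role, so zero cost serves. Duality tested on indicators turns the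
  -- fixed density into an invariant measure.
  have hc : ∃ B : ℝ, ∀ n : ℕ, 1 ≤ n → |(fun _ : ℕ => (0 : ℝ)) n| ≤ B := ⟨0, by simp⟩
  have h1 := integral_transferOperator_one_zero_mul hc density
    (g := A.indicator fun _ => (1 : ℂ)) (measurable_const.indicator hA)
    ⟨1, fun x => by
      refine (norm_indicator_le_norm_self _ _).trans ?_
      simp⟩
  rw [transferOperator_density hc, integral_evalAt_density_mul,
    integral_evalAt_density_mul (fun y => A.indicator (fun _ => (1 : ℂ)) (gaussMap y))] at h1
  have h2 : (fun y => A.indicator (fun _ => (1 : ℂ)) (gaussMap y)) =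
      (gaussMap ⁻¹' A).indicator fun _ => (1 : ℂ) := rfl
  rw [h2, integral_indicator_const _ hA, integral_indicator_const _ (measurable_gaussMap hA)] at h1
  simp only [Complex.real_smul, mul_one] at h1
  have h3 : gaussMeasure.real A = gaussMeasure.real (gaussMap ⁻¹' A) := by exact_mod_cast h1
  rw [measureReal_def, measureReal_def] at h3
  exact ((ENNReal.toReal_eq_toReal_iff' (measure_ne_top _ _) (measure_ne_top _ _)).mp h3).symm

/-! ### Entropy and mean -/

theorem deriv_gaussMap {m : ℕ} {x : ℝ}
    (hx : x ∈ Set.Ioo (1 / ((m : ℝ) + 2)) (1 / ((m : ℝ) + 1))) :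
    deriv gaussMap x = -(x ^ 2)⁻¹ := by
  have hx0 : 0 < x := lt_trans (by positivity) hx.1
  have hev : gaussMap =ᶠ[𝓝 x] fun y => y⁻¹ - ((m : ℝ) + 1) := by
    filter_upwards [Ioo_mem_nhds hx.1 hx.2] with y hy
    have hy0 : 0 < y := lt_trans (by positivity) hy.1
    have h1 := floor_one_div_of_mem (Set.Ioo_subset_Ioc_self hy)
    have h2 : ⌊1 / y⌋ = ((m + 1 : ℕ) : ℤ) := by
      rw [← h1, Int.natCast_floor_eq_floor (by positivity)]
    rw [gaussMap, h2]
    push_cast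
    rw [one_div]
  rw [hev.deriv_eq]
  exact ((hasDerivAt_inv hx0.ne').sub_const _).deriv

/-- Off the countable set of endpoints `1/n`, `T` is locally `1/x - n` and `|T'| = x^{-2}`. -/
theorem ae_log_deriv_gaussMap : ∀ᵐ x ∂volume.restrict (Set.Ioc (0 : ℝ) 1),
    Real.log |deriv gaussMap x| = -2 * Real.log x := by
  have hcount : (Set.range fun m : ℕ => 1 / ((m : ℝ) + 1)).Countable := Set.countable_range _
  filter_upwards [ae_restrict_mem measurableSet_Ioc,
    ae_restrict_of_ae (hcount.ae_notMem volume)] with x hx hxn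
  rw [← iUnion_Ioc_one_div] at hx
  obtain ⟨m, hm⟩ := Set.mem_iUnion.mp hx
  have hlt : x < 1 / ((m : ℝ) + 1) := lt_of_le_of_ne hm.2 fun h => hxn ⟨m, h.symm⟩
  rw [deriv_gaussMap ⟨hm.1, hlt⟩, abs_neg, Real.log_abs, Real.log_inv, Real.log_pow]
  push_cast
  ring

theorem entropy_eq : entropy = -2 * ∫ x in Set.Ioc (0 : ℝ) 1, Real.log x * xi x := by
  rw [entropy, intervalIntegral.integral_of_le zero_le_one, ← integral_const_mul]
  refine integral_congr_ae ?_
  filter_upwards [ae_log_deriv_gaussMap] with x hx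
  rw [hx]
  ring

theorem integrable_mul_xi {F : ℝ → ℝ} (hF : Integrable F (volume.restrict (Set.Ioc 0 1))) :
    Integrable (fun x => F x * xi x) (volume.restrict (Set.Ioc 0 1)) := by
  have h := integrable_gaussMeasure_iff.mp (integrable_gaussMeasure hF)
  simpa only [smul_eq_mul, mul_comm] using h

theorem entropy_pos : 0 < entropy := by
  have hi := (integrable_mul_xi integrable_log).const_mul (-1)
  have h := intervalIntegral.intervalIntegral_pos_of_pos_on
    (f := fun x => -1 * (Real.log x * xi x)) (a := 0) (b := 1)
    ((intervalIntegrable_iff_integrableOn_Ioc_of_le zero_le_one).mpr hi) (fun x hx => by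
      have h1 : Real.log x < 0 := Real.log_neg hx.1 hx.2
      have h2 := xi_pos (Set.Ioo_subset_Ioc_self hx)
      nlinarith) zero_lt_one
  rw [intervalIntegral.integral_of_le zero_le_one, integral_const_mul] at h
  rw [entropy_eq]
  linarith

theorem measurable_cost (c : ℕ → ℝ) : Measurable fun x : ℝ => c ⌊1 / x⌋₊ := by
  have h1 : Measurable fun x : ℝ => 1 / x := by fun_prop
  exact (measurable_from_top (f := c)).comp (Nat.measurable_floor.comp h1)

theorem integrable_cost {c : ℕ → ℝ} (hc : ∃ B : ℝ, ∀ n, 1 ≤ n → |c n| ≤ B) :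
    Integrable (fun x : ℝ => c ⌊1 / x⌋₊) (volume.restrict (Set.Ioc 0 1)) := by
  obtain ⟨B, hB⟩ := hc
  refine Integrable.of_bound (measurable_cost c).aestronglyMeasurable B ?_
  filter_upwards [ae_restrict_mem measurableSet_Ioc] with x hx
  exact hB _ (Nat.le_floor (by
    rw [Nat.cast_one, one_le_div hx.1]
    exact hx.2))

theorem hasSum_cost {c : ℕ → ℝ} (hc : ∃ B : ℝ, ∀ n, 1 ≤ n → |c n| ≤ B) :
    HasSum (fun m : ℕ => c (m + 1) * ∫ x in (1 / ((m : ℝ) + 2))..(1 / ((m : ℝ) + 1)), xi x)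
      (∫ x in Set.Ioc (0 : ℝ) 1, c ⌊1 / x⌋₊ * xi x) := by
  refine (hasSum_integral_Ioc_one_div (integrable_mul_xi (integrable_cost hc))).congr_fun
    fun m => ?_
  rw [intervalIntegral.integral_of_le (one_div_le_one_div_of_le (by positivity) (by linarith)),
    ← integral_const_mul]
  refine setIntegral_congr_fun measurableSet_Ioc fun x hx => ?_
  rw [floor_one_div_of_mem hx]

theorem mean_eq {c : ℕ → ℝ} (hc : ∃ B : ℝ, ∀ n, 1 ≤ n → |c n| ≤ B) :
    mean c = 2 / entropy * ∫ x in Set.Ioc (0 : ℝ) 1, c ⌊1 / x⌋₊ * xi x := by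
  rw [mean, (hasSum_cost hc).tsum_eq]

theorem integral_xi_branch_pos (m : ℕ) :
    0 < ∫ x in (1 / ((m : ℝ) + 2))..(1 / ((m : ℝ) + 1)), xi x := by
  have hlt : 1 / ((m : ℝ) + 2) < 1 / ((m : ℝ) + 1) :=
    one_div_lt_one_div_of_lt (by positivity) (by linarith)
  have hsub : Set.Ioc (1 / ((m : ℝ) + 2)) (1 / ((m : ℝ) + 1)) ⊆ Set.Ioc 0 1 := by
    rw [← iUnion_Ioc_one_div]
    exact Set.subset_iUnion (fun m : ℕ => Set.Ioc (1 / ((m : ℝ) + 2)) (1 / ((m : ℝ) + 1))) m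
  have hi : IntegrableOn xi (Set.Ioc 0 1) := by
    have h := integrable_mul_xi (F := fun _ => 1) (integrable_const _)
    simp only [one_mul] at h
    exact h
  exact intervalIntegral.intervalIntegral_pos_of_pos_on
    ((intervalIntegrable_iff_integrableOn_Ioc_of_le hlt.le).mpr (hi.mono_set hsub))
    (fun x hx => xi_pos (hsub (Set.Ioo_subset_Ioc_self hx))) hlt

theorem mean_pos {c : ℕ → ℝ} (hc : ∃ B : ℝ, ∀ n, 1 ≤ n → |c n| ≤ B)
    (hc0 : ∀ n, 1 ≤ n → 0 ≤ c n) (hne : ∃ n, 1 ≤ n ∧ c n ≠ 0) : 0 < mean c := by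
  obtain ⟨n, hn, hcn⟩ := hne
  obtain ⟨m, rfl⟩ : ∃ m, n = m + 1 := ⟨n - 1, by omega⟩
  rw [mean]
  refine mul_pos (div_pos two_pos entropy_pos) ((hasSum_cost hc).summable.tsum_pos
    (fun k => mul_nonneg (hc0 _ (by omega)) (integral_xi_branch_pos k).le) m
    (mul_pos (lt_of_le_of_ne (hc0 _ hn) hcn.symm) (integral_xi_branch_pos m)))

/-- Since `∫ log · ξ = -𝔥(T)/2`, the factor `2/𝔥(T)` in the definition of `μ` is exactly what
centres `ψ`. -/
theorem integral_psi {c : ℕ → ℝ} (hc : ∃ B : ℝ, ∀ n, 1 ≤ n → |c n| ≤ B) :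
    ∫ x, psi c x ∂gaussMeasure = 0 := by
  rw [integral_gaussMeasure]
  have h1 : ∫ x in Set.Ioc (0 : ℝ) 1, xi x • psi c x =
      ∫ x in Set.Ioc (0 : ℝ) 1, (c ⌊1 / x⌋₊ * xi x + mean c * (Real.log x * xi x)) := by
    refine setIntegral_congr_fun measurableSet_Ioc fun x hx => ?_
    simp only [smul_eq_mul]
    rw [psi_of_mem hx]
    ring
  rw [h1, integral_add (integrable_mul_xi (integrable_cost hc))
    ((integrable_mul_xi integrable_log).const_mul _), integral_const_mul]
  have h2 := mean_eq hc
  have h3 := entropy_eq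
  have h4 := entropy_pos.ne'
  have h5 : entropy * mean c = 2 * ∫ x in Set.Ioc (0 : ℝ) 1, c ⌊1 / x⌋₊ * xi x := by
    rw [h2]
    field_simp
  have h6 : ∫ x in Set.Ioc (0 : ℝ) 1, Real.log x * xi x = -entropy / 2 := by linarith
  rw [h6]
  linarith

theorem memLp_psi {c : ℕ → ℝ} (hc : ∃ B : ℝ, ∀ n, 1 ≤ n → |c n| ≤ B) :
    MemLp (psi c) 2 gaussMeasure := by
  obtain ⟨K, hK0, hK⟩ := exists_abs_psi_le hc
  obtain ⟨δ, hδ, hint⟩ := exists_integrable_exp_of_log_bound (measurable_psi c) hK0 hK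
  rw [memLp_two_iff_integrable_sq (measurable_psi c).aestronglyMeasurable]
  refine integrable_gaussMeasure ((integrable_pow_mul_exp hδ (measurable_psi c) hint 2).mono'
    ((measurable_psi c).pow_const 2).aestronglyMeasurable (Eventually.of_forall fun x => ?_))
  rw [norm_pow, Real.norm_eq_abs]
  exact le_mul_of_one_le_right (by positivity) (Real.one_le_exp (by positivity))

/-- `ψ` is not a bounded function. -/
theorem not_ae_abs_psi_le {c : ℕ → ℝ} (hc : ∃ B : ℝ, ∀ n, 1 ≤ n → |c n| ≤ B)
    (hmean : 0 < mean c) (C : ℝ) : ¬ ∀ᵐ x ∂gaussMeasure, |psi c x| ≤ C := by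
  rw [ae_gaussMeasure_iff]
  intro h
  obtain ⟨B, hB⟩ := hc
  -- Below this `ε` one has `μ log x ≤ -(C + B + 1)`, hence `ψ ≤ -C - 1` because the cost is at most
  -- `B`.
  set ε := min 1 (Real.exp (-(C + B + 1) / mean c)) with hε
  have hε0 : 0 < ε := lt_min one_pos (Real.exp_pos _)
  have hsub : Set.Ioo 0 ε ⊆ Set.Ioc 0 1 := fun x hx => ⟨hx.1, hx.2.le.trans (min_le_left _ _)⟩
  have h1 : ∀ᵐ x ∂volume.restrict (Set.Ioo 0 ε), False := by
    filter_upwards [ae_restrict_of_ae_restrict_of_subset hsub h,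
      ae_restrict_mem measurableSet_Ioo] with x hx hxm
    have hx1 := hsub hxm
    rw [psi_of_mem hx1] at hx
    have h2 := hB ⌊1 / x⌋₊ (Nat.le_floor (by
      rw [Nat.cast_one, one_le_div hx1.1]
      exact hx1.2))
    have h3 : Real.log x ≤ -(C + B + 1) / mean c := by
      rw [Real.log_le_iff_le_exp hx1.1]
      exact hxm.2.le.trans (min_le_right _ _)
    rw [le_div_iff₀ hmean] at h3
    have h4 := (abs_le.mp hx).1
    have h5 := (abs_le.mp h2).2
    linarith
  rw [eventually_false_iff_eq_bot, ae_eq_bot, Measure.restrict_eq_zero, Real.volume_Ioo] at h1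
  simp at h1
  linarith

end GaussEuclid

end

/-! ### The variance formula and its positivity. -/

noncomputable section

namespace GaussEuclid

/-- The quotient of an element of `H^∞(𝔻)` by the Gauss density, on the unit interval. -/
theorem exists_bounded_quotient (f : Hinf) : ∃ w : ℝ → ℂ, Measurable w ∧ (∃ D, ∀ x, ‖w x‖ ≤ D) ∧
    ∀ F : ℝ → ℂ, ∫ x in Set.Ioc (0 : ℝ) 1, evalAt x f * F x = ∫ x, w x * F x ∂gaussMeasure := by
  have hl := Real.log_pos one_lt_two
  have hcont : ContinuousOn (fun x : ℝ => evalAt x f / evalAt x density) (Set.Ioc 0 1) :=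
    ((continuousOn_evalAt_real f).div (continuousOn_evalAt_real density) fun x hx =>
      evalAt_density_ne_zero (mem_disc_of_mem_Icc hx)).mono Set.Ioc_subset_Icc_self
  classical
  refine ⟨(Set.Ioc (0 : ℝ) 1).piecewise (fun x => evalAt x f / evalAt x density) fun _ => 0,
    hcont.measurable_piecewise continuousOn_const measurableSet_Ioc,
    -- On the unit interval `ξ ≥ 1/(2 log 2)`, so division by `ξ` keeps `f` bounded.
    ⟨‖f‖ * (2 * Real.log 2), fun x => ?_⟩, fun F => ?_⟩
  · by_cases hx : x ∈ Set.Ioc (0 : ℝ) 1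
    · rw [Set.piecewise_eq_of_mem _ _ _ hx, norm_div,
        evalAt_density_real (Set.Ioc_subset_Icc_self hx), Complex.norm_real,
        Real.norm_of_nonneg (xi_pos hx).le, div_le_iff₀ (xi_pos hx)]
      have h1 := le_xi hx
      rw [div_le_iff₀ (by positivity)] at h1
      calc ‖evalAt x f‖ ≤ ‖f‖ * 1 := by rw [mul_one]; exact norm_evalAt_le _ _
        _ ≤ ‖f‖ * (xi x * (2 * Real.log 2)) := by gcongr
        _ = _ := by ring
    · rw [Set.piecewise_eq_of_notMem _ _ _ hx, norm_zero]
      positivity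
  · rw [integral_gaussMeasure]
    refine setIntegral_congr_fun measurableSet_Ioc fun x hx => ?_
    have h0 : (xi x : ℂ) ≠ 0 := by exact_mod_cast (xi_pos hx).ne'
    rw [Set.piecewise_eq_of_mem _ _ _ hx, Complex.real_smul,
      evalAt_density_real (Set.Ioc_subset_Icc_self hx)]
    field_simp

theorem integral_sq_sum_psi_mul_xi (c : ℕ → ℝ) (n : ℕ) :
    ∫ x in (0 : ℝ)..1, (∑ k ∈ Finset.range n, psi c (gaussMap^[k] x)) ^ 2 * xi x =
      ∫ x, (∑ k ∈ Finset.range n, psi c (gaussMap^[k] x)) ^ 2 ∂gaussMeasure := by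
  rw [integral_gaussMeasure, intervalIntegral.integral_of_le zero_le_one]
  simp only [smul_eq_mul, mul_comm]

theorem intervalIntegrable_sq_sum_psi {c : ℕ → ℝ} (hc : ∃ B : ℝ, ∀ n, 1 ≤ n → |c n| ≤ B) (n : ℕ) :
    IntervalIntegrable (fun x : ℝ =>
      (∑ k ∈ Finset.range n, psi c (gaussMap^[k] x)) ^ 2 * xi x) volume 0 1 := by
  rw [intervalIntegrable_iff_integrableOn_Ioc_of_le zero_le_one]
  have h := integrable_gaussMeasure_iff.mp
    (memLp_sum_iterate measurePreserving_gaussMap (memLp_psi hc) n).integrable_sq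
  simp only [smul_eq_mul, mul_comm (xi _)] at h
  exact h

section Leading

variable {c : ℕ → ℝ} {V : Set (ℂ × ℂ)} {lam : ℂ × ℂ → ℂ} {P N : ℂ × ℂ → (Hinf →L[ℂ] Hinf)}

theorem IsLeadingDecomposition.hasDerivAt_fst (hd : IsLeadingDecomposition c V lam P N) :
    HasDerivAt (fun s : ℂ => lam (s, 0)) (-(entropy : ℂ)) 1 := by
  have hc := (hd.admissible _ hd.mem).1
  obtain ⟨δ, hδ, hint⟩ := exists_integrable_exp_line hc 1 0
  obtain ⟨f₁, ha, h1, -, -⟩ := hd.exists_derivatives 1 0 rfl hδ hint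
  have h2 : ∫ x in Set.Ioc (0 : ℝ) 1,
      evalAt x density * ((2 * 1 * Real.log x + 0 * psi c x : ℝ) : ℂ) = -(entropy : ℂ) := by
    rw [entropy_eq, ← integral_const_mul, ← Complex.ofReal_neg, ← integral_neg,
      ← integral_complex_ofReal]
    refine setIntegral_congr_fun measurableSet_Ioc fun x hx => ?_
    rw [evalAt_density_real (Set.Ioc_subset_Icc_self hx)]
    push_cast
    ring
  have h3 := ha.differentiableAt.hasDerivAt
  rw [h1, h2] at h3
  -- The base point is written `1 - 1` to match the substitution `t = s - 1`.
  have h4 : HasDerivAt (fun t : ℂ => lam (1 + (1 : ℝ) * t, (0 : ℝ) * t)) (-(entropy : ℂ))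
      ((1 : ℂ) - 1) := by rwa [sub_self]
  have h5 := h4.comp_sub_const (1 : ℂ) 1
  simpa using h5

theorem IsLeadingDecomposition.exists_snd_derivatives (hd : IsLeadingDecomposition c V lam P N) :
    HasDerivAt (fun o : ℂ => lam (1, o)) 0 0 ∧ ∃ w : ℝ → ℂ, Measurable w ∧
      (∃ D, ∀ x, ‖w x‖ ≤ D) ∧
      iteratedDeriv 2 (fun o : ℂ => lam (1, o)) 0 =
        (∫ x, (psi c x : ℂ) ^ 2 ∂gaussMeasure) + 2 * ∫ x, w x * psi c x ∂gaussMeasure ∧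
      ∀ g : ℝ → ℂ, Measurable g → (∃ C, ∀ x, ‖g x‖ ≤ C) →
        ∫ x, w x * g x ∂gaussMeasure =
          (∫ x, w x * g (gaussMap x) ∂gaussMeasure) +
            ∫ x, psi c x * g (gaussMap x) ∂gaussMeasure := by
  have hc := (hd.admissible _ hd.mem).1
  obtain ⟨δ, hδ, hint⟩ := exists_integrable_exp_line hc 0 1
  obtain ⟨f₁, ha, h1, h2, h3⟩ := hd.exists_derivatives 0 1
    (φ := psi c) (by funext x; ring) hδ (by simpa using hint)
  simp only [Complex.ofReal_zero, zero_mul, add_zero, Complex.ofReal_one, one_mul] at ha h1 h2 h3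
  have h4 : ∫ x in Set.Ioc (0 : ℝ) 1, evalAt x density * (psi c x : ℂ) = 0 := by
    rw [integral_evalAt_density_mul (fun x => (psi c x : ℂ)), integral_complex_ofReal,
      integral_psi hc, Complex.ofReal_zero]
  rw [h4] at h1
  have h5 := ha.differentiableAt.hasDerivAt
  rw [h1] at h5
  obtain ⟨w, hwm, hwb, hw⟩ := exists_bounded_quotient f₁
  refine ⟨h5, w, hwm, hwb, ?_, fun g hg hgb => ?_⟩
  · rw [h2, hw fun x => (psi c x : ℂ), integral_evalAt_density_mul fun x => (psi c x : ℂ) ^ 2]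
  · have h6 := h3 g hg hgb
    rwa [h1, zero_mul, zero_add, hw g, hw fun x => g (gaussMap x),
      integral_evalAt_density_mul fun x => (psi c x : ℂ) * g (gaussMap x)] at h6

theorem IsLeadingDecomposition.exists_variance (hd : IsLeadingDecomposition c V lam P N)
    (hmean : 0 < mean c) : HasDerivAt (fun o : ℂ => lam (1, o)) 0 0 ∧ ∃ v : ℝ,
      Tendsto (fun n : ℕ => 1 / (n : ℝ) *
        ∫ x, (∑ k ∈ Finset.range n, psi c (gaussMap^[k] x)) ^ 2 ∂gaussMeasure) atTop (𝓝 v) ∧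
      iteratedDeriv 2 (fun o : ℂ => lam (1, o)) 0 = (v : ℂ) ∧ 0 < v := by
  have hc := (hd.admissible _ hd.mem).1
  obtain ⟨hder, w, hwm, ⟨D, hD⟩, hsec, horth⟩ := hd.exists_snd_derivatives
  refine ⟨hder, ?_⟩
  have hψ := memLp_psi hc
  have hT := measurePreserving_gaussMap
  set h : ℝ → ℝ := fun x => (w x).re with hh_def
  set k : ℝ → ℝ := fun x => (w x).im with hk_def
  have hhm : Measurable h := Complex.measurable_re.comp hwm
  have hkm : Measurable k := Complex.measurable_im.comp hwm
  have hhb : ∀ x, |h x| ≤ D := fun x => (Complex.abs_re_le_norm _).trans (hD x)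
  have hkb : ∀ x, |k x| ≤ D := fun x => (Complex.abs_im_le_norm _).trans (hD x)
  have hhL : MemLp h 2 gaussMeasure :=
    MemLp.of_bound hhm.aestronglyMeasurable D (Eventually.of_forall hhb)
  have hkL : MemLp k 2 gaussMeasure :=
    MemLp.of_bound hkm.aestronglyMeasurable D (Eventually.of_forall hkb)
  have hsplit : ∀ F : ℝ → ℝ, MemLp F 2 gaussMeasure → ∫ x, w x * F x ∂gaussMeasure =
      ((∫ x, h x * F x ∂gaussMeasure : ℝ) : ℂ) +
        ((∫ x, k x * F x ∂gaussMeasure : ℝ) : ℂ) * Complex.I := by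
    intro F hF
    have i1 : Integrable (fun x => h x * F x) gaussMeasure := hhL.integrable_mul hF
    have i2 : Integrable (fun x => k x * F x) gaussMeasure := hkL.integrable_mul hF
    rw [← integral_complex_ofReal, ← integral_complex_ofReal, ← integral_mul_const,
      ← integral_add i1.ofReal (i2.ofReal.mul_const _)]
    refine integral_congr_ae (Eventually.of_forall fun x => ?_)
    simp only [hh_def, hk_def]
    conv_lhs => rw [← Complex.re_add_im (w x)]
    push_cast
    ring
  -- For real `g`, real and imaginary parts separate: the real part of `w` corrects `ψ` to a
  -- reversed martingale difference, the imaginary part is invariant.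
  have hboth : ∀ g : ℝ → ℝ, Measurable g → (∃ C, ∀ x, |g x| ≤ C) →
      ∫ x, (psi c x + h x) * g (gaussMap x) ∂gaussMeasure = ∫ x, h x * g x ∂gaussMeasure ∧
      ∫ x, k x * g (gaussMap x) ∂gaussMeasure = ∫ x, k x * g x ∂gaussMeasure := by
    intro g hg ⟨C, hC⟩
    have hgL : MemLp g 2 gaussMeasure :=
      MemLp.of_bound hg.aestronglyMeasurable C (Eventually.of_forall hC)
    have hgT : MemLp (fun x => g (gaussMap x)) 2 gaussMeasure := hgL.comp_measurePreserving hT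
    have h1 := horth (fun x => (g x : ℂ)) (Complex.measurable_ofReal.comp hg)
      ⟨C, fun x => by rw [Complex.norm_real]; exact hC x⟩
    rw [hsplit g hgL, hsplit (fun x => g (gaussMap x)) hgT] at h1
    have h2 : ∫ x, (psi c x : ℂ) * (g (gaussMap x) : ℂ) ∂gaussMeasure =
        ((∫ x, psi c x * g (gaussMap x) ∂gaussMeasure : ℝ) : ℂ) := by
      rw [← integral_complex_ofReal]
      simp only [Complex.ofReal_mul]
    rw [h2] at h1
    have hre := congrArg Complex.re h1
    have him := congrArg Complex.im h1
    simp at hre him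
    refine ⟨?_, him.symm⟩
    have i1 : Integrable (fun x => psi c x * g (gaussMap x)) gaussMeasure := hψ.integrable_mul hgT
    have i2 : Integrable (fun x => h x * g (gaussMap x)) gaussMeasure := hhL.integrable_mul hgT
    simp_rw [add_mul]
    rw [integral_add i1 i2, hre, add_comm]
  have horth' := fun g hg hgb => (hboth g hg hgb).1
  obtain ⟨hlim, hval⟩ := tendsto_variance_of_martingale_coboundary hT (measurable_psi c) hψ hhm hhb
    horth'
  have hk0 := integral_mul_eq_zero_of_invariant hT hψ hhm hhb horth' hkm hkb
    fun g hg hgb => (hboth g hg hgb).2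
  refine ⟨_, hlim, ?_, ?_⟩
  · rw [hsec, hsplit _ hψ, hval]
    have e1 : ∫ x, k x * psi c x ∂gaussMeasure = 0 := by
      rw [← hk0]
      simp only [mul_comm]
    have e2 : ∫ x, h x * psi c x ∂gaussMeasure = ∫ x, psi c x * h x ∂gaussMeasure := by
      simp only [mul_comm]
    have e3 : ∫ x, (psi c x : ℂ) ^ 2 ∂gaussMeasure = ((∫ x, psi c x ^ 2 ∂gaussMeasure : ℝ) : ℂ) := by
      rw [← integral_complex_ofReal]
      simp only [Complex.ofReal_pow]
    rw [e1, e2, e3]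
    push_cast
    ring
  -- Zero variance would make `ψ` a coboundary of the bounded function `h`, so `|ψ| ≤ 2D` almost
  -- everywhere, which is impossible.
  · refine lt_of_le_of_ne (integral_nonneg fun x => sq_nonneg _) fun h0 => ?_
    have hhT : MemLp (fun x => h (gaussMap x)) 2 gaussMeasure := hhL.comp_measurePreserving hT
    have hi : Integrable (fun x => (psi c x + h x - h (gaussMap x)) ^ 2) gaussMeasure :=
      ((hψ.add hhL).sub hhT).integrable_sq
    have h1 := (integral_eq_zero_iff_of_nonneg (fun x => sq_nonneg _) hi).mp h0.symm
    refine not_ae_abs_psi_le hc hmean (2 * D) ?_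
    filter_upwards [h1] with x hx
    have h2 : psi c x + h x - h (gaussMap x) = 0 := pow_eq_zero_iff two_ne_zero |>.mp hx
    have h3 := abs_le.mp (hhb x)
    have h4 := abs_le.mp (hhb (gaussMap x))
    rw [abs_le]
    constructor <;> linarith

end Leading

end GaussEuclid

end

theorem mainTheorem4 (c : ℕ → ℝ)
    (hc_nonneg : ∀ n, 1 ≤ n → 0 ≤ c n)
    (hc_bdd : ∃ B : ℝ, ∀ n, 1 ≤ n → c n ≤ B)
    (hc_ne : ∃ n, 1 ≤ n ∧ c n ≠ 0) :
    (∃ (V : Set (ℂ × ℂ)) (lam : ℂ × ℂ → ℂ)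
        (P N : ℂ × ℂ → (GaussEuclid.Hinf →L[ℂ] GaussEuclid.Hinf)),
      GaussEuclid.IsLeadingDecomposition c V lam P N) ∧
    ∀ (V : Set (ℂ × ℂ)) (lam : ℂ × ℂ → ℂ)
        (P N : ℂ × ℂ → (GaussEuclid.Hinf →L[ℂ] GaussEuclid.Hinf)),
      GaussEuclid.IsLeadingDecomposition c V lam P N →
        HasDerivAt (fun s : ℂ => lam (s, 0)) (-(GaussEuclid.entropy : ℂ)) 1 ∧
        -GaussEuclid.entropy < 0 ∧
        HasDerivAt (fun ω : ℂ => lam (1, ω)) 0 0 ∧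
        (∀ n : ℕ, IntervalIntegrable (fun x : ℝ =>
          (∑ k ∈ Finset.range n, GaussEuclid.psi c (GaussEuclid.gaussMap^[k] x)) ^ 2 *
            GaussEuclid.xi x) volume 0 1) ∧
        ∃ v : ℝ,
          Tendsto (fun n : ℕ => 1 / (n : ℝ) * ∫ x in (0 : ℝ)..1,
            (∑ k ∈ Finset.range n, GaussEuclid.psi c (GaussEuclid.gaussMap^[k] x)) ^ 2 *
              GaussEuclid.xi x) atTop (𝓝 v) ∧
          iteratedDeriv 2 (fun ω : ℂ => lam (1, ω)) 0 = (v : ℂ) ∧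
          0 < v := by
  have hc : ∃ B : ℝ, ∀ n, 1 ≤ n → |c n| ≤ B := by
    obtain ⟨B, hB⟩ := hc_bdd
    exact ⟨B, fun n hn => by rw [abs_of_nonneg (hc_nonneg n hn)]; exact hB n hn⟩
  refine ⟨GaussEuclid.exists_isLeadingDecomposition hc, fun V lam P N hd => ?_⟩
  obtain ⟨h1, h2⟩ := hd.exists_variance (GaussEuclid.mean_pos hc hc_nonneg hc_ne)
  refine ⟨hd.hasDerivAt_fst, neg_lt_zero.mpr GaussEuclid.entropy_pos, h1,
    GaussEuclid.intervalIntegrable_sq_sum_psi hc, ?_⟩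
  simp_rw [GaussEuclid.integral_sq_sum_psi_mul_xi]
  exact h2
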